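/- **Setting.** Fix a sensible computable coding of pairs $\langle p,q\rangle$ and tagged unions $\mathsf{in}_1,\mathsf{in}_2$ on Baire space $\mathbb N^{\mathbb N}$ and a recursive point $\star$. Write $c\cdot p$ for partial application in Kleene's second algebra; computable partial maps on $\mathbb N^{\mathbb N}$ are those realized by a recursive $c$. An *(extended) problem* $P$ is a set $\operatorname{dom}(P)\subseteq\mathbb N^{\mathbb N}$ with a set $P(u)\subseteq\mathbb N^{\mathbb N}$ for each $u\in\operatorname{dom}(P)$. It is a *Weihrauch problem* if $P(u)\ne\emptyset$ for all $u\in\operatorname{dom}(P)$, and *pointed* if $\operatorname{dom}(P)$ has a recursive element. $P\le_W Q$ means that there are computable $\varphi,\psi$ such that for all $u\in\operatorname{dom}(P)$, $\varphi(u)\in\operatorname{dom}(Q)$ and $\psi(\langle u,y\rangle)\in P(u)$ for all $y\in Q(\varphi(u))$. Operators: $\operatorname{dom}(0)=\emptyset$; $\operatorname{dom}(\top)=\operatorname{dom}(1)=\{\star\}$, $\top(\star)=\emptyset$, $1(\star)=\{\star\}$; $P\sqcup Q$ has instances $\mathsf{in}_1(u)$, $u\in\operatorname{dom}(P)$, with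 solutions $P(u)$, and $\mathsf{in}_2(v)$, $v\in\operatorname{dom}(Q)$, with solutions $Q(v)$; $P\sqcap Q$ has instances $\langle u,v\rangle$ with $u\in\operatorname{dom}(P)$, $v\in\operatorname{dom}(Q)$, and solutions $\mathsf{in}_1(x)$, $x\in P(u)$, and $\mathsf{in}_2(y)$, $y\in Q(v)$; $P\star Q$ (first $Q$, then $P$) has instances $\langle u,c\rangle$ with $u\in\operatorname{dom}(Q)$ and $c\cdot x\in\operatorname{dom}(P)$ for all $x\in Q(u)$, and solutions $\langle x,y\rangle$ with $x\in Q(u)$, $y\in P(c\cdot x)$; $\operatorname{dom}(P^\diamond)$ is the least set containing $\mathsf{in}_1(\star)$, and containing $\mathsf{in}_2\langle u,c\rangle$ whenever $u\in\operatorname{dom}(P)$ and $c\cdot x\in\operatorname{dom}(P^\diamond)$ for all $x\in P(u)$; $P^\diamond(\mathsf{in}_1(\star))=\{\star\}$ and $P^\diamond(\mathsf{in}_2\langle u,c\rangle)=\{\langle x,y\rangle : x\in P(u),\ y\in P^\diamond(c\cdot x)\}$. Let $\Sigma$ be a finite alphabet and let $\mathrm{RegE}(\Sigma)$ be the set of terms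 generated by $e,f ::= a\in\Sigma \mid 0\mid e\sqcup f\mid\top\mid e\sqcap f\mid 1\mid e\star f\mid e^\diamond$. The inequation $e\le f$ is *valid in the pointed Weihrauch degrees* if $[\![e]\!]_\rho\le_W[\![f]\!]_\rho$ for every $\rho$ assigning a pointed Weihrauch problem to each letter, where $[\![\cdot]\!]_\rho$ interprets terms through the operators above. **Terms as automata.** The relation $\to$ on terms is generated by $e\sqcup f\to e$, $e\sqcup f\to f$, $e\sqcap f\to e$, $e\sqcap f\to f$, $a\to 1$ ($a \in \Sigma$), $e\star 1\to e$, $e^\diamond\to 1$, $e^\diamond\to e^\diamond\star e$, and $g\star e\to g\star f$ whenever $e\to f$. Polarities: $\mathrm{pol}(e\sqcup f)=\mathrm{pol}(0)=\mathrm{pol}(1)=\mathrm{pol}(e^\diamond)=\exists$, $\mathrm{pol}(e\sqcap f)=\mathrm{pol}(\top)=\forall$, $\mathrm{pol}(a)=?_a$, $\mathrm{pol}(e\star f)=\mathrm{pol}(f)$. **The pointed simulation game $\mathcal G_\bullet$.** Positions are pairs $(X\dashv e)$ with $X$ a finite set of terms and $e$ a term. A position belongs to Spoiler ($\forall$) if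 some $t\in X\setminus\{1\}$ has polarity $\exists$ or $\forall$, or if $e=1$ and $1\in X$, or if $\mathrm{pol}(e)=\forall$; all other positions belong to Duplicator ($\exists$). The moves are: - *explore*: $(X\uplus\{t\}\dashv e)\to(X\cup\{t'\}\dashv e)$ if $\mathrm{pol}(t)=\exists$ and $t\to t'$; - *fork*: $(X\uplus\{t\}\dashv e)\to(X\cup\{t' : t\to t'\}\dashv e)$ if $\mathrm{pol}(t)=\forall$; - *alea*: $(X\dashv e)\to(X\dashv e')$ if $\mathrm{pol}(e)=\forall$, $e\to e'$, and no $t\in X\setminus\{1\}$ has polarity $\exists$ or $\forall$; - *choose*: $(X\dashv e)\to(X\dashv e')$ at Duplicator positions, if $\mathrm{pol}(e)=\exists$ and $e\to e'$; - *junk*: $(X\dashv e)\to(X\dashv e')$ at Duplicator positions, if $\mathrm{pol}(e)=?_a$ for some $a \in \Sigma$ and $e\to e'$; - *fill*: $(X\uplus\{t\}\dashv e)\to(X\cup\{t'\}\dashv e')$ at Duplicator positions, if $\mathrm{pol}(e)=\mathrm{pol}(t)=?_a$ for some $a \in \Sigma$, $e\to e'$ and $t\to t'$. (This is the simulation game with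 positions $(\Gamma\mid X\dashv e)$, $\Gamma\subseteq\Sigma$ the set of available letters, in which *junk* on $?_a$ requires $a\in\Gamma$ and *fill* on $?_a$ adds $a$ to $\Gamma$, restricted to $\Gamma=\Sigma$.) The *winning positions* are the Spoiler positions at which no alea move can be played. Duplicator wins an infinite play iff it visits winning positions infinitely often, and a finite play that cannot be extended iff its last position is winning. A Duplicator strategy is a nonempty prefix-closed and limit-closed set of partial plays from the initial position that contains every one-move extension of each of its finite plays ending at a Spoiler position, and exactly one such extension of each of its finite plays ending at a Duplicator position; it is winning if all maximal plays in it are won by Duplicator. **Theorem.** For all $e,f\in\mathrm{RegE}(\Sigma)$ containing neither $\top$ nor $0$, the following are equivalent: 1. $e\le f$ is valid in the pointed Weihrauch degrees; 2. Duplicator has a winning strategy in $\mathcal G_\bullet(\{e\}\dashv f)$. -/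

import Mathlib

/-! ### Baire space and Kleene's second algebra -/

/-- Baire space. -/
abbrev Baire : Type := ℕ → ℕ

namespace Baire

/-- The distinguished (recursive) point written `⋆`. -/
def pt : Baire := fun _ => 0

/-- The coding `⟨p, q⟩` of pairs, by interleaving. -/
def pair (p q : Baire) : Baire := fun n => if n % 2 = 0 then p (n / 2) else q (n / 2)

/-- The left injection of the coded tagged union. -/
def in1 (p : Baire) : Baire := fun n => Nat.casesOn n 0 p

/-- The right injection of the coded tagged union. -/
def in2 (p : Baire) : Baire := fun n => Nat.casesOn n 1 p

/-- The finite prefix of `p` of length `m`. -/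
def prefixOf (p : Baire) (m : ℕ) : List ℕ := (List.range m).map p

/-- `App c p q` says that `c · p` is defined and equal to `q` in Kleene's second algebra:
for every `n`, there is a least `m` such that `c ⟨n, p 0, …, p (m-1)⟩ ≠ 0`, and for this `m`
the value is `q n + 1`. -/
def App (c p q : Baire) : Prop :=
  ∀ n : ℕ, ∃ m : ℕ, (∀ i < m, c (Encodable.encode (n, prefixOf p i)) = 0) ∧
    c (Encodable.encode (n, prefixOf p m)) = q n + 1

end Baire

/-! ### Weihrauch problems and reductions -/

/-- An extended Weihrauch problem: a set of instances and, for every instance `u`, a set `sol u`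
of solutions. The values of `sol` outside `dom` carry no information. -/
structure WProblem where
  dom : Set Baire
  sol : Baire → Set Baire

namespace WProblem

open Baire

/-- A (non-extended) Weihrauch problem: every instance has a solution. -/
def IsOrdinary (P : WProblem) : Prop := ∀ u ∈ P.dom, (P.sol u).Nonempty

/-- A problem is pointed if it has a recursive instance. -/
def IsPointed (P : WProblem) : Prop := ∃ u ∈ P.dom, Computable u

/-- Weihrauch reducibility. The computable (partial) maps on Baire space are those that are
realized by a recursive element of Kleene's second algebra. -/
def Reduces (P Q : WProblem) : Prop :=
  ∃ φ ψ : Baire, Computable φ ∧ Computable ψ ∧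
    ∀ u ∈ P.dom, ∃ v ∈ Q.dom, App φ u v ∧
      ∀ y ∈ Q.sol v, ∃ x ∈ P.sol u, App ψ (pair u y) x

/-- The problem `0`. -/
def zero : WProblem where
  dom := ∅
  sol _ := ∅

/-- The problem `⊤`. -/
def top : WProblem where
  dom := {pt}
  sol _ := ∅

/-- The problem `1`. -/
def one : WProblem where
  dom := {pt}
  sol _ := {pt}

/-- The join `P ⊔ Q`. -/
def join (P Q : WProblem) : WProblem where
  dom := in1 '' P.dom ∪ in2 '' Q.dom
  sol w := {x | (∃ u ∈ P.dom, w = in1 u ∧ x ∈ P.sol u) ∨ (∃ v ∈ Q.dom, w = in2 v ∧ x ∈ Q.sol v)}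

/-- The meet `P ⊓ Q`. -/
def meet (P Q : WProblem) : WProblem where
  dom := {w | ∃ u ∈ P.dom, ∃ v ∈ Q.dom, w = pair u v}
  sol w := {z | ∃ u ∈ P.dom, ∃ v ∈ Q.dom, w = pair u v ∧
    ((∃ x ∈ P.sol u, z = in1 x) ∨ (∃ y ∈ Q.sol v, z = in2 y))}

/-- The composition `P ⋆ Q`: first a call to `Q`, then a call to `P`. -/
def comp (P Q : WProblem) : WProblem where
  dom := {w | ∃ u ∈ Q.dom, ∃ c : Baire, w = pair u c ∧ ∀ x ∈ Q.sol u, ∃ v ∈ P.dom, App c x v}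
  sol w := {z | ∃ u ∈ Q.dom, ∃ c : Baire, w = pair u c ∧
    ∃ x ∈ Q.sol u, ∃ v : Baire, App c x v ∧ ∃ y ∈ P.sol v, z = pair x y}

/-- The instances of `P^◇`: the least set that contains `in1 ⋆` and contains `in2 ⟨u, c⟩` whenever
`u` is an instance of `P` and `c · x` is defined and an instance of `P^◇` for every `x ∈ P u`. -/
inductive IterDom (P : WProblem) : Baire → Prop
  | done : IterDom P (in1 pt)
  | step (u c : Baire) (hu : u ∈ P.dom) (hdef : ∀ x ∈ P.sol u, ∃ v, App c x v)
      (hrec : ∀ x ∈ P.sol u, ∀ v, App c x v → IterDom P v) : IterDom P (in2 (pair u c))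

/-- `IterSol P w z`: `z` is a solution of the instance `w` of `P^◇`. -/
inductive IterSol (P : WProblem) : Baire → Baire → Prop
  | done : IterSol P (in1 pt) pt
  | step (u c x v y : Baire) (hu : u ∈ P.dom) (hx : x ∈ P.sol u) (hv : App c x v)
      (hy : IterSol P v y) : IterSol P (in2 (pair u c)) (pair x y)

/-- The iterated composition `P^◇`. -/
def iter (P : WProblem) : WProblem where
  dom := {w | IterDom P w}
  sol w := {z | IterSol P w z}

end WProblem

/-! ### Expressions -/

/-- The expressions over the alphabet `A`. -/
inductive RegE (A : Type*) where
  | var (a : A) : RegE A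
  | zero : RegE A
  | join (e f : RegE A) : RegE A
  | top : RegE A
  | meet (e f : RegE A) : RegE A
  | one : RegE A
  | comp (e f : RegE A) : RegE A
  | iter (e : RegE A) : RegE A

/-- The polarity of an expression: `∃`, `∀`, or a letter. -/
inductive Polarity (A : Type*) where
  | ex : Polarity A
  | all : Polarity A
  | letter (a : A) : Polarity A

namespace RegE

variable {A : Type*}

/-- The expression contains neither `⊤` nor `0`. -/
def TopZeroFree : RegE A → Prop
  | var _ => True
  | zero => False
  | join e f => e.TopZeroFree ∧ f.TopZeroFree
  | top => False
  | meet e f => e.TopZeroFree ∧ f.TopZeroFree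
  | one => True
  | comp e f => e.TopZeroFree ∧ f.TopZeroFree
  | iter e => e.TopZeroFree

/-- The interpretation of an expression under a valuation of the letters. -/
def interp (ρ : A → WProblem) : RegE A → WProblem
  | var a => ρ a
  | zero => WProblem.zero
  | join e f => (e.interp ρ).join (f.interp ρ)
  | top => WProblem.top
  | meet e f => (e.interp ρ).meet (f.interp ρ)
  | one => WProblem.one
  | comp e f => (e.interp ρ).comp (f.interp ρ)
  | iter e => (e.interp ρ).iter

/-- `e ≤ f` is valid in the pointed Weihrauch degrees. -/
def PointedValid (e f : RegE A) : Prop :=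
  ∀ ρ : A → WProblem, (∀ a, (ρ a).IsOrdinary ∧ (ρ a).IsPointed) →
    (e.interp ρ).Reduces (f.interp ρ)

/-- The transition relation on expressions. -/
inductive Step : RegE A → RegE A → Prop
  | join_left (e f : RegE A) : Step (join e f) e
  | join_right (e f : RegE A) : Step (join e f) f
  | meet_left (e f : RegE A) : Step (meet e f) e
  | meet_right (e f : RegE A) : Step (meet e f) f
  | var (a : A) : Step (var a) one
  | comp_one (e : RegE A) : Step (comp e one) e
  | iter_one (e : RegE A) : Step (iter e) one
  | iter_unfold (e : RegE A) : Step (iter e) (comp (iter e) e)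
  | comp_right (g : RegE A) {e f : RegE A} (h : Step e f) : Step (comp g e) (comp g f)

/-- The polarity of an expression. -/
def pol : RegE A → Polarity A
  | var a => .letter a
  | zero => .ex
  | join _ _ => .ex
  | top => .all
  | meet _ _ => .all
  | one => .ex
  | comp _ f => f.pol
  | iter _ => .ex

end RegE

/-! ### Büchi games -/

/-- The two players; Duplicator owns the `∃` positions and Spoiler the `∀` positions. -/
inductive Player where
  | duplicator : Player
  | spoiler : Player

/-- A Büchi arena. -/
structure BuchiArena (V : Type*) where
  move : V → V → Prop
  owner : V → Player
  win : Set V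

namespace BuchiArena

variable {V : Type*}

/-- A Duplicator strategy from `v`, given by its finite partial plays (nonempty lists of positions,
first position first); its infinite plays are those all of whose nonempty finite prefixes
belong to it. -/
structure IsStrategy (G : BuchiArena V) (v : V) (S : Set (List V)) : Prop where
  nonempty : S.Nonempty
  starts : ∀ p ∈ S, p.head? = some v
  isPlay : ∀ p ∈ S, p.IsChain G.move
  prefix_closed : ∀ p ∈ S, ∀ q : List V, q ≠ [] → q <+: p → q ∈ S
  spoiler_closed : ∀ (p : List V) (u m : V), p ++ [u] ∈ S → G.owner u = .spoiler →
    G.move u m → p ++ [u] ++ [m] ∈ S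
  duplicator_unique : ∀ (p : List V) (u : V), p ++ [u] ∈ S → G.owner u = .duplicator →
    ∃! m, G.move u m ∧ p ++ [u] ++ [m] ∈ S

/-- All maximal plays of `S`, finite or infinite, are won by Duplicator. -/
structure IsWinning (G : BuchiArena V) (S : Set (List V)) : Prop where
  finite_plays : ∀ (p : List V) (u : V), p ++ [u] ∈ S → (∀ m, ¬ G.move u m) → u ∈ G.win
  infinite_plays : ∀ x : ℕ → V, (∀ n : ℕ, (List.range (n + 1)).map x ∈ S) →
    {i : ℕ | x i ∈ G.win}.Infinite

/-- Duplicator has a winning strategy from `v`. -/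
def DuplicatorWins (G : BuchiArena V) (v : V) : Prop :=
  ∃ S : Set (List V), G.IsStrategy v S ∧ G.IsWinning S

end BuchiArena

/-! ### The simulation games -/

/-- The positions `(Γ ∣ X ⊣ e)` of the simulation game. -/
structure SimPos (A : Type*) where
  avail : Set A
  hyps : Finset (RegE A)
  goal : RegE A

namespace SimPos

variable {A : Type*}

/-- Some `t ∈ X` other than `1` has polarity `∃` or `∀`. -/
def HasPending (p : SimPos A) : Prop :=
  ∃ t ∈ p.hyps, t ≠ .one ∧ (t.pol = .ex ∨ t.pol = .all)

open Classical in
/-- The player who owns a position. A completed position, with goal `1` and `1 ∈ X`, is a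
(winning) Spoiler position. -/
noncomputable def owner (p : SimPos A) : Player :=
  if p.HasPending then .spoiler
  else if RegE.one ∈ p.hyps ∧ p.goal = .one then .spoiler
  else match p.goal.pol with
    | .all => .spoiler
    | .ex => .duplicator
    | .letter _ => .duplicator

end SimPos

/-- The kinds of moves of the simulation game. -/
inductive MoveKind where
  | explore | fork | alea | choose | junk | fill

/-- The moves of the simulation game. -/
inductive SimMove {A : Type*} : MoveKind → SimPos A → SimPos A → Prop
  | explore (Γ : Set A) (X X' : Finset (RegE A)) (e t t' : RegE A) (ht : t ∈ X)
      (hpol : t.pol = .ex) (hstep : t.Step t')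
      (hX : (X' : Set (RegE A)) = (↑X \ {t}) ∪ {t'}) :
      SimMove .explore ⟨Γ, X, e⟩ ⟨Γ, X', e⟩
  | fork (Γ : Set A) (X X' : Finset (RegE A)) (e t : RegE A) (ht : t ∈ X)
      (hpol : t.pol = .all)
      (hX : (X' : Set (RegE A)) = (↑X \ {t}) ∪ {t' | t.Step t'}) :
      SimMove .fork ⟨Γ, X, e⟩ ⟨Γ, X', e⟩
  | alea (Γ : Set A) (X : Finset (RegE A)) (e e' : RegE A) (hpol : e.pol = .all)
      (hX : ∀ t ∈ X, t.pol = .all ∨ t.pol = .ex → t = .one) (hstep : e.Step e') :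
      SimMove .alea ⟨Γ, X, e⟩ ⟨Γ, X, e'⟩
  | choose (Γ : Set A) (X : Finset (RegE A)) (e e' : RegE A)
      (howner : SimPos.owner ⟨Γ, X, e⟩ = .duplicator) (hpol : e.pol = .ex) (hstep : e.Step e') :
      SimMove .choose ⟨Γ, X, e⟩ ⟨Γ, X, e'⟩
  | junk (Γ : Set A) (X : Finset (RegE A)) (e e' : RegE A) (a : A)
      (howner : SimPos.owner ⟨Γ, X, e⟩ = .duplicator) (hpol : e.pol = .letter a) (ha : a ∈ Γ)
      (hstep : e.Step e') :
      SimMove .junk ⟨Γ, X, e⟩ ⟨Γ, X, e'⟩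
  | fill (Γ : Set A) (X X' : Finset (RegE A)) (e e' t t' : RegE A) (a : A) (ht : t ∈ X)
      (howner : SimPos.owner ⟨Γ, X, e⟩ = .duplicator) (hpole : e.pol = .letter a)
      (hpolt : t.pol = .letter a) (hstepe : e.Step e') (hstept : t.Step t')
      (hX : (X' : Set (RegE A)) = (↑X \ {t}) ∪ {t'}) :
      SimMove .fill ⟨Γ, X, e⟩ ⟨Γ ∪ {a}, X', e'⟩

/-- The simulation arena. The winning positions are the Spoiler positions in which no alea move
can be played. -/
noncomputable def simGame (A : Type*) : BuchiArena (SimPos A) where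
  move p q := ∃ k, SimMove k p q
  owner p := p.owner
  win := {p | p.owner = .spoiler ∧ ¬ ∃ q, SimMove .alea p q}

/-- The positions `(X ⊣ e)` of the pointed simulation game. -/
structure PSimPos (A : Type*) where
  hyps : Finset (RegE A)
  goal : RegE A

/-- The position `(Σ ∣ X ⊣ e)` of the simulation game, in which all letters are available. -/
def PSimPos.toSim {A : Type*} (p : PSimPos A) : SimPos A := ⟨Set.univ, p.hyps, p.goal⟩

/-- The pointed simulation arena. -/
noncomputable def psimGame (A : Type*) : BuchiArena (PSimPos A) where
  move p q := (simGame A).move p.toSim q.toSim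
  owner p := (simGame A).owner p.toSim
  win := {p | p.toSim ∈ (simGame A).win}

/-! An instance of a term is a well-founded interaction that follows the automaton: at `t` it poses
one query to `head ρ t`, and the answer leads to an instance of a successor of `t`.
`exists_destructor` and `exists_constructor` make this reading computable in both directions,
`LS.sound` carries solutions back along a transition, and `acc_of_mem_dom` says that the interaction
terminates.

From a strategy to a reduction. `DuplicatorWins.exists_progress` turns a winning strategy into a set
of positions with a natural rank that falls along the play outside the winning positions. The
reduction stores, for every hypothesis of the current position, an instance and a code that sends
its solutions to solutions of the original instance. Explore, fork and fill replace a stored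
instance by instances further down in its interaction; alea, choose and junk leave the store alone
and lower the rank, junk posing the recursive query that pointedness provides. Finitely many
positions matter, so a single code from the recursion theorem handles all of them (`exists_solver`).
It is correct by induction on the multiset of ordinal ranks of the stored instances and, for equal
multisets, on the rank of the position.

From the absence of a strategy to a failing valuation. As only finitely many positions are
reachable, `exists_layers` gives layers in which Spoiler can stay, going down by one at each winning
position. A generic point supplies names and passwords, none of which is computable from finitely
many others. A query to a letter is identified by a name; its answers consist of a password and an
instance, and there is one for each description, so that Spoiler can choose. Given a reduction, the
instance of the goal is executed against Spoiler. By genericity every query except the recursive one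
`pt` has a revealed name, so it repeats an answered query, which is a junk move, or it is the
current query of a hypothesis, which is a fill move (`exists_answer`). The execution ends with a
solution computed from the revealed columns while `1` is not a hypothesis (`exists_solution`). But
then no solution of the original instance can be computed from these columns (`Safe.not_computes`),
contrary to the reduction. -/

set_option autoImplicit false

open Baire

/-! ### Prefixes and application in Kleene's second algebra -/

namespace Baire

@[simp] theorem length_prefixOf (p : Baire) (m : ℕ) : (prefixOf p m).length = m := by
  simp [prefixOf]

theorem getElem?_prefixOf (p : Baire) (m i : ℕ) :
    (prefixOf p m)[i]? = if i < m then some (p i) else none := by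
  unfold prefixOf
  by_cases h : i < m <;> simp [h]

theorem take_prefixOf (p : Baire) (m i : ℕ) : (prefixOf p m).take i = prefixOf p (min i m) := by
  apply List.ext_getElem?
  intro j
  simp only [List.getElem?_take, getElem?_prefixOf]
  split_ifs <;> first | rfl | omega

theorem prefixOf_succ (p : Baire) (m : ℕ) : prefixOf p (m + 1) = prefixOf p m ++ [p m] := by
  simp [prefixOf, List.range_succ]

theorem App.unique {c p q q' : Baire} (h : App c p q) (h' : App c p q') : q = q' := by
  funext n
  obtain ⟨m, h1, h2⟩ := h n
  obtain ⟨m', h1', h2'⟩ := h' n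
  have : m = m' := by
    rcases lt_trichotomy m m' with hlt | rfl | hlt
    · have := h1' m hlt; omega
    · rfl
    · have := h1 m' hlt; omega
  subst this
  omega

theorem computable_prefixOf {p : Baire} (hp : Computable p) : Computable (prefixOf p) := by
  have : Computable fun n : ℕ =>
      (Nat.rec [] (fun i acc => acc ++ [p i]) n : List ℕ) :=
    Computable.nat_rec (f := fun n => n) (g := fun _ => ([] : List ℕ))
      (h := fun _ (y : ℕ × List ℕ) => y.2 ++ [p y.1]) Computable.id (Computable.const _)
      (Computable.list_append.comp (Computable.snd.comp Computable.snd)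
        (Computable.list_cons.comp (hp.comp (Computable.fst.comp Computable.snd))
          (Computable.const []))).to₂
  refine this.of_eq fun n => ?_
  induction n with
  | zero => rfl
  | succ n ih => rw [prefixOf_succ, ← ih]

/-! ### Monotone machines -/

/-- The list function `A` computes `q` from the prefixes of `p`. -/
def Tracks (A : List ℕ → List ℕ) (p q : Baire) : Prop :=
  (∀ m, ∃ l, A (prefixOf p m) = prefixOf q l) ∧
    ∀ L, ∃ M, ∀ m, M ≤ m → L ≤ (A (prefixOf p m)).length

theorem Tracks.getElem? {A : List ℕ → List ℕ} {p q : Baire} (h : Tracks A p q) {n m v : ℕ}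
    (hv : (A (prefixOf p m))[n]? = some v) : v = q n := by
  obtain ⟨l, hl⟩ := h.1 m
  rw [hl, getElem?_prefixOf] at hv
  split_ifs at hv
  exact (Option.some.inj hv).symm

theorem Tracks.eventually {A : List ℕ → List ℕ} {p q : Baire} (h : Tracks A p q) (n : ℕ) :
    ∃ M, ∀ m, M ≤ m → (A (prefixOf p m))[n]? = some (q n) := by
  obtain ⟨M, hM⟩ := h.2 (n + 1)
  refine ⟨M, fun m hm => ?_⟩
  have := hM m hm
  rw [List.getElem?_eq_getElem (by omega)]
  exact congrArg some (h.getElem? (List.getElem?_eq_getElem (by omega)))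

theorem Tracks.comp {A B : List ℕ → List ℕ} {p q r : Baire} (hA : Tracks A p q)
    (hB : Tracks B q r) : Tracks (fun σ => B (A σ)) p r := by
  refine ⟨fun m => ?_, fun L => ?_⟩
  · obtain ⟨l, hl⟩ := hA.1 m
    obtain ⟨k, hk⟩ := hB.1 l
    exact ⟨k, by simp only [hl, hk]⟩
  · obtain ⟨L', h'⟩ := hB.2 L
    obtain ⟨M, hM⟩ := hA.2 L'
    refine ⟨M, fun m hm => ?_⟩
    obtain ⟨l, hl⟩ := hA.1 m
    have := hM m hm
    simp only [hl, length_prefixOf] at this ⊢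
    exact h' l this

/-- The longest list of length at most `N` of successive values of a partial sequence. -/
def collect (G : ℕ → Option ℕ) : ℕ → List ℕ :=
  fun N => Nat.rec [] (fun i acc => if acc.length = i then
    Option.casesOn (G i) acc (fun v => acc ++ [v]) else acc) N

theorem collect_succ (G : ℕ → Option ℕ) (N : ℕ) : collect G (N + 1) =
    if (collect G N).length = N then
      Option.casesOn (G N) (collect G N) (fun v => collect G N ++ [v]) else collect G N := rfl

/-- A value is appended only while the list has no gap (`acc.length = i`), so the first undefined
entry freezes the list. -/
theorem collect_spec {G : ℕ → Option ℕ} {q : Baire} (h : ∀ n v, G n = some v → v = q n) (N : ℕ) :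
    ∃ l ≤ N, collect G N = prefixOf q l ∧ (l = N ∨ G l = none) := by
  induction N with
  | zero => exact ⟨0, le_rfl, rfl, Or.inl rfl⟩
  | succ N ih =>
    obtain ⟨l, hl, h1, h2⟩ := ih
    rw [collect_succ, h1, length_prefixOf]
    split_ifs with hlN
    · subst hlN
      cases hG : G l with
      | none => exact ⟨l, Nat.le_succ _, rfl, Or.inr hG⟩
      | some v => exact ⟨l + 1, le_rfl, by rw [prefixOf_succ, h l v hG], Or.inl rfl⟩
    · exact ⟨l, by omega, rfl, Or.inr (h2.resolve_left hlN)⟩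

theorem tracks_collect {G : ℕ → List ℕ → Option ℕ} {p q : Baire}
    (h1 : ∀ n m v, G n (prefixOf p m) = some v → v = q n)
    (h2 : ∀ n, ∃ M, ∀ m, M ≤ m → G n (prefixOf p m) = some (q n)) :
    Tracks (fun σ => collect (fun n => G n σ) σ.length) p q := by
  refine ⟨fun m => ?_, fun L => ?_⟩
  · obtain ⟨l, -, hl, -⟩ := collect_spec (fun n v => h1 n m v) (prefixOf p m).length
    exact ⟨l, hl⟩
  · choose M hM using h2
    -- The bound `L` is needed because `collect` asks for only as many values as the input prefix is
    -- long; the supremum makes all values below `L` available.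
    refine ⟨max L ((Finset.range L).sup M), fun m hm => ?_⟩
    obtain ⟨l, hl1, hl, h3⟩ := collect_spec (fun n v => h1 n m v) (prefixOf p m).length
    simp only [length_prefixOf] at *
    rw [hl, length_prefixOf]
    rcases h3 with h3 | h3
    · omega
    · by_contra hlt
      have : M l ≤ (Finset.range L).sup M :=
        Finset.le_sup (f := M) (Finset.mem_range.2 (not_le.1 hlt))
      rw [hM l m (by omega)] at h3
      exact Option.some_ne_none _ h3

theorem computable_collect {G : ℕ → List ℕ → Option ℕ} (hG : Computable₂ G) :
    Computable fun σ : List ℕ => collect (fun n => G n σ) σ.length := by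
  have hacc : Computable fun x : List ℕ × ℕ × List ℕ => x.2.2 :=
    Computable.snd.comp Computable.snd
  have hi : Computable fun x : List ℕ × ℕ × List ℕ => x.2.1 :=
    Computable.fst.comp Computable.snd
  have hdec : Computable fun x : List ℕ × ℕ × List ℕ => decide (x.2.2.length = x.2.1) :=
    (Primrec.eq (α := ℕ)).decide.to_comp.comp (Computable.list_length.comp hacc) hi
  have hopt : Computable fun x : List ℕ × ℕ × List ℕ =>
      (Option.casesOn (G x.2.1 x.1) x.2.2 (fun v => x.2.2 ++ [v]) : List ℕ) :=
    Computable.option_casesOn (hG.comp hi Computable.fst) hacc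
      (Computable.list_append.comp (hacc.comp Computable.fst)
        (Computable.list_cons.comp Computable.snd (Computable.const []))).to₂
  refine Computable.of_eq (Computable.nat_rec (h := fun σ (y : ℕ × List ℕ) =>
    bif decide (y.2.length = y.1) then
      (Option.casesOn (G y.1 σ) y.2 (fun v => y.2 ++ [v]) : List ℕ) else y.2)
    Computable.list_length (Computable.const []) (Computable.cond hdec hopt hacc).to₂)
    fun σ => ?_
  simp only [collect, Bool.cond_decide]

/-! ### Evaluation of associates -/

/-- The value at `n` that an associate with prefix `γ` outputs on an argument with prefix `σ`. -/
def lookup (γ : List ℕ) (n : ℕ) (σ : List ℕ) : Option ℕ :=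
  (List.range (σ.length + 1)).foldr (fun i acc =>
    Option.casesOn γ[Encodable.encode (n, σ.take i)]? none
      (fun k => Nat.casesOn k acc (fun v => some v))) none

theorem primrec_lookup : Primrec fun x : List ℕ × ℕ × List ℕ => lookup x.1 x.2.1 x.2.2 := by
  unfold lookup
  refine Primrec.list_foldr (h := fun (x : List ℕ × ℕ × List ℕ) (y : ℕ × Option ℕ) =>
    (Option.casesOn x.1[Encodable.encode (x.2.1, x.2.2.take y.1)]? none
      (fun k => Nat.casesOn k y.2 (fun v => some v)) : Option ℕ))
    (Primrec.list_range.comp (Primrec.succ.comp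
      (Primrec.list_length.comp (Primrec.snd.comp Primrec.snd)))) (Primrec.const none) ?_
  refine Primrec.option_casesOn (Primrec.list_getElem?.comp (Primrec.fst.comp Primrec.fst)
    (Primrec.encode.comp ((Primrec.fst.comp (Primrec.snd.comp Primrec.fst)).pair
      (Primrec.list_take.comp (Primrec.fst.comp Primrec.snd)
        (Primrec.snd.comp (Primrec.snd.comp Primrec.fst)))))) (Primrec.const none) ?_
  exact (Primrec.nat_casesOn Primrec.snd (Primrec.snd.comp (Primrec.snd.comp Primrec.fst))
    (Primrec.option_some.comp Primrec.snd).to₂).to₂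

/-- The fold searches for the first nonzero entry and gives up at the first missing one. No positive
value is seen before `i₀`, and only `q + 1` can be seen there, so any output is `q`. -/
theorem foldr_range'_sound {h : ℕ → Option ℕ} {i₀ q : ℕ} (h1 : ∀ i < i₀, ∀ v, h i ≠ some (v + 1))
    (h2 : ∀ k, h i₀ = some k → k = q + 1) (len s : ℕ) (hs : s ≤ i₀) {v : ℕ}
    (hv : (List.range' s len).foldr (fun i acc => (Option.casesOn (h i) none
      (fun k => Nat.casesOn k acc (fun v => some v)) : Option ℕ)) none = some v) : v = q := by
  induction len generalizing s with
  | zero => simp at hv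
  | succ len ih =>
    rw [List.range'_succ, List.foldr_cons] at hv
    match hh : h s with
    | none => simp [hh] at hv
    | some (k + 1) =>
      rcases hs.lt_or_eq with hlt | rfl
      · exact absurd hh (h1 s hlt k)
      · have := h2 _ hh
        simp [hh] at hv
        omega
    | some 0 =>
      rcases hs.lt_or_eq with hlt | rfl
      · rw [hh] at hv
        exact ih (s + 1) hlt hv
      · have := h2 _ hh
        omega

theorem foldr_range'_complete {h : ℕ → Option ℕ} {i₀ q : ℕ} (h1 : ∀ i < i₀, h i = some 0)
    (h2 : h i₀ = some (q + 1)) (len s : ℕ) (hs : s ≤ i₀) (hs' : i₀ < s + len) :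
    (List.range' s len).foldr (fun i acc => (Option.casesOn (h i) none
      (fun k => Nat.casesOn k acc (fun v => some v)) : Option ℕ)) none = some q := by
  induction len generalizing s with
  | zero => omega
  | succ len ih =>
    rw [List.range'_succ, List.foldr_cons]
    rcases hs.lt_or_eq with hlt | rfl
    · rw [h1 s hlt]
      exact ih (s + 1) hlt (by omega)
    · rw [h2]

/-- Short prefixes of the associate or of the argument can only suppress an output and never falsify
it. This lets codes be applied while they are themselves still being computed. -/
theorem lookup_sound {c p q : Baire} (h : App c p q) {n k m v : ℕ}
    (hv : lookup (prefixOf c k) n (prefixOf p m) = some v) : v = q n := by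
  obtain ⟨i₀, h1, h2⟩ := h n
  rw [lookup, List.range_eq_range', length_prefixOf] at hv
  have key : ∀ i ≤ m, ∀ w, (prefixOf c k)[Encodable.encode (n, (prefixOf p m).take i)]? = some w →
      w = c (Encodable.encode (n, prefixOf p i)) := by
    intro i hi w hw
    rw [getElem?_prefixOf, take_prefixOf, min_eq_left hi] at hw
    split_ifs at hw
    exact (Option.some.inj hw).symm
  by_cases him : i₀ ≤ m
  · refine foldr_range'_sound (i₀ := i₀) ?_ ?_ _ 0 (Nat.zero_le _) hv
    · intro i hi v hv
      have := key i (by omega) _ hv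
      have := h1 i hi
      omega
    · intro w hw
      have := key i₀ him _ hw
      omega
  -- The argument is too short to reach the deciding stage `i₀`: every entry that can be read is
  -- `0`, so there is no output.
  · have : ∀ len s, s + len ≤ m + 1 → ∀ v, (List.range' s len).foldr (fun i acc =>
        (Option.casesOn (prefixOf c k)[Encodable.encode (n, (prefixOf p m).take i)]? none
          (fun k => Nat.casesOn k acc (fun v => some v)) : Option ℕ)) none ≠ some v := by
      intro len
      induction len with
      | zero => simp
      | succ len ih =>
        intro s hs v
        rw [List.range'_succ, List.foldr_cons]
        cases hw : (prefixOf c k)[Encodable.encode (n, (prefixOf p m).take s)]? with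
        | none => simp
        | some w =>
          have h3 := key s (by omega) _ hw
          rw [h1 s (by omega)] at h3
          subst h3
          exact ih (s + 1) (by omega) v
    exact absurd hv (this (m + 1) 0 (by omega) v)

theorem lookup_complete {c p q : Baire} (h : App c p q) (n : ℕ) :
    ∃ M, ∀ k m, M ≤ k → M ≤ m → lookup (prefixOf c k) n (prefixOf p m) = some (q n) := by
  obtain ⟨i₀, h1, h2⟩ := h n
  -- The argument must reach length `i₀`, and the associate must be known at all of the indices
  -- consulted up to `i₀`.
  refine ⟨max i₀ ((Finset.range (i₀ + 1)).sup
    fun i => Encodable.encode (n, prefixOf p i) + 1), fun k m hk hm => ?_⟩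
  rw [lookup, List.range_eq_range', length_prefixOf]
  have key : ∀ i ≤ i₀, (prefixOf c k)[Encodable.encode (n, (prefixOf p m).take i)]? =
      some (c (Encodable.encode (n, prefixOf p i))) := by
    intro i hi
    have : Encodable.encode (n, prefixOf p i) + 1 ≤ (Finset.range (i₀ + 1)).sup
        fun i => Encodable.encode (n, prefixOf p i) + 1 :=
      Finset.le_sup (f := fun i => Encodable.encode (n, prefixOf p i) + 1)
        (Finset.mem_range.2 (by omega))
    rw [getElem?_prefixOf, take_prefixOf, min_eq_left (by omega), if_pos (by omega)]
  refine foldr_range'_complete (i₀ := i₀) ?_ ?_ _ 0 (Nat.zero_le _) (by omega)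
  · intro i hi
    rw [key i hi.le, h1 i hi]
  · rw [key i₀ le_rfl, h2]

/-- The associate outputs at the first prefix on which the machine has produced its `n`-th value. By
`Tracks` this first value is already correct. -/
theorem app_of_machine {c : Baire} {A : List ℕ → List ℕ} {p q : Baire}
    (hc : ∀ n m : ℕ, c (Encodable.encode (n, prefixOf p m)) =
      (Option.casesOn (A (prefixOf p m))[n]? 0 (fun v => v + 1) : ℕ))
    (hA : Tracks A p q) : App c p q := by
  classical
  intro n
  have h2 : ∃ m, ((A (prefixOf p m))[n]?).isSome := by
    obtain ⟨M, hM⟩ := hA.eventually n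
    exact ⟨M, by rw [hM M le_rfl]; rfl⟩
  refine ⟨Nat.find h2, fun i hi => ?_, ?_⟩
  · have := Nat.find_min h2 hi
    rw [hc]
    cases hh : (A (prefixOf p i))[n]? with
    | none => rfl
    | some v => simp [hh] at this
  · have := Nat.find_spec h2
    obtain ⟨v, hv⟩ := Option.isSome_iff_exists.1 this
    rw [hc, hv]
    exact congrArg (· + 1) (hA.getElem? hv)

end Baire

/-! ### Represented types and realizable maps -/

/-- A type whose elements are coded by points of Baire space. -/
class Coded (α : Type) where
  code : α → Baire
  code_inj : Function.Injective code

namespace Baire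

/-- The first component of a coded pair. -/
def fst (p : Baire) : Baire := fun n => p (2 * n)

/-- The second component of a coded pair. -/
def snd (p : Baire) : Baire := fun n => p (2 * n + 1)

@[simp] theorem fst_pair (p q : Baire) : fst (pair p q) = p := by
  funext n
  simp [fst, pair]

@[simp] theorem snd_pair (p q : Baire) : snd (pair p q) = q := by
  funext n
  have : (2 * n + 1) / 2 = n := by omega
  simp [snd, pair, this]

theorem pair_inj {p q p' q' : Baire} (h : pair p q = pair p' q') : p = p' ∧ q = q' :=
  ⟨by simpa using congrArg fst h, by simpa using congrArg snd h⟩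

end Baire

instance : Coded Baire := ⟨id, Function.injective_id⟩

instance {α β : Type} [Coded α] [Coded β] : Coded (α × β) where
  code x := pair (Coded.code x.1) (Coded.code x.2)
  code_inj _ _ h := Prod.ext (Coded.code_inj (pair_inj h).1) (Coded.code_inj (pair_inj h).2)

instance : Coded ℕ := ⟨fun n _ => n, fun _ _ h => congrFun h 0⟩

instance : Coded Bool where
  code b := fun _ => b.toNat
  code_inj b c h := by
    have := congrFun h 0
    revert this
    cases b <;> cases c <;> simp

/-- Application of a code to a coded argument, with decoded value. -/
noncomputable def capp {α β : Type} [Coded α] [Coded β] (c : Baire) (a : α) : Part β :=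
  ⟨∃ b : β, App c (Coded.code a) (Coded.code b), fun h => h.choose⟩

theorem mem_capp {α β : Type} [Coded α] [Coded β] {c : Baire} {a : α} {b : β} :
    b ∈ capp c a ↔ App c (Coded.code a) (Coded.code b) := by
  constructor
  · rintro ⟨h, rfl⟩
    exact h.choose_spec
  · intro h
    have h' : ∃ b : β, App c (Coded.code a) (Coded.code b) := ⟨b, h⟩
    exact ⟨h', Coded.code_inj (h'.choose_spec.unique h)⟩

/-- The partial map `F` is computable with respect to the codings. -/
def Rz {α β : Type} [Coded α] [Coded β] (F : α → Part β) : Prop :=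
  ∃ A, Computable A ∧ ∀ a, ∀ b ∈ F a, Tracks A (Coded.code a) (Coded.code b)

/-- The total map `f` is computable with respect to the codings. -/
def Rt {α β : Type} [Coded α] [Coded β] (f : α → β) : Prop := Rz fun a => Part.some (f a)

section

variable {α β γ δ : Type} [Coded α] [Coded β] [Coded γ] [Coded δ]

theorem Rz.of_le {F G : α → Part β} (h : Rz F) (hG : ∀ a, ∀ b ∈ G a, b ∈ F a) : Rz G := by
  obtain ⟨A, hA, hF⟩ := h
  exact ⟨A, hA, fun a b hb => hF a b (hG a b hb)⟩

theorem rt_iff {f : α → β} :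
    Rt f ↔ ∃ A, Computable A ∧ ∀ a, Tracks A (Coded.code a) (Coded.code (f a)) := by
  simp [Rt, Rz]

/-- It suffices to produce the values of the output one by one: never a wrong value, and each right
value on all sufficiently long prefixes. -/
theorem Rz.of_opt {F : α → Part β} {G : ℕ → List ℕ → Option ℕ} (hG : Computable₂ G)
    (h1 : ∀ a, ∀ b ∈ F a, ∀ n m v, G n (prefixOf (Coded.code a) m) = some v → v = Coded.code b n)
    (h2 : ∀ a, ∀ b ∈ F a, ∀ n, ∃ M, ∀ m, M ≤ m →
      G n (prefixOf (Coded.code a) m) = some (Coded.code b n)) : Rz F :=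
  ⟨_, computable_collect hG, fun a b hb => tracks_collect (h1 a b hb) (h2 a b hb)⟩

theorem Rt.of_prefix {f : α → β} {g : ℕ → List ℕ → ℕ} {κ : ℕ → ℕ} (hg : Computable₂ g)
    (hκ : Computable κ) (h : ∀ a n, Coded.code (f a) n = g n (prefixOf (Coded.code a) (κ n))) :
    Rt f := by
  refine Rz.of_opt (G := fun n σ => bif decide (κ n ≤ σ.length) then
    some (g n (σ.take (κ n))) else none) ?_ ?_ ?_
  · refine (Computable.cond (f := fun x : ℕ × List ℕ => some (g x.1 (x.2.take (κ x.1))))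
      (Primrec.nat_le.decide.to_comp.comp (hκ.comp Computable.fst)
      (Computable.list_length.comp Computable.snd)) (Computable.option_some.comp
        (hg.comp Computable.fst (Primrec.list_take.to_comp.comp (hκ.comp Computable.fst)
          Computable.snd))) (Computable.const none)).to₂
  · intro a b hb n m v hv
    obtain rfl := Part.mem_some_iff.1 hb
    simp only [length_prefixOf, Bool.cond_decide] at hv
    split_ifs at hv with hle
    rw [take_prefixOf, min_eq_left hle] at hv
    rw [h, ← Option.some.inj hv]
  · intro a b hb n
    obtain rfl := Part.mem_some_iff.1 hb
    refine ⟨κ n, fun m hm => ?_⟩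
    rw [length_prefixOf, Bool.cond_decide, if_pos hm, take_prefixOf, min_eq_left hm, h]

theorem Rt.of_reindex {f : α → β} {ι : ℕ → ℕ} (hι : Computable ι)
    (h : ∀ a n, Coded.code (f a) n = Coded.code a (ι n)) : Rt f := by
  refine Rt.of_prefix (g := fun n σ => σ.getD (ι n) 0) (κ := fun n => ι n + 1)
    ((Primrec.list_getD 0).to_comp.comp Computable.snd (hι.comp Computable.fst))
    (Computable.succ.comp hι) fun a n => ?_
  rw [h, List.getD_eq_getElem?_getD, getElem?_prefixOf, if_pos (Nat.lt_succ_self _)]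
  rfl

theorem Rz.comp {F : β → Part γ} {f : α → β} (hF : Rz F) (hf : Rt f) :
    Rz fun a => F (f a) := by
  obtain ⟨B, hB, hF⟩ := hF
  obtain ⟨A, hA, hf⟩ := rt_iff.1 hf
  exact ⟨_, hB.comp hA, fun a c hc => (hf a).comp (hF _ _ hc)⟩

theorem Rt.comp {f : β → γ} {g : α → β} (hf : Rt f) (hg : Rt g) : Rt fun a => f (g a) :=
  Rz.comp (F := fun b => Part.some (f b)) hf hg

theorem Rt.id : Rt fun a : α => a :=
  rt_iff.2 ⟨_, Computable.id, fun _ => ⟨fun m => ⟨m, rfl⟩, fun L => ⟨L, fun m hm => by simpa⟩⟩⟩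

theorem Rt.fst : Rt fun x : α × β => x.1 :=
  Rt.of_reindex (ι := fun n => 2 * n) Primrec.nat_double.to_comp fun a n => by
    simp [Coded.code, pair]

theorem Rt.snd : Rt fun x : α × β => x.2 :=
  Rt.of_reindex (ι := fun n => 2 * n + 1) Primrec.nat_double_succ.to_comp fun a n => by
    have : (2 * n + 1) / 2 = n := by omega
    simp [Coded.code, pair, this]

theorem Rt.const {b : β} (hb : Computable (Coded.code b)) : Rt fun _ : α => b :=
  Rt.of_prefix (g := fun n _ => Coded.code b n) (κ := fun _ => 0) (hb.comp Computable.fst)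
    (Computable.const 0) fun _ _ => rfl

/-- Interleaving of the common part of two lists. -/
def interleave (σ τ : List ℕ) (n : ℕ) : Option ℕ :=
  bif n.bodd then τ[n.div2]? else σ[n.div2]?

theorem computable_interleave {A B : List ℕ → List ℕ} (hA : Computable A) (hB : Computable B) :
    Computable₂ fun n σ => interleave (A σ) (B σ) n :=
  (Computable.cond (Computable.nat_bodd.comp Computable.fst)
    (Computable.list_getElem?.comp (hB.comp Computable.snd)
      (Computable.nat_div2.comp Computable.fst))
    (Computable.list_getElem?.comp (hA.comp Computable.snd)
      (Computable.nat_div2.comp Computable.fst))).to₂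

theorem pair_eq_bodd (p q : Baire) (n : ℕ) :
    pair p q n = bif n.bodd then q n.div2 else p n.div2 := by
  rw [pair, Nat.div2_val, Nat.mod_two_of_bodd]
  cases n.bodd <;> simp

theorem Rz.pair {F : α → Part β} {G : α → Part γ} (hF : Rz F) (hG : Rz G) :
    Rz fun a => (F a).bind fun b => (G a).map fun c => (b, c) := by
  obtain ⟨A, hA, hF⟩ := hF
  obtain ⟨B, hB, hG⟩ := hG
  refine Rz.of_opt (computable_interleave hA hB) ?_ ?_
  · intro a b hb n m v hv
    obtain ⟨b, hb', h⟩ := Part.mem_bind_iff.1 hb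
    obtain ⟨c, hc, rfl⟩ := (Part.mem_map_iff _).1 h
    simp only [Coded.code, pair_eq_bodd, interleave] at hv ⊢
    cases hn : n.bodd <;> rw [hn] at hv
    · exact (hF a b hb').getElem? hv
    · exact (hG a c hc).getElem? hv
  · intro a b hb n
    obtain ⟨b, hb', h⟩ := Part.mem_bind_iff.1 hb
    obtain ⟨c, hc, rfl⟩ := (Part.mem_map_iff _).1 h
    simp only [Coded.code, pair_eq_bodd, interleave]
    cases hn : n.bodd
    · exact (hF a b hb').eventually _
    · exact (hG a c hc).eventually _

theorem Rt.pair {f : α → β} {g : α → γ} (hf : Rt f) (hg : Rt g) : Rt fun a => (f a, g a) :=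
  (Rz.pair hf hg).of_le (by simp)

theorem Rz.bind {F : α → Part β} {G : α → β → Part γ} (hF : Rz F)
    (hG : Rz fun x : α × β => G x.1 x.2) : Rz fun a => (F a).bind (G a) := by
  obtain ⟨A, hA, hF⟩ := Rz.pair (F := fun a : α => Part.some a) Rt.id hF
  obtain ⟨B, hB, hG⟩ := hG
  refine ⟨_, hB.comp hA, fun a c hc => ?_⟩
  obtain ⟨b, hb, h⟩ := Part.mem_bind_iff.1 hc
  exact (hF a (a, b) (by simpa using hb)).comp (hG (a, b) c h)

theorem Rz.map {F : α → Part β} {g : α → β → γ} (hF : Rz F)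
    (hg : Rt fun x : α × β => g x.1 x.2) : Rz fun a => (F a).map (g a) :=
  (Rz.bind (G := fun a b => Part.some (g a b)) hF hg).of_le (by simp [eq_comm])

theorem Rz.cond {g : α → Bool} {F G : α → Part β} (hg : Rt g) (hF : Rz F) (hG : Rz G) :
    Rz fun a => bif g a then F a else G a := by
  obtain ⟨C, hC, hg⟩ := rt_iff.1 hg
  obtain ⟨A, hA, hF⟩ := hF
  obtain ⟨B, hB, hG⟩ := hG
  refine Rz.of_opt (G := fun n σ => Option.casesOn ((C σ)[0]?) none fun v =>
    bif decide (v = 0) then (B σ)[n]? else (A σ)[n]?) ?_ ?_ ?_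
  · refine Computable.option_casesOn (Computable.list_getElem?.comp
      (hC.comp Computable.snd) (Computable.const 0)) (Computable.const none) ?_
    exact (Computable.cond ((Primrec.eq (α := ℕ)).decide.to_comp.comp Computable.snd
      (Computable.const 0)) (Computable.list_getElem?.comp
        (hB.comp (Computable.snd.comp Computable.fst)) (Computable.fst.comp Computable.fst))
        (Computable.list_getElem?.comp
        (hA.comp (Computable.snd.comp Computable.fst)) (Computable.fst.comp Computable.fst))).to₂
  · intro a b hb n m v hv
    cases hc : (C (prefixOf (Coded.code a) m))[0]? with
    | none => simp [hc] at hv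
    | some w =>
      have := (hg a).getElem? hc
      rw [hc] at hv
      cases hga : g a
      · rw [hga] at hb
        refine (hG a b hb).getElem? (n := n) (m := m) (v := v) ?_
        simpa [Coded.code, hga, this] using hv
      · rw [hga] at hb
        refine (hF a b hb).getElem? (n := n) (m := m) (v := v) ?_
        simpa [Coded.code, hga, this] using hv
  · intro a b hb n
    obtain ⟨M, hM⟩ := (hg a).eventually 0
    cases hga : g a
    · rw [hga] at hb
      obtain ⟨M', hM'⟩ := (hG a b hb).eventually n
      refine ⟨max M M', fun m hm => ?_⟩
      simp only [hM m (by omega), Coded.code, hga]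
      simpa using hM' m (by omega)
    · rw [hga] at hb
      obtain ⟨M', hM'⟩ := (hF a b hb).eventually n
      refine ⟨max M M', fun m hm => ?_⟩
      simp only [hM m (by omega), Coded.code, hga]
      simpa using hM' m (by omega)

/-- Codes and arguments that are both still being computed are combined by `lookup` on the prefixes
available so far. -/
theorem Rz.ap {F : α → Part Baire} {G : α → Part β} (hF : Rz F) (hG : Rz G) :
    Rz fun a => (F a).bind fun c => (G a).bind fun b => (capp c b : Part γ) := by
  obtain ⟨A, hA, hF⟩ := hF
  obtain ⟨B, hB, hG⟩ := hG
  refine Rz.of_opt (G := fun n σ => lookup (A σ) n (B σ)) ?_ ?_ ?_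
  · exact (primrec_lookup.to_comp.comp ((hA.comp Computable.snd).pair
      (Computable.fst.pair (hB.comp Computable.snd)))).to₂
  · intro a b hb n m v hv
    obtain ⟨c, hc, h⟩ := Part.mem_bind_iff.1 hb
    obtain ⟨d, hd, h⟩ := Part.mem_bind_iff.1 h
    obtain ⟨k, hk⟩ := (hF a c hc).1 m
    obtain ⟨l, hl⟩ := (hG a d hd).1 m
    rw [hk, hl] at hv
    exact lookup_sound (mem_capp.1 h) hv
  · intro a b hb n
    obtain ⟨c, hc, h⟩ := Part.mem_bind_iff.1 hb
    obtain ⟨d, hd, h⟩ := Part.mem_bind_iff.1 h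
    obtain ⟨M, hM⟩ := lookup_complete (mem_capp.1 h) n
    obtain ⟨M₁, h₁⟩ := (hF a c hc).2 M
    obtain ⟨M₂, h₂⟩ := (hG a d hd).2 M
    refine ⟨max M₁ M₂, fun m hm => ?_⟩
    obtain ⟨k, hk⟩ := (hF a c hc).1 m
    obtain ⟨l, hl⟩ := (hG a d hd).1 m
    have e1 := h₁ m (by omega)
    have e2 := h₂ m (by omega)
    rw [hk, length_prefixOf] at e1
    rw [hl, length_prefixOf] at e2
    simp only [hk, hl]
    exact hM k l e1 e2

theorem Rz.ap_total {f : α → Baire} {g : α → β} (hf : Rt f) (hg : Rt g) :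
    Rz fun a => (capp (f a) (g a) : Part γ) :=
  (Rz.ap hf hg).of_le (by simp)

/-! ### Computable points -/

/-- Each value of the output is found by an unbounded search over the prefixes of the computable
input. -/
theorem Rz.computable {F : α → Part β} (hF : Rz F) {a : α} {b : β} (hb : b ∈ F a)
    (ha : Computable (Coded.code a)) : Computable (Coded.code b) := by
  obtain ⟨A, hA, hF⟩ := hF
  have h := hF a b hb
  have hc : Computable₂ fun n m => (A (prefixOf (Coded.code a) m))[n]? :=
    (Computable.list_getElem?.comp (hA.comp ((computable_prefixOf ha).comp Computable.snd))
      Computable.fst).to₂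
  refine Partrec.of_eq_tot (Partrec.rfindOpt hc) fun n => ?_
  have hd : (Nat.rfindOpt fun m => (A (prefixOf (Coded.code a) m))[n]?).Dom := by
    rw [Nat.rfindOpt_dom]
    obtain ⟨M, hM⟩ := h.eventually n
    exact ⟨M, _, hM M le_rfl⟩
  obtain ⟨m, hm⟩ := Nat.rfindOpt_spec (Part.get_mem hd)
  have := h.getElem? hm
  rw [← this]
  exact Part.get_mem hd

theorem Rt.computable {f : α → β} (hf : Rt f) {a : α} (ha : Computable (Coded.code a)) :
    Computable (Coded.code (f a)) := Rz.computable hf (Part.mem_some _) ha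

theorem computable_pt : Computable (Coded.code pt) := Computable.const 0

/-! ### Currying and recursion -/

/-- The s-m-n theorem: an associate for `F a` simulates the machine for `F`, reading as much of `a`
as it has been given of its argument. -/
theorem Rz.curry {F : α → β → Part γ} (hF : Rz fun x : α × β => F x.1 x.2) :
    ∃ K : α → Baire, Rt K ∧ ∀ a b, ∀ c ∈ F a b, c ∈ (capp (K a) b : Part γ) := by
  obtain ⟨A, hA, hF⟩ := hF
  -- Both lists are cut to a common length `m`, which determines exactly the first `2 * m` entries
  -- of the interleaving; the default `0` is never reached.
  let B : List ℕ → List ℕ → List ℕ := fun σ τ =>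
    A ((List.range (2 * min σ.length τ.length)).map fun n => (interleave σ τ n).getD 0)
  have hB : Computable₂ B := by
    refine hA.comp (Primrec.list_map (f := fun x : List ℕ × List ℕ =>
      List.range (2 * min x.1.length x.2.length))
      (g := fun x n => (interleave x.1 x.2 n).getD 0) (Primrec.list_range.comp
      (Primrec.nat_double.comp (Primrec.nat_min.comp (Primrec.list_length.comp Primrec.fst)
        (Primrec.list_length.comp Primrec.snd)))) (Primrec.option_getD.comp (Primrec.cond
        (Primrec.nat_bodd.comp Primrec.snd)
        (Primrec.list_getElem?.comp (Primrec.snd.comp Primrec.fst)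
          (Primrec.nat_div2.comp Primrec.snd))
        (Primrec.list_getElem?.comp (Primrec.fst.comp Primrec.fst)
          (Primrec.nat_div2.comp Primrec.snd))) (Primrec.const 0))).to_comp
  have hBp : ∀ p q m, B (prefixOf p m) (prefixOf q m) = A (prefixOf (Baire.pair p q) (2 * m)) := by
    intro p q m
    simp only [B, length_prefixOf, min_self]
    congr 1
    refine List.map_congr_left fun n hn => ?_
    have hn := List.mem_range.1 hn
    have : n.div2 < m := by rw [Nat.div2_val]; omega
    rw [interleave, pair_eq_bodd, getElem?_prefixOf, getElem?_prefixOf, if_pos this, if_pos this]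
    cases n.bodd <;> rfl
  let dec : ℕ → ℕ × List ℕ := fun k => (Encodable.decode k).getD (0, [])
  have hdec : Computable dec := Computable.option_getD Computable.decode (Computable.const _)
  let K : α → Baire := fun a k =>
    Option.casesOn (B (prefixOf (Coded.code a) (dec k).2.length) (dec k).2)[(dec k).1]? 0
      fun v => v + 1
  refine ⟨K, ?_, fun a b c hc => ?_⟩
  · refine Rt.of_prefix (κ := fun k => (dec k).2.length) (g := fun k σ =>
      Option.casesOn (B σ (dec k).2)[(dec k).1]? 0 fun v => v + 1) ?_
      (Computable.list_length.comp (Computable.snd.comp hdec)) fun a n => rfl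
    exact (Computable.option_casesOn (Computable.list_getElem?.comp
      (hB.comp Computable.snd (Computable.snd.comp (hdec.comp Computable.fst)))
      (Computable.fst.comp (hdec.comp Computable.fst))) (Computable.const 0)
      (Computable.succ.comp Computable.snd).to₂).to₂
  · have ht := hF (a, b) c hc
    refine mem_capp.2 (app_of_machine (A := fun σ => B (prefixOf (Coded.code a) σ.length) σ)
      (fun n m => ?_) ⟨fun m => ?_, fun L => ?_⟩)
    · have : dec (Encodable.encode (n, prefixOf (Coded.code b) m)) =
          (n, prefixOf (Coded.code b) m) := by
        simp only [dec, Encodable.encodek, Option.getD_some]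
      simp only [K, this]
    · simp only [length_prefixOf, hBp]
      exact ht.1 _
    · obtain ⟨M, hM⟩ := ht.2 L
      refine ⟨M, fun m hm => ?_⟩
      simp only [length_prefixOf, hBp]
      exact hM _ (by omega)

/-- A computable map has a computable code. -/
theorem Rz.exists_code {F : α → Part β} (hF : Rz F) :
    ∃ c : Baire, Computable c ∧ ∀ a, ∀ b ∈ F a, b ∈ (capp c a : Part β) := by
  obtain ⟨K, hK, h⟩ := Rz.curry (F := fun (_ : Baire) a => F a) (hF.comp Rt.snd)
  exact ⟨K pt, hK.computable computable_pt, fun a => h pt a⟩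

/-- Kleene's recursion theorem by diagonalization: with `K x · a = x.1 · (x.2, a)` and `h · (x, a) =
F (K (x, x)) a`, the code `K (h, h)` reproduces itself inside `F`. -/
theorem Rz.exists_fix {F : Baire → α → Part β} (hF : Rz fun x : Baire × α => F x.1 x.2) :
    ∃ r : Baire, Computable r ∧ ∀ a, ∀ b ∈ F r a, b ∈ (capp r a : Part β) := by
  obtain ⟨K, hK, hKap⟩ := Rz.curry (α := Baire × Baire) (β := α) (γ := β)
    (F := fun x a => capp x.1 (x.2, a))
    (Rz.ap_total (Rt.fst.comp Rt.fst) ((Rt.snd.comp Rt.fst).pair Rt.snd))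
  obtain ⟨h, hh, hap⟩ := Rz.exists_code (F := fun x : Baire × α => F (K (x.1, x.1)) x.2)
    (hF.comp ((hK.comp (Rt.fst.pair Rt.fst)).pair Rt.snd))
  refine ⟨K (h, h), hK.computable ((Rt.pair Rt.id Rt.id).computable (α := Baire) hh),
    fun a b hb => hKap (h, h) a b (hap (h, a) b hb)⟩

end

attribute [fun_prop] Rt
attribute [fun_prop] Rt.id Rt.comp Rt.fst Rt.snd Rt.pair

/-! ### Tags, columns and their realizability -/

namespace Baire

/-- The injections of the coded tagged union. -/
def inb (b : Bool) (p : Baire) : Baire := bif b then in2 p else in1 p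

/-- The tag of a point of the coded tagged union. -/
def tag (p : Baire) : Bool := decide (p 0 ≠ 0)

/-- The point below the tag. -/
def untag (p : Baire) : Baire := fun n => p (n + 1)

@[simp] theorem tag_inb (b : Bool) (p : Baire) : tag (inb b p) = b := by
  cases b <;> simp [tag, inb, in1, in2]

@[simp] theorem untag_inb (b : Bool) (p : Baire) : untag (inb b p) = p := by
  cases b <;> rfl

/-- The `k`-th column of a coded sequence of points. -/
def col (k : ℕ) (s : Baire) : Baire := fun n => s (Nat.pair k n)

/-- Replacement of the `k`-th column. -/
def upd (k : ℕ) (s x : Baire) : Baire :=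
  fun n => if n.unpair.1 = k then x n.unpair.2 else s n

@[simp] theorem col_upd_self (k : ℕ) (s x : Baire) : col k (upd k s x) = x := by
  funext n
  simp [col, upd]

theorem col_upd_of_ne {k l : ℕ} (h : l ≠ k) (s x : Baire) : col l (upd k s x) = col l s := by
  funext n
  simp [col, upd, h]

end Baire

section

variable {α β γ : Type} [Coded α] [Coded β] [Coded γ]

@[fun_prop]
theorem Rt.baire_pair {f g : α → Baire} (hf : Rt f) (hg : Rt g) :
    Rt fun a => Baire.pair (f a) (g a) :=
  Rt.comp (f := fun x : Baire × Baire => Baire.pair x.1 x.2)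
    (Rt.of_reindex (ι := fun n => n) Computable.id fun _ _ => rfl) (hf.pair hg)

@[fun_prop]
theorem Rt.baire_fst {f : α → Baire} (hf : Rt f) : Rt fun a => Baire.fst (f a) :=
  Rt.comp (f := Baire.fst)
    (Rt.of_reindex (ι := fun n => 2 * n) Primrec.nat_double.to_comp fun _ _ => rfl) hf

@[fun_prop]
theorem Rt.baire_snd {f : α → Baire} (hf : Rt f) : Rt fun a => Baire.snd (f a) :=
  Rt.comp (f := Baire.snd)
    (Rt.of_reindex (ι := fun n => 2 * n + 1) Primrec.nat_double_succ.to_comp fun _ _ => rfl) hf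

@[fun_prop]
theorem Rt.pt : Rt fun _ : α => Baire.pt := Rt.const computable_pt

@[fun_prop]
theorem Rt.bool (b : Bool) : Rt fun _ : α => b := Rt.const (Computable.const _)

@[fun_prop]
theorem Rt.nat (n : ℕ) : Rt fun _ : α => n := Rt.const (Computable.const _)

@[fun_prop]
theorem Rt.cond {g : α → Bool} {f f' : α → β} (hg : Rt g) (hf : Rt f) (hf' : Rt f') :
    Rt fun a => bif g a then f a else f' a := by
  refine Rz.of_le (Rz.cond hg hf hf') fun a b hb => ?_
  cases h : g a <;> simpa [h] using hb

theorem Rt.baire_cons (k : ℕ) {f : α → Baire} (hf : Rt f) :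
    Rt fun a => (fun n => Nat.casesOn n k (f a) : Baire) := by
  refine Rt.comp (f := fun p : Baire => (fun n => Nat.casesOn n k p : Baire)) (Rt.of_prefix
    (g := fun n σ => Nat.casesOn n k fun i => σ.getD i 0) (κ := fun n => n) ?_ Computable.id ?_) hf
  · exact (Primrec.nat_casesOn Primrec.fst (Primrec.const k) ((Primrec.list_getD 0).comp
      (Primrec.snd.comp Primrec.fst) Primrec.snd).to₂).to_comp.to₂
  · intro p n
    cases n with
    | zero => rfl
    | succ n =>
      simp only [Coded.code, List.getD_eq_getElem?_getD, getElem?_prefixOf]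
      simp

@[fun_prop]
theorem Rt.inb {g : α → Bool} {f : α → Baire} (hg : Rt g) (hf : Rt f) :
    Rt fun a => Baire.inb (g a) (f a) :=
  Rt.cond hg (Rt.baire_cons 1 hf) (Rt.baire_cons 0 hf)

@[fun_prop]
theorem Rt.tag {f : α → Baire} (hf : Rt f) : Rt fun a => Baire.tag (f a) := by
  refine Rt.comp (f := Baire.tag) (Rt.of_prefix
    (g := fun n σ => bif decide (σ.getD 0 0 = 0) then 0 else 1) (κ := fun _ => 1) ?_
    (Computable.const 1) ?_) hf
  · exact (Primrec.cond ((Primrec.eq (α := ℕ)).decide.comp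
      ((Primrec.list_getD 0).comp Primrec.snd (Primrec.const 0)) (Primrec.const 0))
      (Primrec.const 0) (Primrec.const 1)).to_comp.to₂
  · intro p n
    simp only [Coded.code, List.getD_eq_getElem?_getD, getElem?_prefixOf, Baire.tag]
    by_cases h : p 0 = 0 <;> simp [h]

@[fun_prop]
theorem Rt.untag {f : α → Baire} (hf : Rt f) : Rt fun a => Baire.untag (f a) :=
  Rt.comp (f := Baire.untag)
    (Rt.of_reindex (ι := fun n => n + 1) Computable.succ fun _ _ => rfl) hf

@[fun_prop]
theorem Rt.col (k : ℕ) {f : α → Baire} (hf : Rt f) : Rt fun a => Baire.col k (f a) :=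
  Rt.comp (f := Baire.col k) (Rt.of_reindex (ι := fun n => Nat.pair k n)
    (Primrec₂.natPair.comp (Primrec.const k) Primrec.id).to_comp fun _ _ => rfl) hf

@[fun_prop]
theorem Rt.upd (k : ℕ) {f g : α → Baire} (hf : Rt f) (hg : Rt g) :
    Rt fun a => Baire.upd k (f a) (g a) := by
  refine Rt.comp (f := fun x : Baire × Baire => Baire.upd k x.1 x.2) (Rt.of_reindex
    (ι := fun n => bif decide (n.unpair.1 = k) then 2 * n.unpair.2 + 1 else 2 * n)
    ?_ ?_) (hf.pair hg)
  · exact (Primrec.cond ((Primrec.eq (α := ℕ)).decide.comp (Primrec.fst.comp Primrec.unpair)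
      (Primrec.const k)) (Primrec.nat_double_succ.comp (Primrec.snd.comp Primrec.unpair))
      Primrec.nat_double).to_comp
  · intro x n
    have h1 (p q : Baire) (n : ℕ) : Baire.pair p q (2 * n) = p n := by simp [Baire.pair]
    have h2 (p q : Baire) (n : ℕ) : Baire.pair p q (2 * n + 1) = q n :=
      congrFun (snd_pair p q) n
    by_cases h : n.unpair.1 = k <;> simp [Coded.code, Baire.upd, h, h1, h2]

@[fun_prop]
theorem Rt.nat_beq {f : α → ℕ} (k : ℕ) (hf : Rt f) : Rt fun a => decide (f a = k) := by
  refine Rt.comp (f := fun n : ℕ => decide (n = k)) (Rt.of_prefix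
    (g := fun n σ => bif decide (σ.getD 0 0 = k) then 1 else 0) (κ := fun _ => 1) ?_
    (Computable.const 1) ?_) hf
  · exact (Primrec.cond ((Primrec.eq (α := ℕ)).decide.comp
      ((Primrec.list_getD 0).comp Primrec.snd (Primrec.const 0)) (Primrec.const k))
      (Primrec.const 1) (Primrec.const 0)).to_comp.to₂
  · intro p n
    simp only [Coded.code, List.getD_eq_getElem?_getD, getElem?_prefixOf]
    by_cases h : p = k <;> simp [h]

/-- A finite case distinction between realizable maps is realizable. -/
theorem Rz.dispatch {F : ℕ → α → Part β} (N : ℕ) (hF : ∀ i < N, Rz (F i)) :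
    Rz fun x : ℕ × α => if x.1 < N then F x.1 x.2 else Part.none := by
  induction N with
  | zero => exact ⟨id, Computable.id, by simp⟩
  | succ N ih =>
    have h1 := ih fun i hi => hF i (by omega)
    refine Rz.of_le (Rz.cond (g := fun x : ℕ × α => decide (x.1 = N)) (by fun_prop)
      ((hF N (by omega)).comp Rt.snd) h1) fun x b hb => ?_
    by_cases h : x.1 = N
    · simpa [h] using hb
    · have : x.1 < N ↔ x.1 < N + 1 := by omega
      simpa [h, this] using hb

theorem Rz.ap_map {g : α → Baire} {f : α → β} (hg : Rt g) (hf : Rt f) {δ : Type} [Coded δ]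
    {h : α → γ → δ} (hh : Rt fun x : α × γ => h x.1 x.2) :
    Rz fun a => (capp (g a) (f a) : Part γ).map (h a) :=
  Rz.map (Rz.ap_total hg hf) hh

end

/-! ### Transitions of terms and of their instances -/

namespace RegE

variable {A : Type*}

/-- The two (possibly equal) successors of an expression. -/
def nxt : RegE A → Bool → RegE A
  | join e f, b => bif b then f else e
  | meet e f, b => bif b then f else e
  | iter e, b => bif b then comp (iter e) e else one
  | comp g one, _ => g
  | comp g e, b => comp g (nxt e b)
  | _, _ => one

theorem nxt_comp {g e : RegE A} (h : e ≠ one) (b : Bool) :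
    nxt (comp g e) b = comp g (nxt e b) := by
  cases e <;> first | rfl | exact absurd rfl h

theorem TopZeroFree.nxt {t : RegE A} (ht : t.TopZeroFree) (b : Bool) :
    (t.nxt b).TopZeroFree := by
  induction t with
  | zero => exact ht.elim
  | top => exact ht.elim
  | var | one => trivial
  | join e f | meet e f => cases b; exacts [ht.1, ht.2]
  | iter e => cases b; exacts [trivial, ⟨ht, ht⟩]
  | comp g e _ ih =>
    by_cases he : e = one
    · subst he; exact ht.1
    · rw [nxt_comp he]; exact ⟨ht.1, ih ht.2⟩

theorem step_nxt {t : RegE A} (ht : t.TopZeroFree) (h1 : t ≠ one) (b : Bool) :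
    t.Step (t.nxt b) := by
  induction t with
  | zero => exact ht.elim
  | top => exact ht.elim
  | one => exact absurd rfl h1
  | var a => exact .var a
  | join e f => cases b; exacts [.join_left e f, .join_right e f]
  | meet e f => cases b; exacts [.meet_left e f, .meet_right e f]
  | iter e => cases b; exacts [.iter_one e, .iter_unfold e]
  | comp g e _ ih =>
    by_cases he : e = one
    · subst he; exact .comp_one g
    · rw [nxt_comp he]; exact .comp_right g (ih ht.2 he)

theorem not_step_one {t : RegE A} : ¬ Step one t := nofun

/-- Without `⊤` and `0`, every term other than `1` has one or two successors, so a Boolean suffices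
to name them. -/
theorem step_iff {t t' : RegE A} (ht : t.TopZeroFree) (h1 : t ≠ one) :
    t.Step t' ↔ ∃ b, t' = t.nxt b := by
  constructor
  · intro h
    clear h1
    induction h with
    | join_left => exact ⟨false, rfl⟩
    | join_right => exact ⟨true, rfl⟩
    | meet_left => exact ⟨false, rfl⟩
    | meet_right => exact ⟨true, rfl⟩
    | var => exact ⟨false, rfl⟩
    | comp_one => exact ⟨false, rfl⟩
    | iter_one => exact ⟨false, rfl⟩
    | iter_unfold => exact ⟨true, rfl⟩
    | comp_right g h ih =>
      obtain ⟨b, rfl⟩ := ih ht.2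
      refine ⟨b, (nxt_comp ?_ b).symm⟩
      rintro rfl
      exact not_step_one h
  · rintro ⟨b, rfl⟩
    exact step_nxt ht h1 b

theorem nxt_eq_of_letter {t : RegE A} {a : A} (h : t.pol = .letter a) (b : Bool) :
    t.nxt b = t.nxt false := by
  induction t with
  | var => rfl
  | comp g e _ ih =>
    by_cases he : e = one
    · subst he; rfl
    · rw [nxt_comp he, nxt_comp he, ih h]
  | _ => cases h

/-- The problem solved by a single transition of an expression. -/
def head (ρ : A → WProblem) (t : RegE A) : WProblem :=
  match t.pol with
  | .ex => .one
  | .all => WProblem.one.meet .one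
  | .letter a => ρ a

/-- In an expression of universal polarity the answer selects the successor. -/
def Selects (t : RegE A) (x : Baire) (b : Bool) : Prop := t.pol = .all → tag x = b

variable {ρ : A → WProblem}

/-- `LS ρ t w x b w' bk`: the instance `w` of `t` and the answer `x` lead to the instance `w'` of
the successor of `t` selected by `b`; `bk` maps solutions of `w'` to solutions of `w`. -/
inductive LS (ρ : A → WProblem) :
    RegE A → Baire → Baire → Bool → Baire → (Baire → Baire) → Prop
  | var (a : A) (u x : Baire) (hx : x ∈ (ρ a).sol u) :
      LS ρ (var a) u x false pt fun _ => x
  | join (e f : RegE A) (b : Bool) (u : Baire) : LS ρ (join e f) (inb b u) pt b u id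
  | meet (e f : RegE A) (b : Bool) (u v : Baire) :
      LS ρ (meet e f) (pair u v) (inb b pt) b (bif b then v else u) (inb b)
  | iter (e : RegE A) (b : Bool) (u : Baire) : LS ρ (iter e) (inb b u) pt b u id
  | comp_one (g : RegE A) (c v : Baire) (h : App c pt v) :
      LS ρ (comp g one) (pair pt c) pt false v (pair pt)
  | comp (g e : RegE A) (u c x : Baire) (b : Bool) (u' c' : Baire) (bk : Baire → Baire)
      (he : e ≠ one) (h : LS ρ e u x b u' bk)
      (hc : ∀ y ∈ ((e.nxt b).interp ρ).sol u', ∀ v, App c (bk y) v → App c' y v) :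
      LS ρ (comp g e) (pair u c) x b (pair u' c')
        fun z => pair (bk (Baire.fst z)) (Baire.snd z)

theorem _root_.Baire.inb_inj {b b' : Bool} {u u' : Baire} (h : inb b u = inb b' u') :
    b = b' ∧ u = u' :=
  ⟨by simpa using congrArg tag h, by simpa using congrArg untag h⟩

theorem mem_dom_iter {e : RegE A} {w : Baire} (h : w ∈ ((iter e).interp ρ).dom) :
    ∃ b u, w = inb b u ∧ u ∈ (((iter e).nxt b).interp ρ).dom := by
  cases h with
  | done => exact ⟨false, pt, rfl, rfl⟩
  | step u c hu hdef hrec =>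
    refine ⟨true, pair u c, rfl, u, hu, c, rfl, fun x hx => ?_⟩
    obtain ⟨v, hv⟩ := hdef x hx
    exact ⟨v, hrec x hx v hv, hv⟩

theorem inb_mem_dom_iter {e : RegE A} {b : Bool} {u : Baire} :
    inb b u ∈ ((iter e).interp ρ).dom ↔ u ∈ (((iter e).nxt b).interp ρ).dom := by
  constructor
  · intro h
    obtain ⟨b', u', h', hu⟩ := mem_dom_iter h
    obtain ⟨rfl, rfl⟩ := inb_inj h'
    exact hu
  · intro h
    cases b with
    | false =>
      obtain rfl : u = pt := h
      exact .done
    | true =>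
      obtain ⟨u, hu, c, rfl, h⟩ := h
      refine WProblem.IterDom.step u c hu (fun x hx => ?_) fun x hx v hv => ?_
      · obtain ⟨v, -, hv⟩ := h x hx
        exact ⟨v, hv⟩
      · obtain ⟨v', hv', hv''⟩ := h x hx
        rwa [hv.unique hv'']

theorem mem_sol_iter {e : RegE A} {b : Bool} {u z : Baire}
    (hu : u ∈ (((iter e).nxt b).interp ρ).dom) :
    z ∈ ((iter e).interp ρ).sol (inb b u) ↔ z ∈ (((iter e).nxt b).interp ρ).sol u := by
  -- The instance is replaced by a variable with an equation, so that the inductive predicate can be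
  -- inverted.
  have key : ∀ w, z ∈ ((iter e).interp ρ).sol w → w = inb b u →
      z ∈ (((iter e).nxt b).interp ρ).sol u := by
    intro w h hw
    cases h with
    | done =>
      obtain ⟨rfl, rfl⟩ := inb_inj (b := false) hw
      exact rfl
    | step u' c x v y hu' hx hv hy =>
      obtain ⟨rfl, rfl⟩ := inb_inj (b := true) hw
      exact ⟨u', hu', c, rfl, x, hx, v, hv, y, hy, rfl⟩
  refine ⟨fun h => key _ h rfl, fun h => ?_⟩
  cases b with
  | false =>
    obtain rfl : u = pt := hu
    obtain rfl : z = pt := h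
    exact WProblem.IterSol.done
  | true =>
    obtain ⟨u, hu', c, rfl, x, hx, v, hv, y, hy, rfl⟩ := h
    exact WProblem.IterSol.step u c x v y hu' hx hv hy

theorem mem_dom_join {e f : RegE A} {w : Baire} :
    w ∈ ((join e f).interp ρ).dom ↔
      ∃ b u, w = inb b u ∧ u ∈ (((join e f).nxt b).interp ρ).dom := by
  constructor
  · rintro (⟨u, hu, rfl⟩ | ⟨u, hu, rfl⟩)
    · exact ⟨false, u, rfl, hu⟩
    · exact ⟨true, u, rfl, hu⟩
  · rintro ⟨b, u, rfl, hu⟩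
    cases b
    · exact Or.inl ⟨u, hu, rfl⟩
    · exact Or.inr ⟨u, hu, rfl⟩

theorem inb_mem_dom_join {e f : RegE A} {b : Bool} {u : Baire} :
    inb b u ∈ ((join e f).interp ρ).dom ↔ u ∈ (((join e f).nxt b).interp ρ).dom := by
  rw [mem_dom_join]
  constructor
  · rintro ⟨b', u', h', hu⟩
    obtain ⟨rfl, rfl⟩ := inb_inj h'
    exact hu
  · intro h
    exact ⟨b, u, rfl, h⟩

theorem mem_sol_join {e f : RegE A} {b : Bool} {u z : Baire}
    (hu : u ∈ (((join e f).nxt b).interp ρ).dom) :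
    z ∈ ((join e f).interp ρ).sol (inb b u) ↔ z ∈ (((join e f).nxt b).interp ρ).sol u := by
  constructor
  · rintro (⟨u', -, h', hz⟩ | ⟨u', -, h', hz⟩)
    · obtain ⟨rfl, rfl⟩ := inb_inj (b' := false) h'
      exact hz
    · obtain ⟨rfl, rfl⟩ := inb_inj (b' := true) h'
      exact hz
  · intro h
    cases b
    · exact Or.inl ⟨u, hu, rfl, h⟩
    · exact Or.inr ⟨u, hu, rfl, h⟩

theorem mem_sol_meet {e f : RegE A} {u v z : Baire} (hu : u ∈ (e.interp ρ).dom)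
    (hv : v ∈ (f.interp ρ).dom) :
    z ∈ ((meet e f).interp ρ).sol (pair u v) ↔
      ∃ b y, z = inb b y ∧ y ∈ (((meet e f).nxt b).interp ρ).sol (bif b then v else u) := by
  constructor
  · rintro ⟨u', -, v', -, h, h'⟩
    obtain ⟨rfl, rfl⟩ := pair_inj h
    rcases h' with ⟨x, hx, rfl⟩ | ⟨x, hx, rfl⟩
    · exact ⟨false, x, rfl, hx⟩
    · exact ⟨true, x, rfl, hx⟩
  · rintro ⟨b, y, rfl, hy⟩
    refine ⟨u, hu, v, hv, rfl, ?_⟩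
    cases b
    · exact Or.inl ⟨y, hy, rfl⟩
    · exact Or.inr ⟨y, hy, rfl⟩

theorem pair_mem_dom_comp {g e : RegE A} {u c : Baire} :
    pair u c ∈ ((comp g e).interp ρ).dom ↔ u ∈ (e.interp ρ).dom ∧
      ∀ x ∈ (e.interp ρ).sol u, ∃ v ∈ (g.interp ρ).dom, App c x v := by
  constructor
  · rintro ⟨u', hu, c', h, h'⟩
    obtain ⟨rfl, rfl⟩ := pair_inj h
    exact ⟨hu, h'⟩
  · rintro ⟨hu, h⟩
    exact ⟨u, hu, c, rfl, h⟩

theorem mem_sol_comp {g e : RegE A} {u c z : Baire} (hu : u ∈ (e.interp ρ).dom) :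
    z ∈ ((comp g e).interp ρ).sol (pair u c) ↔ ∃ x ∈ (e.interp ρ).sol u, ∃ v, App c x v ∧
      ∃ y ∈ (g.interp ρ).sol v, z = pair x y := by
  constructor
  · rintro ⟨u', -, c', h, h'⟩
    obtain ⟨rfl, rfl⟩ := pair_inj h
    exact h'
  · intro h
    exact ⟨u, hu, c, rfl, h⟩

/-- Under a composition, the continuation `c'` of the successor acts on a solution `y` as `c` acts
on `bk y`. Hence domain and solutions are preserved although only the right factor moves. -/
theorem LS.sound {t : RegE A} {u x : Baire} {b : Bool} {u' : Baire} {bk : Baire → Baire}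
    (h : LS ρ t u x b u' bk) (hu : u ∈ (t.interp ρ).dom) :
    u' ∈ ((t.nxt b).interp ρ).dom ∧
      ∀ y ∈ ((t.nxt b).interp ρ).sol u', bk y ∈ (t.interp ρ).sol u := by
  induction h with
  | var a u x hx => exact ⟨rfl, fun _ _ => hx⟩
  | join e f b u =>
    have := inb_mem_dom_join.1 hu
    exact ⟨this, fun y hy => (mem_sol_join this).2 hy⟩
  | meet e f b u v =>
    obtain ⟨u', hu', v', hv', h⟩ := hu
    obtain ⟨rfl, rfl⟩ := pair_inj h
    refine ⟨by cases b; exacts [hu', hv'], fun y hy => (mem_sol_meet hu' hv').2 ⟨b, y, rfl, hy⟩⟩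
  | iter e b u =>
    have := inb_mem_dom_iter.1 hu
    exact ⟨this, fun y hy => (mem_sol_iter this).2 hy⟩
  | comp_one g c v h =>
    obtain ⟨h1, h2⟩ := pair_mem_dom_comp.1 hu
    obtain ⟨v', hv', h'⟩ := h2 pt rfl
    rw [h.unique h']
    exact ⟨hv', fun y hy => (mem_sol_comp h1).2 ⟨pt, rfl, v', h', y, hy, rfl⟩⟩
  | comp g e u c x b u' c' bk he h hc ih =>
    obtain ⟨h1, h2⟩ := pair_mem_dom_comp.1 hu
    obtain ⟨hu', hbk⟩ := ih h1
    rw [nxt_comp he]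
    have hd : pair u' c' ∈ ((RegE.comp g (e.nxt b)).interp ρ).dom := by
      refine pair_mem_dom_comp.2 ⟨hu', fun y hy => ?_⟩
      obtain ⟨v, hv, hcv⟩ := h2 _ (hbk y hy)
      exact ⟨v, hv, hc y hy v hcv⟩
    refine ⟨hd, fun z hz => ?_⟩
    obtain ⟨y, hy, v, hv, y', hy', rfl⟩ := (mem_sol_comp hu').1 hz
    obtain ⟨v', -, hcv⟩ := h2 _ (hbk y hy)
    rw [← (hc y hy v' hcv).unique hv] at hy'
    exact (mem_sol_comp h1).2 ⟨bk y, hbk y hy, v', hcv, y', hy', by simp⟩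

/-! ### Well-foundedness of unfolding -/

/-- The unfolding relation on pairs of an expression and an instance. -/
def Unfolds (ρ : A → WProblem) (q p : RegE A × Baire) : Prop :=
  ∃ x b bk, LS ρ p.1 p.2 x b q.2 bk ∧ q.1 = p.1.nxt b

/-- The composition unfolds as its right factor does, until that factor is `1` and control passes to
an instance of the left one. The induction is on accessibility of the right factor. -/
theorem acc_comp {h t : RegE A} {u c : Baire} (ht : Acc (Unfolds ρ) (t, u))
    (hu : u ∈ (t.interp ρ).dom)
    (hc : ∀ x ∈ (t.interp ρ).sol u, ∃ v, App c x v ∧ Acc (Unfolds ρ) (h, v)) :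
    Acc (Unfolds ρ) (comp h t, pair u c) := by
  generalize hp : (t, u) = p at ht
  induction ht generalizing t u c with
  | intro p _ ih =>
    subst hp
    refine Acc.intro _ ?_
    rintro ⟨t', w'⟩ ⟨x, b, bk, hls, ht'⟩
    simp only at hls ht'
    subst ht'
    generalize hs : comp h t = s at hls
    generalize hw : pair u c = w at hls
    cases hls with
    | comp_one g c' v hv =>
      obtain ⟨rfl, rfl⟩ := RegE.comp.inj hs
      obtain ⟨rfl, rfl⟩ := pair_inj hw
      obtain ⟨v', hv', h'⟩ := hc pt rfl
      rw [hv.unique hv']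
      exact h'
    | comp g e u₁ c₁ _ _ u' c' bk he hls' hc' =>
      obtain ⟨rfl, rfl⟩ := RegE.comp.inj hs
      obtain ⟨rfl, rfl⟩ := pair_inj hw
      rw [nxt_comp he]
      obtain ⟨hu', hbk⟩ := hls'.sound hu
      refine ih (t.nxt b, u') ⟨x, b, bk, hls', rfl⟩ hu' (fun y hy => ?_) rfl
      obtain ⟨v, hv, hacc⟩ := hc _ (hbk y hy)
      exact ⟨v, hc' y hy v hv, hacc⟩
    | _ => cases hs

theorem acc_one {u : Baire} : Acc (Unfolds ρ) (one, u) :=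
  Acc.intro _ fun q ⟨x, b, bk, h, _⟩ => by cases h

/-- Structural induction on the term. For an iteration, a second induction uses that its domain is a
least set: each round runs one instance of `e` and continues at an instance added earlier. -/
theorem acc_of_mem_dom {t : RegE A} {u : Baire} (hu : u ∈ (t.interp ρ).dom) :
    Acc (Unfolds ρ) (t, u) := by
  induction t generalizing u with
  | zero => exact hu.elim
  | one => exact acc_one
  | top => exact Acc.intro _ fun q ⟨x, b, bk, h, _⟩ => by cases h
  | var a =>
    refine Acc.intro _ ?_
    rintro ⟨t', u'⟩ ⟨x, b, bk, h, ht'⟩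
    cases h
    obtain rfl : t' = one := ht'
    exact acc_one
  | join e f ihe ihf =>
    refine Acc.intro _ ?_
    rintro ⟨t', u'⟩ ⟨x, b, bk, h, ht'⟩
    have := (h.sound hu).1
    obtain rfl : t' = bif b then f else e := ht'
    cases b
    · exact ihe this
    · exact ihf this
  | meet e f ihe ihf =>
    refine Acc.intro _ ?_
    rintro ⟨t', u'⟩ ⟨x, b, bk, h, ht'⟩
    have := (h.sound hu).1
    obtain rfl : t' = bif b then f else e := ht'
    cases b
    · exact ihe this
    · exact ihf this
  | comp g e ihg ihe =>
    obtain ⟨u, hu, c, rfl, hc⟩ := hu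
    refine acc_comp (ihe hu) hu fun x hx => ?_
    obtain ⟨v, hv, hcv⟩ := hc x hx
    exact ⟨v, hcv, ihg hv⟩
  | iter e ih =>
    change WProblem.IterDom (e.interp ρ) u at hu
    induction hu with
    | done =>
      refine Acc.intro _ ?_
      rintro ⟨t', u'⟩ ⟨x, b, bk, h, ht'⟩
      simp only at h ht'
      generalize hw : in1 pt = w at h
      cases h
      obtain ⟨rfl, rfl⟩ := inb_inj (b := false) hw
      subst ht'
      exact acc_one
    | step u c hu hdef hrec ih' =>
      refine Acc.intro _ ?_
      rintro ⟨t', u'⟩ ⟨x, b, bk, h, ht'⟩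
      simp only at h ht'
      generalize hw : in2 (pair u c) = w at h
      cases h
      obtain ⟨rfl, rfl⟩ := inb_inj (b := true) hw
      subst ht'
      refine acc_comp (ih hu) hu fun x hx => ?_
      obtain ⟨v, hv⟩ := hdef x hx
      exact ⟨v, hv, ih' x hx v hv⟩

end RegE

/-! ### Computable decomposition and construction of instances -/

namespace RegE

variable {A : Type*} {ρ : A → WProblem}

/-- A code of a map that ignores its argument. -/
theorem exists_const_code {α β : Type} [Coded α] [Coded β] :
    ∃ K : β → Baire, Rt K ∧ ∀ (b : β) (a : α), b ∈ (capp (K b) a : Part β) := by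
  obtain ⟨K, hK, h⟩ := Rz.curry (F := fun (b : β) (_ : α) => Part.some b) Rt.fst
  exact ⟨K, hK, fun b a => h b a b (Part.mem_some _)⟩

theorem exists_fun_code {α β : Type} [Coded α] [Coded β] {f : α → β} (hf : Rt f) :
    ∃ c : Baire, Computable c ∧ ∀ a, f a ∈ (capp c a : Part β) := by
  obtain ⟨c, hc, h⟩ := Rz.exists_code hf
  exact ⟨c, hc, fun a => h a _ (Part.mem_some _)⟩

/-- `q` and `κ` describe the first transition from the instance `w` of `t`: the query `q` and the
code `κ` that maps an answer to the successor, its instance, and a code of the back map. -/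
def Destructs (ρ : A → WProblem) (t : RegE A) (w q κ : Baire) : Prop :=
  q ∈ (head ρ t).dom ∧ ∀ x ∈ (head ρ t).sol q, ∃ b w' β bk,
    (b, w', β) ∈ (capp κ x : Part (Bool × Baire × Baire)) ∧ Selects t x b ∧
      LS ρ t w x b w' bk ∧ ∀ y ∈ ((t.nxt b).interp ρ).sol w', bk y ∈ (capp β y : Part Baire)

/-- Induction on the term: in a composition whose right factor is not `1`, the query comes from the
right factor, and the left one is only carried along as a code. -/
theorem exists_destructor (ρ : A → WProblem) {t : RegE A} (ht : t.TopZeroFree) (h1 : t ≠ one) :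
    ∃ D : Baire → Part (Baire × Baire), Rz D ∧
      ∀ w ∈ (t.interp ρ).dom, ∃ q κ, (q, κ) ∈ D w ∧ Destructs ρ t w q κ := by
  obtain ⟨cid, hcid, hid⟩ := exists_fun_code (f := fun x : Baire => x) Rt.id
  have hcid' : Rt fun _ : Baire => cid := Rt.const hcid
  obtain ⟨Kc, hKc, hKc'⟩ := exists_const_code (α := Baire) (β := Bool × Baire × Baire)
  obtain ⟨Kx, hKx, hKx'⟩ := exists_const_code (α := Baire) (β := Baire)
  induction t with
  | zero => exact ht.elim
  | top => exact ht.elim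
  | one => exact absurd rfl h1
  | var a =>
    obtain ⟨κ, hκ, hκ'⟩ := exists_fun_code
      (f := fun x : Baire => (false, Baire.pt, Kx x)) (by fun_prop)
    have hκc : Rt fun _ : Baire => κ := Rt.const hκ
    refine ⟨fun w => Part.some (w, κ), (by fun_prop : Rt fun w : Baire => (w, κ)),
      fun w hw => ⟨w, κ, Part.mem_some _, hw, fun x hx =>
        ⟨false, pt, Kx x, _, hκ' x, nofun, .var a w x hx, fun y _ => hKx' x y⟩⟩⟩
  | join e f =>
    refine ⟨fun w => Part.some (pt, Kc (tag w, untag w, cid)),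
      (by fun_prop : Rt fun w : Baire => (pt, Kc (tag w, untag w, cid))), fun w hw => ?_⟩
    obtain ⟨b, u, rfl, hu⟩ := mem_dom_join.1 hw
    refine ⟨_, _, Part.mem_some _, rfl, fun x hx => ?_⟩
    obtain rfl : x = pt := hx
    refine ⟨b, u, cid, _, ?_, nofun, .join e f b u, fun y _ => hid y⟩
    simpa using hKc' (b, u, cid) pt
  | iter e =>
    refine ⟨fun w => Part.some (pt, Kc (tag w, untag w, cid)),
      (by fun_prop : Rt fun w : Baire => (pt, Kc (tag w, untag w, cid))), fun w hw => ?_⟩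
    obtain ⟨b, u, rfl, hu⟩ := mem_dom_iter hw
    refine ⟨_, _, Part.mem_some _, rfl, fun x hx => ?_⟩
    obtain rfl : x = pt := hx
    refine ⟨b, u, cid, _, ?_, nofun, .iter e b u, fun y _ => hid y⟩
    simpa using hKc' (b, u, cid) pt
  | meet e f =>
    obtain ⟨c, hc, hc'⟩ : ∃ c : Bool → Baire, (∀ b, Computable (c b)) ∧
        ∀ b y, inb b y ∈ (capp (c b) y : Part Baire) := by
      choose c hc hc' using fun b : Bool =>
        exists_fun_code (f := fun y : Baire => inb b y) (by fun_prop)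
      exact ⟨c, hc, hc'⟩
    have h0 : Rt fun _ : Baire × Baire => c false := Rt.const (hc false)
    have h1 : Rt fun _ : Baire × Baire => c true := Rt.const (hc true)
    obtain ⟨K, hK, hK'⟩ := Rz.curry (α := Baire) (β := Baire) (γ := Bool × Baire × Baire)
      (F := fun w x => Part.some (tag x,
        bif tag x then Baire.snd w else Baire.fst w, bif tag x then c true else c false))
      (by fun_prop : Rt fun x : Baire × Baire => (tag x.2,
        bif tag x.2 then Baire.snd x.1 else Baire.fst x.1,
        bif tag x.2 then c true else c false))
    refine ⟨fun w => Part.some (pair pt pt, K w),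
      (by fun_prop : Rt fun w : Baire => (pair pt pt, K w)), fun w hw => ?_⟩
    obtain ⟨u, hu, v, hv, rfl⟩ := hw
    refine ⟨_, _, Part.mem_some _, ⟨pt, rfl, pt, rfl, rfl⟩, fun x hx => ?_⟩
    obtain ⟨b, rfl⟩ : ∃ b, x = inb b pt := by
      obtain ⟨_, _, _, _, -, (⟨x, hx, rfl⟩ | ⟨x, hx, rfl⟩)⟩ := hx
      · obtain rfl : x = pt := hx
        exact ⟨false, rfl⟩
      · obtain rfl : x = pt := hx
        exact ⟨true, rfl⟩
    refine ⟨b, bif b then v else u, c b, _, ?_, fun _ => tag_inb b pt, .meet e f b u v,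
      fun y _ => hc' b y⟩
    have := hK' (pair u v) (inb b pt) _ (Part.mem_some _)
    cases b <;> simpa using this
  | comp g e _ ih =>
    by_cases he : e = one
    · subst he
      obtain ⟨cp, hcp, hcp'⟩ := exists_fun_code (f := fun y : Baire => pair pt y) (by fun_prop)
      have hcp'' : Rt fun _ : Baire × Baire => cp := Rt.const hcp
      refine ⟨fun w => (capp (Baire.snd w) pt : Part Baire).map
        fun v => (pt, Kc (false, v, cp)), Rz.ap_map (by fun_prop) (by fun_prop)
          (by fun_prop), fun w hw => ?_⟩
      obtain ⟨u, hu, c, rfl, hc⟩ := hw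
      obtain rfl : u = pt := hu
      obtain ⟨v, hv, hcv⟩ := hc pt rfl
      refine ⟨_, _, (Part.mem_map_iff _).2 ⟨v, by simpa using mem_capp.2 hcv, rfl⟩, rfl,
        fun x hx => ?_⟩
      obtain rfl : x = pt := hx
      exact ⟨false, v, cp, _, hKc' _ _, nofun, .comp_one g c v hcv, fun y _ => hcp' y⟩
    · obtain ⟨D, hD, ih⟩ := ih ht.2 he
      -- `K₁` lifts a back map to solution pairs, `K₂` precomposes the continuation with the back
      -- map, and `K₃` assembles the successor instance from the answer.
      obtain ⟨K₁, hK₁, hK₁'⟩ := Rz.curry (α := Baire) (β := Baire) (γ := Baire)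
        (F := fun β z => (capp β (Baire.fst z) : Part Baire).map
          fun y => pair y (Baire.snd z))
        (Rz.ap_map (by fun_prop) (by fun_prop) (by fun_prop))
      obtain ⟨K₂, hK₂, hK₂'⟩ := Rz.curry (α := Baire × Baire) (β := Baire) (γ := Baire)
        (F := fun x y => (capp x.2 y : Part Baire).bind fun y' => (capp x.1 y' : Part Baire))
        (Rz.bind (Rz.ap_total (by fun_prop) (by fun_prop))
          (Rz.ap_total (by fun_prop) (by fun_prop)))
      obtain ⟨K₃, hK₃, hK₃'⟩ := Rz.curry (α := Baire × Baire) (β := Baire)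
        (γ := Bool × Baire × Baire)
        (F := fun x y => (capp x.2 y : Part (Bool × Baire × Baire)).map
          fun r => (r.1, pair r.2.1 (K₂ (x.1, r.2.2)), K₁ r.2.2))
        (Rz.ap_map (by fun_prop) (by fun_prop) (by fun_prop))
      refine ⟨fun w => (D (Baire.fst w)).map fun r => (r.1, K₃ (Baire.snd w, r.2)),
        Rz.map (hD.comp (by fun_prop)) (by fun_prop), fun w hw => ?_⟩
      obtain ⟨u, hu, c, rfl, hc⟩ := hw
      obtain ⟨q, κ, hqκ, hq, hκ⟩ := ih u hu
      refine ⟨_, _, (Part.mem_map_iff _).2 ⟨(q, κ), by simpa using hqκ, rfl⟩, hq,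
        fun x hx => ?_⟩
      obtain ⟨b, u', β, bk, h1, h2, h3, h4⟩ := hκ x hx
      obtain ⟨hu', hbk⟩ := h3.sound hu
      refine ⟨b, pair u' (K₂ (c, β)), K₁ β, _, hK₃' _ _ _ ((Part.mem_map_iff _).2
        ⟨_, h1, by simp⟩), h2, .comp g e u c x b u' _ bk he h3 fun y hy v hv => ?_,
        fun z hz => ?_⟩
      · exact mem_capp.1 (hK₂' (c, β) y v (Part.mem_bind_iff.2 ⟨_, h4 y hy, mem_capp.2 hv⟩))
      · rw [nxt_comp he] at hz
        obtain ⟨y, hy, v, hv, y', hy', rfl⟩ := (mem_sol_comp hu').1 hz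
        refine hK₁' β _ _ ((Part.mem_map_iff _).2 ⟨bk y, ?_, by simp⟩)
        simpa using h4 y hy

/-- `q` and `κ` describe a first transition towards an instance of `t`: `κ` maps every answer to
the query `q` to an instance of a successor of `t`. -/
def Queries (ρ : A → WProblem) (t : RegE A) (q κ : Baire) : Prop :=
  q ∈ (head ρ t).dom ∧ ∀ x ∈ (head ρ t).sol q, ∃ b w',
    (b, w') ∈ (capp κ x : Part (Bool × Baire)) ∧ Selects t x b ∧ w' ∈ ((t.nxt b).interp ρ).dom

/-- The code `γ` decomposes every solution of the instance `w` of `t` into an answer `x` to the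
query `q` and a solution of the instance given by `κ` for that answer. -/
def Constructs (ρ : A → WProblem) (t : RegE A) (q κ w γ : Baire) : Prop :=
  w ∈ (t.interp ρ).dom ∧ ∀ z ∈ (t.interp ρ).sol w, ∃ x y b w',
    (x, y) ∈ (capp γ z : Part (Baire × Baire)) ∧ x ∈ (head ρ t).sol q ∧
      (b, w') ∈ (capp κ x : Part (Bool × Baire)) ∧ y ∈ ((t.nxt b).interp ρ).sol w'

/-- The converse of the decomposition. The map `C` is chosen before the valuation, since Spoiler's
valuation is itself defined from constructed instances. -/
theorem exists_constructor {t : RegE A} (ht : t.TopZeroFree) (h1 : t ≠ one) :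
    ∃ C : Baire × Baire → Part (Baire × Baire), Rz C ∧
      ∀ (ρ : A → WProblem) (q κ : Baire), Queries ρ t q κ → ∃ w γ, (w, γ) ∈ C (q, κ) ∧ Constructs ρ t q κ w γ := by
  obtain ⟨cpt, hcpt, hpt⟩ := exists_fun_code (f := fun z : Baire => (pt, z)) (by fun_prop)
  have hcpt' : Rt fun _ : (Baire × Baire) × Bool × Baire => cpt := Rt.const hcpt
  induction t with
  | zero => exact ht.elim
  | top => exact ht.elim
  | one => exact absurd rfl h1
  | var a =>
    obtain ⟨c, hc, hc'⟩ := exists_fun_code (f := fun z : Baire => (z, pt)) (by fun_prop)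
    have hc'' : Rt fun _ : Baire × Baire => c := Rt.const hc
    refine ⟨fun x => Part.some (x.1, c), (by fun_prop : Rt fun x : Baire × Baire => (x.1, c)),
      fun ρ q κ h => ⟨q, c, Part.mem_some _, h.1, fun z hz => ?_⟩⟩
    obtain ⟨b, w', h1, -, h2⟩ := h.2 z hz
    exact ⟨z, pt, b, w', hc' z, hz, h1, rfl⟩
  | join e f =>
    refine ⟨fun x => (capp x.2 pt : Part (Bool × Baire)).map fun r => (inb r.1 r.2, cpt),
      Rz.ap_map (by fun_prop) (by fun_prop) (by fun_prop), fun ρ q κ h => ?_⟩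
    obtain ⟨b, w', h1, -, h2⟩ := h.2 pt rfl
    refine ⟨inb b w', cpt, (Part.mem_map_iff _).2 ⟨_, h1, rfl⟩, inb_mem_dom_join.2 h2,
      fun z hz => ⟨pt, z, b, w', hpt z, rfl, h1, (mem_sol_join h2).1 hz⟩⟩
  | iter e =>
    refine ⟨fun x => (capp x.2 pt : Part (Bool × Baire)).map fun r => (inb r.1 r.2, cpt),
      Rz.ap_map (by fun_prop) (by fun_prop) (by fun_prop), fun ρ q κ h => ?_⟩
    obtain ⟨b, w', h1, -, h2⟩ := h.2 pt rfl
    refine ⟨inb b w', cpt, (Part.mem_map_iff _).2 ⟨_, h1, rfl⟩, inb_mem_dom_iter.2 h2,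
      fun z hz => ⟨pt, z, b, w', hpt z, rfl, h1, (mem_sol_iter h2).1 hz⟩⟩
  | meet e f =>
    obtain ⟨c, hc, hc'⟩ := exists_fun_code
      (f := fun z : Baire => (inb (tag z) pt, untag z)) (by fun_prop)
    have hc'' : Rt fun _ : ((Baire × Baire) × Bool × Baire) × Bool × Baire => c := Rt.const hc
    refine ⟨fun x => (capp x.2 (inb false pt) : Part (Bool × Baire)).bind fun r =>
      (capp x.2 (inb true pt) : Part (Bool × Baire)).map fun r' => (pair r.2 r'.2, c),
      Rz.bind (Rz.ap_total (by fun_prop) (by fun_prop))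
        (Rz.ap_map (by fun_prop) (by fun_prop) (by fun_prop)), fun ρ q κ h => ?_⟩
    obtain ⟨p, hp, p', hp', rfl⟩ := h.1
    -- Both answers solve the query at a meet, so `κ` delivers an instance of each side, and
    -- `Selects` tells which is which.
    have hb (b : Bool) : inb b pt ∈ (head ρ (meet e f)).sol (pair p p') := by
      refine ⟨_, hp, _, hp', rfl, ?_⟩
      cases b
      · exact Or.inl ⟨pt, rfl, rfl⟩
      · exact Or.inr ⟨pt, rfl, rfl⟩
    obtain ⟨b, u, h1, h2, h3⟩ := h.2 _ (hb false)
    obtain ⟨b', v, h1', h2', h3'⟩ := h.2 _ (hb true)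
    obtain rfl : false = b := by simpa using h2 rfl
    obtain rfl : true = b' := by simpa using h2' rfl
    refine ⟨pair u v, c, Part.mem_bind_iff.2 ⟨_, h1, (Part.mem_map_iff _).2 ⟨_, h1', rfl⟩⟩,
      ⟨u, h3, v, h3', rfl⟩, fun z hz => ?_⟩
    obtain ⟨b, y, rfl, hy⟩ := (mem_sol_meet h3 h3').1 hz
    refine ⟨inb b pt, y, b, bif b then v else u, ?_, hb b, ?_, hy⟩
    · simpa using hc' (inb b y)
    · cases b
      · exact h1
      · exact h1'
  | comp g e _ ih =>
    by_cases he : e = one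
    · subst he
      obtain ⟨Kx, hKx, hKx'⟩ := exists_const_code (α := Baire) (β := Baire)
      obtain ⟨cs, hcs, hcs'⟩ := exists_fun_code (f := fun z : Baire => (pt, Baire.snd z))
        (by fun_prop)
      have hcs'' : Rt fun _ : (Baire × Baire) × Bool × Baire => cs := Rt.const hcs
      refine ⟨fun x => (capp x.2 pt : Part (Bool × Baire)).map
        fun r => (pair pt (Kx r.2), cs), Rz.ap_map (by fun_prop) (by fun_prop) (by fun_prop),
        fun ρ q κ h => ?_⟩
      obtain ⟨b, w', h1, -, h2⟩ := h.2 pt rfl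
      have hd : pt ∈ ((one : RegE A).interp ρ).dom := rfl
      refine ⟨_, cs, (Part.mem_map_iff _).2 ⟨_, h1, rfl⟩, pair_mem_dom_comp.2 ⟨hd,
        fun x _ => ⟨w', h2, mem_capp.1 (hKx' w' x)⟩⟩, fun z hz => ?_⟩
      obtain ⟨x, hx, v, hv, y, hy, rfl⟩ := (mem_sol_comp hd).1 hz
      obtain rfl := hv.unique (mem_capp.1 (hKx' w' x))
      refine ⟨pt, y, b, _, ?_, rfl, h1, hy⟩
      simpa using hcs' (pair x y)
    · obtain ⟨C, hC, ih⟩ := ih ht.2 he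
      -- `K₁` forgets the continuation, leaving data for the right factor. `K₂` is the new
      -- continuation: it splits a solution into the answer and a remainder, recovers from the
      -- answer the continuation promised by `κ`, and applies that to the remainder. `K₃` regroups
      -- solutions accordingly.
      obtain ⟨K₁, hK₁, hK₁'⟩ := Rz.curry (α := Baire) (β := Baire) (γ := Bool × Baire)
        (F := fun κ x => (capp κ x : Part (Bool × Baire)).map fun r => (r.1, Baire.fst r.2))
        (Rz.ap_map (by fun_prop) (by fun_prop) (by fun_prop))
      obtain ⟨K₂, hK₂, hK₂'⟩ := Rz.curry (α := Baire × Baire) (β := Baire) (γ := Baire)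
        (F := fun x z => (capp x.1 z : Part (Baire × Baire)).bind fun r =>
          (capp x.2 r.1 : Part (Bool × Baire)).bind fun r' =>
            (capp (Baire.snd r'.2) r.2 : Part Baire))
        (Rz.bind (Rz.ap_total (by fun_prop) (by fun_prop))
          (Rz.bind (Rz.ap_total (by fun_prop) (by fun_prop))
            (Rz.ap_total (by fun_prop) (by fun_prop))))
      obtain ⟨K₃, hK₃, hK₃'⟩ := Rz.curry (α := Baire) (β := Baire) (γ := Baire × Baire)
        (F := fun γ z => (capp γ (Baire.fst z) : Part (Baire × Baire)).map
          fun r => (r.1, pair r.2 (Baire.snd z)))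
        (Rz.ap_map (by fun_prop) (by fun_prop) (by fun_prop))
      refine ⟨fun x => (C (x.1, K₁ x.2)).map fun r => (pair r.1 (K₂ (r.2, x.2)), K₃ r.2),
        Rz.map (hC.comp (by fun_prop)) (by fun_prop), fun ρ q κ h => ?_⟩
      have hsplit : ∀ x ∈ (head ρ e).sol q, ∃ b u' c',
          (b, pair u' c') ∈ (capp κ x : Part (Bool × Baire)) ∧
          (b, u') ∈ (capp (K₁ κ) x : Part (Bool × Baire)) ∧ Selects e x b ∧
          u' ∈ ((e.nxt b).interp ρ).dom ∧
          ∀ y ∈ ((e.nxt b).interp ρ).sol u', ∃ v ∈ (g.interp ρ).dom, App c' y v := by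
        intro x hx
        obtain ⟨b, w', h1, h2, h3⟩ := h.2 x hx
        rw [nxt_comp he] at h3
        obtain ⟨u', hu', c', rfl, hc'⟩ := h3
        exact ⟨b, u', c', h1, hK₁' κ x _ ((Part.mem_map_iff _).2 ⟨_, h1, by simp⟩), h2, hu', hc'⟩
      obtain ⟨u, γ, h1, hu, hγ⟩ := ih ρ q (K₁ κ) ⟨h.1, fun x hx => by
        obtain ⟨b, u', c', -, h1, h2, h3, -⟩ := hsplit x hx
        exact ⟨b, u', h1, h2, h3⟩⟩
      have hz' : ∀ z ∈ (e.interp ρ).sol u, ∃ x y b u' c',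
          (x, y) ∈ (capp γ z : Part (Baire × Baire)) ∧ x ∈ (head ρ e).sol q ∧
          (b, pair u' c') ∈ (capp κ x : Part (Bool × Baire)) ∧
          u' ∈ ((e.nxt b).interp ρ).dom ∧ y ∈ ((e.nxt b).interp ρ).sol u' ∧
          ∃ v ∈ (g.interp ρ).dom, App c' y v ∧ App (K₂ (γ, κ)) z v := by
        intro z hz
        obtain ⟨x, y, b, u', hγz, hx, hκx, hy⟩ := hγ z hz
        obtain ⟨b₁, u₁, c', h1, h2, h3, h4, h5⟩ := hsplit x hx
        obtain ⟨rfl, rfl⟩ := Prod.mk.inj (Part.mem_unique hκx h2)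
        obtain ⟨v, hv, hcv⟩ := h5 y hy
        refine ⟨x, y, b, u', c', hγz, hx, h1, h4, hy, v, hv, hcv, mem_capp.1 (hK₂' (γ, κ) z v ?_)⟩
        refine Part.mem_bind_iff.2 ⟨_, hγz, Part.mem_bind_iff.2 ⟨_, h1, ?_⟩⟩
        simpa using mem_capp.2 hcv
      refine ⟨_, _, (Part.mem_map_iff _).2 ⟨_, h1, rfl⟩, pair_mem_dom_comp.2 ⟨hu, fun z hz => ?_⟩,
        fun z hz => ?_⟩
      · obtain ⟨x, y, b, u', c', -, -, -, -, -, v, hv, -, hK⟩ := hz' z hz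
        exact ⟨v, hv, hK⟩
      · obtain ⟨z, hz₁, v, hv, y₂, hy₂, rfl⟩ := (mem_sol_comp hu).1 hz
        obtain ⟨x, y, b, u', c', h1, h2, h3, h4, h5, v', -, h7, h8⟩ := hz' z hz₁
        obtain rfl := hv.unique h8
        refine ⟨x, pair y y₂, b, _, hK₃' γ _ _ ((Part.mem_map_iff _).2 ⟨(x, y), ?_, by simp⟩), h2, h3, ?_⟩
        · simpa using h1
        · rw [nxt_comp he]
          simpa using (mem_sol_comp h4).2 ⟨y, h5, v, h7, y₂, hy₂, rfl⟩

end RegE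

/-! ### Attractors, positional strategies and layers in Büchi games -/

namespace BuchiArena

variable {V : Type*} (G : BuchiArena V)

/-- The positions from which Duplicator forces, in at most `n` moves, a visit to a winning position
all of whose successors are in `Y`. -/
def attr (Y : Set V) : ℕ → Set V
  | 0 => {u | u ∈ G.win ∧ ∀ m, G.move u m → m ∈ Y}
  | n + 1 => attr Y n ∪
      ({u | u ∉ G.win ∧ G.owner u = .spoiler ∧ (∃ m, G.move u m) ∧
          ∀ m, G.move u m → m ∈ attr Y n} ∪
        {u | u ∉ G.win ∧ G.owner u = .duplicator ∧ ∃ m, G.move u m ∧ m ∈ attr Y n})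

/-- The positions from which Duplicator forces a visit to a winning position all of whose
successors are in `Y`. -/
def attrac (Y : Set V) : Set V := {u | ∃ n, u ∈ G.attr Y n}

variable {G}

theorem attr_succ (Y : Set V) {n : ℕ} : G.attr Y n ⊆ G.attr Y (n + 1) :=
  fun _ h => Or.inl h

theorem attr_le (Y : Set V) {n k : ℕ} (h : n ≤ k) : G.attr Y n ⊆ G.attr Y k := by
  induction h with
  | refl => exact subset_rfl
  | step _ ih => exact ih.trans (attr_succ Y)

theorem attr_mono {Y Z : Set V} (h : Y ⊆ Z) (n : ℕ) : G.attr Y n ⊆ G.attr Z n := by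
  induction n with
  | zero => exact fun u hu => ⟨hu.1, fun m hm => h (hu.2 m hm)⟩
  | succ n ih =>
    rintro u (hu | ⟨h1, h2, h3, h4⟩ | ⟨h1, h2, m, h3, h4⟩)
    · exact Or.inl (ih hu)
    · exact Or.inr (Or.inl ⟨h1, h2, h3, fun m hm => ih (h4 m hm)⟩)
    · exact Or.inr (Or.inr ⟨h1, h2, m, h3, ih h4⟩)

theorem attrac_mono {Y Z : Set V} (h : Y ⊆ Z) : G.attrac Y ⊆ G.attrac Z :=
  fun _ ⟨n, hn⟩ => ⟨n, attr_mono h n hn⟩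

/-- The later clauses of `attr` exclude winning positions, so these can only enter at stage `0`. -/
theorem mem_attr_zero {Y : Set V} {n : ℕ} {u : V} (h : u ∈ G.attr Y n) (hw : u ∈ G.win) :
    u ∈ G.attr Y 0 := by
  induction n with
  | zero => exact h
  | succ n ih =>
    rcases h with h | ⟨h, -⟩ | ⟨h, -⟩
    · exact ih h
    · exact absurd hw h
    · exact absurd hw h

/-- `Z` is a set of positions in which Duplicator can stay while decreasing `rank` outside of the
winning positions. -/
structure Progress (G : BuchiArena V) (Z : Set V) (rank : V → ℕ) : Prop where
  win : ∀ u ∈ Z, u ∈ G.win → ∀ m, G.move u m → m ∈ Z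
  spoiler : ∀ u ∈ Z, u ∉ G.win → G.owner u = .spoiler →
    (∃ m, G.move u m) ∧ ∀ m, G.move u m → m ∈ Z ∧ rank m < rank u
  duplicator : ∀ u ∈ Z, u ∉ G.win → G.owner u = .duplicator →
    ∃ m, G.move u m ∧ m ∈ Z ∧ rank m < rank u

/-- The rank is the least attractor stage. It falls until a winning position is met, whose
successors lie in `Y` and so in the attractor again. -/
theorem exists_progress {Y : Set V} (hY : Y ⊆ G.attrac Y) :
    ∃ rank, G.Progress (G.attrac Y) rank := by
  classical
  let rank : V → ℕ := fun u => if h : ∃ n, u ∈ G.attr Y n then Nat.find h else 0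
  have hmem : ∀ u ∈ G.attrac Y, u ∈ G.attr Y (rank u) := fun u hu => by
    have hu : ∃ n, u ∈ G.attr Y n := hu
    simp only [rank, dif_pos hu]
    exact Nat.find_spec hu
  have hle : ∀ u n, u ∈ G.attr Y n → rank u ≤ n := fun u n hn => by
    have hu : ∃ n, u ∈ G.attr Y n := ⟨n, hn⟩
    simp only [rank, dif_pos hu]
    exact Nat.find_min' hu hn
  have hcases : ∀ u ∈ G.attrac Y, u ∉ G.win → ∃ n, rank u = n + 1 ∧
      ((G.owner u = .spoiler ∧ (∃ m, G.move u m) ∧ ∀ m, G.move u m → m ∈ G.attr Y n) ∨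
        (G.owner u = .duplicator ∧ ∃ m, G.move u m ∧ m ∈ G.attr Y n)) := by
    intro u hu hw
    have h := hmem u hu
    cases hr : rank u with
    | zero => rw [hr] at h; exact absurd h.1 hw
    | succ n =>
      rw [hr] at h
      rcases h with h | ⟨-, h⟩ | ⟨-, h⟩
      · have := hle u n h; omega
      · exact ⟨n, rfl, Or.inl h⟩
      · exact ⟨n, rfl, Or.inr h⟩
  refine ⟨rank, ⟨fun u hu hw m hm => hY ((mem_attr_zero (hmem u hu) hw).2 m hm),
    fun u hu hw ho => ?_, fun u hu hw ho => ?_⟩⟩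
  · obtain ⟨n, hn, (⟨-, h1, h2⟩ | ⟨h, -⟩)⟩ := hcases u hu hw
    · refine ⟨h1, fun m hm => ⟨⟨n, h2 m hm⟩, ?_⟩⟩
      have := hle m n (h2 m hm)
      omega
    · rw [ho] at h; cases h
  · obtain ⟨n, hn, (⟨h, -⟩ | ⟨-, m, h1, h2⟩)⟩ := hcases u hu hw
    · rw [ho] at h; cases h
    · have := hle m n h2
      exact ⟨m, h1, ⟨n, h2⟩, by omega⟩

/-- Duplicator plays any rank-decreasing successor. A natural rank cannot fall forever, so winning
positions recur. -/
theorem Progress.duplicatorWins {Z : Set V} {rank : V → ℕ} (h : G.Progress Z rank)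
    (hwin : ∀ u ∈ G.win, G.owner u = .spoiler) {v : V} (hv : v ∈ Z) : G.DuplicatorWins v := by
  classical
  have hdw : ∀ {u}, G.owner u = .duplicator → u ∉ G.win := fun ho hw => by
    rw [hwin _ hw] at ho; cases ho
  let σ : V → V := fun u => if hu : ∃ m, G.move u m ∧ m ∈ Z ∧ rank m < rank u then hu.choose else u
  have hσ : ∀ u ∈ Z, G.owner u = .duplicator →
      G.move u (σ u) ∧ σ u ∈ Z ∧ rank (σ u) < rank u := fun u hu ho => by
    have h' := h.duplicator u hu (hdw ho) ho
    simp only [σ, dif_pos h']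
    exact h'.choose_spec
  let R : V → V → Prop := fun u m => G.move u m ∧ (G.owner u = .duplicator → m = σ u)
  have hR : ∀ {u m}, u ∈ Z → R u m → m ∈ Z ∧ (u ∉ G.win → rank m < rank u) := by
    rintro u m hu ⟨hm, ho⟩
    by_cases hw : u ∈ G.win
    · exact ⟨h.win u hu hw m hm, fun h => absurd hw h⟩
    · cases hou : G.owner u with
      | spoiler =>
        obtain ⟨h1, h2⟩ := (h.spoiler u hu hw hou).2 m hm
        exact ⟨h1, fun _ => h2⟩
      | duplicator =>
        rw [ho hou]
        exact ⟨(hσ u hu hou).2.1, fun _ => (hσ u hu hou).2.2⟩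
  have hall : ∀ p : List V, ∀ v ∈ Z, (v :: p).IsChain R → ∀ u ∈ v :: p, u ∈ Z := by
    intro p
    induction p with
    | nil => intro v hv _ u hu; rw [List.mem_singleton.1 hu]; exact hv
    | cons w p ih =>
      intro v hv hc u hu
      rw [List.isChain_cons_cons] at hc
      rcases List.mem_cons.1 hu with rfl | hu
      · exact hv
      · exact ih w (hR hv hc.1).1 hc.2 u hu
  have hall' : ∀ p : List V, p.head? = some v → p.IsChain R → ∀ u ∈ p, u ∈ Z := by
    intro p hp hc
    cases p with
    | nil => simp
    | cons w p =>
      obtain rfl : w = v := by simpa using hp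
      exact hall p w hv hc
  have hext : ∀ (p : List V) (u m : V), p ++ [u] ++ [m] ∈
      {p : List V | p.head? = some v ∧ p.IsChain R} ↔
        p ++ [u] ∈ {p : List V | p.head? = some v ∧ p.IsChain R} ∧ R u m := by
    intro p u m
    have : (p ++ [u] ++ [m]).head? = (p ++ [u]).head? := by cases p <;> rfl
    simp only [Set.mem_ofPred_eq, this, List.isChain_append (l₂ := [m])]
    simp [and_assoc]
  refine ⟨{p | p.head? = some v ∧ p.IsChain R}, ⟨⟨[v], rfl, List.isChain_singleton v⟩,
    fun p hp => hp.1, fun p hp => hp.2.imp fun _ _ h => h.1, ?_, ?_, ?_⟩, ?_, ?_⟩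
  · rintro p ⟨hp, hc⟩ q hq ⟨r, rfl⟩
    refine ⟨?_, (List.isChain_append.1 hc).1⟩
    cases q with
    | nil => exact absurd rfl hq
    | cons w q => exact hp
  · intro p u m hp ho hm
    exact (hext p u m).2 ⟨hp, hm, fun h => by rw [ho] at h; cases h⟩
  · intro p u hp ho
    have hu : u ∈ Z := hall' _ hp.1 hp.2 u (by simp)
    refine ⟨σ u, ⟨(hσ u hu ho).1, (hext p u _).2 ⟨hp, (hσ u hu ho).1, fun _ => rfl⟩⟩, ?_⟩
    rintro m ⟨-, hm⟩
    exact ((hext p u m).1 hm).2.2 ho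
  · intro p u hp hno
    have hu : u ∈ Z := hall' _ hp.1 hp.2 u (by simp)
    by_contra hw
    cases ho : G.owner u with
    | spoiler => exact (h.spoiler u hu hw ho).1.elim hno
    | duplicator => exact hno _ (hσ u hu ho).1
  · intro x hx
    have hxs : ∀ n, x n ∈ Z ∧ R (x n) (x (n + 1)) := by
      intro n
      have h1 := hx (n + 1)
      rw [List.range_succ, List.map_append, List.range_succ, List.map_append] at h1
      have h2 := (hext _ _ _).1 h1
      exact ⟨hall' _ h2.1.1 h2.1.2 _ (by simp), h2.2⟩
    refine Set.infinite_of_forall_exists_gt fun a => ?_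
    by_contra hcon
    push Not at hcon
    have key : ∀ k, rank (x (a + 1 + k)) + k ≤ rank (x (a + 1)) := by
      intro k
      induction k with
      | zero => simp
      | succ k ih =>
        have := (hR (hxs (a + 1 + k)).1 (hxs (a + 1 + k)).2).2 fun hw => by
          have := hcon _ hw; omega
        have e : a + 1 + (k + 1) = a + 1 + k + 1 := by ring
        rw [e]
        omega
    have := key (rank (x (a + 1)) + 1)
    omega

theorem DuplicatorWins.exists_progress (hwin : ∀ u ∈ G.win, G.owner u = .spoiler)
    (hfin : ∀ u, u ∉ G.win → G.owner u = .spoiler → {m | G.move u m}.Finite) {v : V}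
    (h : G.DuplicatorWins v) : ∃ Z rank, v ∈ Z ∧ G.Progress Z rank := by
  obtain ⟨S, hS, hW⟩ := h
  let Y : Set V := {u | ∃ p, p ++ [u] ∈ S}
  have hvY : v ∈ Y := by
    obtain ⟨p, hp⟩ := hS.nonempty
    have hh := hS.starts p hp
    cases p with
    | nil => cases hh
    | cons w p =>
      obtain rfl : w = v := by simpa using hh
      exact ⟨[], hS.prefix_closed _ hp [w] (by simp) ⟨p, rfl⟩⟩
  have hbad : ∀ p u, p ++ [u] ∈ S → u ∉ G.attrac Y →
      u ∉ G.win ∧ ∃ m, p ++ [u] ++ [m] ∈ S ∧ m ∉ G.attrac Y := by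
    intro p u hp hu
    have hw : u ∉ G.win := fun hw =>
      hu ⟨0, hw, fun m hm => ⟨p ++ [u], hS.spoiler_closed p u m hp (hwin u hw) hm⟩⟩
    refine ⟨hw, ?_⟩
    by_contra hcon
    push Not at hcon
    cases ho : G.owner u with
    | spoiler =>
      have hm : ∀ m, G.move u m → m ∈ G.attrac Y := fun m hm =>
        hcon m (hS.spoiler_closed p u m hp ho hm)
      choose! n hn using hm
      -- Finite branching bounds the stages of all successors, which is why natural-number stages
      -- suffice.
      obtain ⟨N, hN⟩ := ((hfin u hw ho).image n).bddAbove
      refine hu ⟨N + 1, Or.inr (Or.inl ⟨hw, ho, ?_, fun m hm =>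
        attr_le Y (hN ⟨m, hm, rfl⟩) (hn m hm)⟩)⟩
      by_contra hno
      push Not at hno
      exact hw (hW.finite_plays p u hp hno)
    | duplicator =>
      obtain ⟨m, ⟨hm, hpm⟩, -⟩ := hS.duplicator_unique p u hp ho
      obtain ⟨n, hn⟩ := hcon m hpm
      exact hu ⟨n + 1, Or.inr (Or.inr ⟨hw, ho, m, hm, hn⟩)⟩
  have hY : Y ⊆ G.attrac Y := by
    rintro u₀ ⟨p₀, hp₀⟩
    by_contra hu₀
    -- Plays of the strategy that end outside the attractor; each extends to another one, and
    -- iterating gives an infinite play.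
    let B := {q : List V × V // q.1 ++ [q.2] ∈ S ∧ q.2 ∉ G.attrac Y}
    have hstep : ∀ q : B, ∃ m, q.1.1 ++ [q.1.2] ++ [m] ∈ S ∧ m ∉ G.attrac Y :=
      fun q => (hbad _ _ q.2.1 q.2.2).2
    choose nx hnx using hstep
    obtain ⟨P, hP₀, hP⟩ : ∃ P : ℕ → B, (P 0).1.1 = p₀ ∧
        ∀ n, (P (n + 1)).1.1 = (P n).1.1 ++ [(P n).1.2] :=
      ⟨fun n => Nat.rec ⟨(p₀, u₀), hp₀, hu₀⟩
        (fun _ q => ⟨(q.1.1 ++ [q.1.2], nx q), hnx q⟩) n, rfl, fun n => rfl⟩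
    have hlen : ∀ n, (P n).1.1.length = p₀.length + n := by
      intro n
      induction n with
      | zero => rw [hP₀]; rfl
      | succ n ih => rw [hP, List.length_append, ih]; rfl
    have hpre : ∀ n k, (P n).1.1 <+: (P (n + k)).1.1 := by
      intro n k
      induction k with
      | zero => exact List.prefix_rfl
      | succ k ih => exact ih.trans (by rw [← add_assoc, hP]; exact List.prefix_append _ _)
    -- The stored history at stage `n + 1` has length greater than `n`, so the default `u₀` is never
    -- used.
    let x : ℕ → V := fun n => ((P (n + 1)).1.1[n]?).getD u₀
    have hx : ∀ n k i, i < (P n).1.1.length → n ≤ k → (P n).1.1[i]? = (P k).1.1[i]? := by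
      intro n k i hi hnk
      obtain ⟨k, rfl⟩ := Nat.exists_eq_add_of_le hnk
      obtain ⟨r, hr⟩ := hpre n k
      rw [← hr, List.getElem?_append_left hi]
    have htake : ∀ n, (List.range (n + 1)).map x = (P (n + 1)).1.1.take (n + 1) := by
      intro n
      apply List.ext_getElem?
      intro i
      rw [List.getElem?_take]
      split_ifs with hi
      · rw [List.getElem?_map, List.getElem?_range hi]
        have h1 : i < (P (i + 1)).1.1.length := by rw [hlen]; omega
        rw [← hx (i + 1) (n + 1) i h1 (by omega)]
        simp only [Option.map_some, x, List.getElem?_eq_getElem h1, Option.getD_some]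
      · exact List.getElem?_eq_none (by simpa using hi)
    have hmem : ∀ n, (List.range (n + 1)).map x ∈ S := by
      intro n
      rw [htake]
      refine hS.prefix_closed _ (P (n + 1)).2.1 _ ?_ ?_
      · intro h
        have := congrArg List.length h
        rw [List.length_take, hlen, List.length_nil] at this
        omega
      · exact (List.take_prefix _ _).trans (List.prefix_append _ _)
    have hlast : ∀ n, x (p₀.length + n) = (P n).1.2 := by
      intro n
      have h1 : p₀.length + n < (P (n + 1)).1.1.length := by rw [hlen]; omega
      have h2 := hx (n + 1) (p₀.length + n + 1) _ h1 (by omega)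
      simp only [x]
      rw [← h2, hP, List.getElem?_append_right (by rw [hlen]), hlen]
      simp
    refine (hW.infinite_plays x hmem) ((Set.finite_lt_nat p₀.length).subset fun i hi => ?_)
    by_contra hge
    obtain ⟨n, rfl⟩ := Nat.exists_eq_add_of_le (not_lt.1 hge)
    rw [Set.mem_ofPred_eq, hlast] at hi
    exact (hbad _ _ (P n).2.1 (P n).2.2).1 hi
  obtain ⟨rank, hr⟩ := BuchiArena.exists_progress hY
  exact ⟨_, rank, hY hvY, hr⟩

/-- The complement of the greatest fixed point of the attractor, computed by iteration from a finite
closed set. The layer of a position records by when it has dropped out, and thus bounds the number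
of winning positions that Spoiler still has to concede. -/
theorem exists_layers (hwin : ∀ u ∈ G.win, G.owner u = .spoiler)
    (hfin : ∀ u, u ∉ G.win → G.owner u = .spoiler → {m | G.move u m}.Finite) {v : V}
    (h : ¬ G.DuplicatorWins v) {W₀ : Set V} (hW₀ : W₀.Finite)
    (hcl : ∀ u ∈ W₀, ∀ m, G.move u m → m ∈ W₀) (hv : v ∈ W₀) :
    ∃ L : ℕ → Set V, L 0 = ∅ ∧ (∃ N, v ∈ L N) ∧ ∀ k, ∀ u ∈ L (k + 1), u ∈ W₀ ∧
      (u ∈ G.win → ∃ m, G.move u m ∧ m ∈ L k) ∧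
      (u ∉ G.win → G.owner u = .spoiler → (∃ m, G.move u m) →
        ∃ m, G.move u m ∧ m ∈ L (k + 1)) ∧
      (G.owner u = .duplicator → ∀ m, G.move u m → m ∈ L (k + 1)) := by
  let W : ℕ → Set V := fun n => Nat.rec W₀ (fun _ W => W₀ ∩ G.attrac W) n
  have hWs : ∀ n, W (n + 1) = W₀ ∩ G.attrac (W n) := fun n => rfl
  have hsub : ∀ n, W n ⊆ W₀ := fun n => by
    cases n with
    | zero => exact subset_rfl
    | succ n => exact Set.inter_subset_left
  have hanti : ∀ n, W (n + 1) ⊆ W n := by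
    intro n
    induction n with
    | zero => exact hsub 1
    | succ n ih => exact Set.inter_subset_inter_right _ (attrac_mono ih)
  -- A decreasing sequence of subsets of a finite set becomes stationary; cardinalities would
  -- otherwise fall forever.
  obtain ⟨n, hn⟩ : ∃ n, W n ⊆ W (n + 1) := by
    by_contra hcon
    push Not at hcon
    have key : ∀ n, (W n).ncard + n ≤ W₀.ncard := by
      intro n
      induction n with
      | zero => exact le_rfl
      | succ n ih =>
        have : (W (n + 1)).ncard < (W n).ncard :=
          Set.ncard_lt_ncard ⟨hanti n, hcon n⟩ (hW₀.subset (hsub n))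
        omega
    have := key (W₀.ncard + 1)
    omega
  have hvn : v ∉ W n := by
    intro hvn
    have hY : W n ⊆ G.attrac (W n) := fun u hu => (hn hu).2
    obtain ⟨rank, hr⟩ := exists_progress hY
    exact h (hr.duplicatorWins hwin (hY hvn))
  refine ⟨fun k => W₀ \ W k, Set.sdiff_self, ⟨n, hv, hvn⟩, ?_⟩
  rintro k u ⟨hu, huk⟩
  have hu' : u ∉ G.attrac (W k) := fun h' => huk ⟨hu, h'⟩
  have hmem : ∀ m, G.move u m → m ∉ G.attrac (W k) → m ∈ W₀ \ W (k + 1) := fun m hm h' =>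
    ⟨hcl u hu m hm, fun hmk => h' hmk.2⟩
  refine ⟨hu, fun hw => ?_, fun hw ho hex => ?_, fun ho m hm => ?_⟩
  · by_contra hcon
    push Not at hcon
    refine hu' ⟨0, hw, fun m hm => ?_⟩
    by_contra hmk
    exact hcon m hm ⟨hcl u hu m hm, hmk⟩
  · by_contra hcon
    have hm : ∀ m, G.move u m → m ∈ G.attrac (W k) := fun m hm => by
      by_contra hmk
      exact hcon ⟨m, hm, hmem m hm hmk⟩
    choose! l hl using hm
    obtain ⟨N, hN⟩ := ((hfin u hw ho).image l).bddAbove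
    exact hu' ⟨N + 1, Or.inr (Or.inl ⟨hw, ho, hex, fun m hm =>
      attr_le _ (hN ⟨m, hm, rfl⟩) (hl m hm)⟩)⟩
  · refine hmem m hm fun ⟨N, hN⟩ => hu' ⟨N + 1, Or.inr (Or.inr ⟨fun hw => ?_, ho, m, hm, hN⟩)⟩
    rw [hwin u hw] at ho
    cases ho

end BuchiArena

/-! ### Moves and winning positions of the pointed game -/

open Classical in
/-- Replacement of the hypothesis `t` by `t'`. -/
noncomputable def Finset.swap {α : Type*} (X : Finset α) (t t' : α) : Finset α :=
  insert t' (X.erase t)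

theorem Finset.mem_swap {α : Type*} {X : Finset α} {t t' s : α} :
    s ∈ X.swap t t' ↔ s = t' ∨ (s ≠ t ∧ s ∈ X) := by
  classical
  simp [Finset.swap]

open Classical in
/-- Replacement of the hypothesis `t` by `t₀` and `t₁`. -/
noncomputable def Finset.swapPair {α : Type*} (X : Finset α) (t t₀ t₁ : α) : Finset α :=
  insert t₁ (insert t₀ (X.erase t))

theorem Finset.mem_swapPair {α : Type*} {X : Finset α} {t t₀ t₁ s : α} :
    s ∈ X.swapPair t t₀ t₁ ↔ s = t₁ ∨ s = t₀ ∨ (s ≠ t ∧ s ∈ X) := by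
  classical
  simp [Finset.swapPair]

namespace PSimPos

variable {A : Type*}

open RegE

theorem coe_eq_swap_iff {X X' : Finset (RegE A)} {t t' : RegE A} :
    (X' : Set (RegE A)) = (↑X \ {t}) ∪ {t'} ↔ X' = X.swap t t' := by
  rw [← Finset.coe_inj]
  have : ((X.swap t t' : Finset (RegE A)) : Set (RegE A)) = (↑X \ {t}) ∪ {t'} := by
    ext s
    simp [Finset.mem_swap, and_comm]
  rw [this]

/-- Some hypothesis has yet to be explored or forked. -/
def Pending (X : Finset (RegE A)) : Prop := ∃ t ∈ X, t ≠ one ∧ (t.pol = .ex ∨ t.pol = .all)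

theorem owner_eq (X : Finset (RegE A)) (h : RegE A) :
    (psimGame A).owner ⟨X, h⟩ = .spoiler ↔
      Pending X ∨ (one ∈ X ∧ h = one) ∨ h.pol = .all := by
  change SimPos.owner ⟨Set.univ, X, h⟩ = _ ↔ _
  have : (SimPos.HasPending ⟨Set.univ, X, h⟩) = Pending X := rfl
  rw [SimPos.owner, this]
  split_ifs with h1 h2
  · simp [h1]
  · simp only [true_iff]; exact Or.inr (Or.inl h2)
  · cases hp : h.pol <;> simp [h1]
    all_goals exact fun a b => h2 ⟨a, b⟩

theorem owner_eq_duplicator (X : Finset (RegE A)) (h : RegE A) :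
    (psimGame A).owner ⟨X, h⟩ = .duplicator ↔
      ¬ Pending X ∧ ¬ (one ∈ X ∧ h = one) ∧ h.pol ≠ .all := by
  have := owner_eq X h
  rw [← not_iff_not] at this
  rw [← not_or, ← not_or, ← this]
  cases (psimGame A).owner ⟨X, h⟩ <;> simp

theorem move_iff {X Y : Finset (RegE A)} {h h' : RegE A} :
    (psimGame A).move ⟨X, h⟩ ⟨Y, h'⟩ ↔
      (∃ t ∈ X, t.pol = .ex ∧ h' = h ∧ ∃ t', t.Step t' ∧ Y = X.swap t t') ∨
      (∃ t ∈ X, t.pol = .all ∧ h' = h ∧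
        (Y : Set (RegE A)) = (↑X \ {t}) ∪ {t' | t.Step t'}) ∨
      (h.pol = .all ∧ ¬ Pending X ∧ Y = X ∧ h.Step h') ∨
      ((psimGame A).owner ⟨X, h⟩ = .duplicator ∧ h.pol = .ex ∧ Y = X ∧ h.Step h') ∨
      ((psimGame A).owner ⟨X, h⟩ = .duplicator ∧ (∃ a, h.pol = .letter a) ∧ Y = X ∧ h.Step h') ∨
      ((psimGame A).owner ⟨X, h⟩ = .duplicator ∧ ∃ a t t', t ∈ X ∧ h.pol = .letter a ∧
        t.pol = .letter a ∧ h.Step h' ∧ t.Step t' ∧ Y = X.swap t t') := by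
  have hpend : (∀ t ∈ X, t.pol = .all ∨ t.pol = .ex → t = one) ↔ ¬ Pending X := by
    simp only [Pending, not_exists, not_and]
    constructor
    · exact fun H t ht h1 h2 => h1 (H t ht h2.symm)
    · exact fun H t ht h2 => by_contra fun h1 => H t ht h1 h2.symm
  constructor
  · rintro ⟨k, hk⟩
    change SimMove k ⟨Set.univ, X, h⟩ ⟨Set.univ, Y, h'⟩ at hk
    generalize hp : (⟨Set.univ, X, h⟩ : SimPos A) = p at hk
    generalize hq : (⟨Set.univ, Y, h'⟩ : SimPos A) = q at hk
    cases hk with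
    | explore Γ X₁ X' e t t' ht hpol hstep hX =>
      obtain ⟨-, rfl, rfl⟩ := SimPos.mk.inj hp
      obtain ⟨-, rfl, rfl⟩ := SimPos.mk.inj hq
      exact Or.inl ⟨t, ht, hpol, rfl, t', hstep, coe_eq_swap_iff.1 hX⟩
    | fork Γ X₁ X' e t ht hpol hX =>
      obtain ⟨-, rfl, rfl⟩ := SimPos.mk.inj hp
      obtain ⟨-, rfl, rfl⟩ := SimPos.mk.inj hq
      exact Or.inr (Or.inl ⟨t, ht, hpol, rfl, hX⟩)
    | alea Γ X₁ e e' hpol hX hstep =>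
      obtain ⟨-, rfl, rfl⟩ := SimPos.mk.inj hp
      obtain ⟨-, rfl, rfl⟩ := SimPos.mk.inj hq
      exact Or.inr (Or.inr (Or.inl ⟨hpol, hpend.1 hX, rfl, hstep⟩))
    | choose Γ X₁ e e' ho hpol hstep =>
      obtain ⟨rfl, rfl, rfl⟩ := SimPos.mk.inj hp
      obtain ⟨-, rfl, rfl⟩ := SimPos.mk.inj hq
      exact Or.inr (Or.inr (Or.inr (Or.inl ⟨ho, hpol, rfl, hstep⟩)))
    | junk Γ X₁ e e' a ho hpol ha hstep =>
      obtain ⟨rfl, rfl, rfl⟩ := SimPos.mk.inj hp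
      obtain ⟨-, rfl, rfl⟩ := SimPos.mk.inj hq
      exact Or.inr (Or.inr (Or.inr (Or.inr (Or.inl ⟨ho, ⟨a, hpol⟩, rfl, hstep⟩))))
    | fill Γ X₁ X' e e' t t' a ht ho hpe hpt hse hst hX =>
      obtain ⟨rfl, rfl, rfl⟩ := SimPos.mk.inj hp
      obtain ⟨-, rfl, rfl⟩ := SimPos.mk.inj hq
      exact Or.inr (Or.inr (Or.inr (Or.inr (Or.inr
        ⟨ho, a, t, t', ht, hpe, hpt, hse, hst, coe_eq_swap_iff.1 hX⟩))))
  · rintro (⟨t, ht, hpol, rfl, t', hstep, hX⟩ | ⟨t, ht, hpol, rfl, hX⟩ |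
      ⟨hpol, hX, rfl, hstep⟩ | ⟨ho, hpol, rfl, hstep⟩ | ⟨ho, ⟨a, hpol⟩, rfl, hstep⟩ |
      ⟨ho, a, t, t', ht, hpe, hpt, hse, hst, hX⟩)
    · exact ⟨.explore, .explore _ _ _ _ t t' ht hpol hstep (coe_eq_swap_iff.2 hX)⟩
    · exact ⟨.fork, .fork _ _ _ _ t ht hpol hX⟩
    · exact ⟨.alea, .alea _ _ _ _ hpol (hpend.2 hX) hstep⟩
    · exact ⟨.choose, .choose _ _ _ _ ho hpol hstep⟩
    · exact ⟨.junk, .junk _ _ _ _ a ho hpol trivial hstep⟩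
    -- Filling adds a letter to the set of all letters, so the target is again a position of the
    -- pointed game.
    · have := SimMove.fill Set.univ X Y h h' t t' a ht ho hpe hpt hse hst (coe_eq_swap_iff.2 hX)
      rw [Set.univ_union] at this
      exact ⟨.fill, this⟩

theorem mem_win_iff {X : Finset (RegE A)} {h : RegE A} :
    (⟨X, h⟩ : PSimPos A) ∈ (psimGame A).win ↔
      (psimGame A).owner ⟨X, h⟩ = .spoiler ∧
        ¬ (h.pol = .all ∧ ¬ Pending X ∧ ∃ h', h.Step h') := by
  refine and_congr_right fun _ => not_congr ?_
  constructor
  · rintro ⟨q, hq⟩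
    generalize hp : (PSimPos.toSim ⟨X, h⟩ : SimPos A) = p at hq
    cases hq with
    | alea Γ X₁ e e' hpol hX hstep =>
      obtain ⟨-, rfl, rfl⟩ := SimPos.mk.inj hp
      refine ⟨hpol, ?_, e', hstep⟩
      rintro ⟨t, ht, h1, h2⟩
      exact h1 (hX t ht h2.symm)
  · rintro ⟨hpol, hX, h', hstep⟩
    refine ⟨_, .alea _ _ _ _ hpol (fun t ht h2 => by_contra fun h1 => hX ⟨t, ht, h1, h2.symm⟩) hstep⟩

theorem win_spoiler : ∀ u ∈ (psimGame A).win, (psimGame A).owner u = .spoiler :=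
  fun _ hu => hu.1

theorem finite_step (t : RegE A) : {t' | t.Step t'}.Finite := by
  induction t with
  | zero | top | one =>
    refine Set.finite_empty.subset fun t' h => ?_
    cases h
  | var a =>
    refine (Set.finite_singleton one).subset fun t' h => ?_
    cases h; rfl
  | join e f | meet e f =>
    refine (Set.toFinite {e, f}).subset fun t' h => ?_
    cases h
    · exact Or.inl rfl
    · exact Or.inr rfl
  | iter e =>
    refine (Set.toFinite {one, comp (iter e) e}).subset fun t' h => ?_
    cases h
    · exact Or.inl rfl
    · exact Or.inr rfl
  | comp g e _ ih =>
    refine ((ih.image (comp g)).union (Set.finite_singleton g)).subset fun t' h => ?_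
    cases h with
    | comp_one => exact Or.inr rfl
    | comp_right _ h => exact Or.inl ⟨_, h, rfl⟩

theorem ne_one_of_step {t t' : RegE A} (h : t.Step t') : t ≠ one := by
  rintro rfl
  exact not_step_one h

theorem ne_one_of_all {t : RegE A} (h : t.pol = .all) : t ≠ one := by
  rintro rfl; cases h

theorem ne_one_of_letter {t : RegE A} {a : A} (h : t.pol = .letter a) : t ≠ one := by
  rintro rfl; cases h

/-- At such a position nothing is pending and the goal has polarity `∀`, so only alea moves remain,
one for each transition of the goal. -/
theorem finite_moves (u : PSimPos A) (hu : u ∉ (psimGame A).win)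
    (ho : (psimGame A).owner u = .spoiler) : {m | (psimGame A).move u m}.Finite := by
  obtain ⟨X, h⟩ := u
  rw [mem_win_iff] at hu
  obtain ⟨hpol, hX, -⟩ := not_not.1 (not_and.1 hu ho)
  refine ((finite_step h).image fun h' => (⟨X, h'⟩ : PSimPos A)).subset ?_
  rintro ⟨Y, h'⟩ hm
  rcases move_iff.1 hm with ⟨t, ht, hp, -, t', hs, -⟩ | ⟨t, ht, hp, -, -⟩ | ⟨-, -, rfl, hs⟩ |
    ⟨ho', -⟩ | ⟨ho', -⟩ | ⟨ho', -⟩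
  · exact absurd ⟨t, ht, ne_one_of_step hs, Or.inl hp⟩ hX
  · exact absurd ⟨t, ht, ne_one_of_all hp, Or.inr hp⟩ hX
  · exact ⟨h', hs, rfl⟩
  all_goals rw [ho] at ho'; cases ho'

/-- All expressions of the position are free of `⊤` and `0`. -/
def Tame (X : Finset (RegE A)) : Prop := ∀ t ∈ X, t.TopZeroFree

theorem Tame.swap {X : Finset (RegE A)} (hX : Tame X) {t : RegE A} (ht : t ∈ X) (b : Bool) :
    Tame (X.swap t (t.nxt b)) := by
  intro s hs
  rcases Finset.mem_swap.1 hs with rfl | hs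
  · exact (hX t ht).nxt b
  · exact hX s hs.2

theorem Tame.swapPair {X : Finset (RegE A)} (hX : Tame X) {t : RegE A} (ht : t ∈ X) :
    Tame (X.swapPair t (t.nxt false) (t.nxt true)) := by
  intro s hs
  rcases Finset.mem_swapPair.1 hs with rfl | rfl | hs
  · exact (hX t ht).nxt true
  · exact (hX t ht).nxt false
  · exact hX s hs.2

theorem coe_eq_fork_iff {X Y : Finset (RegE A)} {t : RegE A} (ht : t.TopZeroFree)
    (h1 : t ≠ one) : (Y : Set (RegE A)) = (↑X \ {t}) ∪ {t' | t.Step t'} ↔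
      Y = X.swapPair t (t.nxt false) (t.nxt true) := by
  rw [← Finset.coe_inj]
  have : ((X.swapPair t (t.nxt false) (t.nxt true) : Finset (RegE A)) : Set (RegE A)) =
      (↑X \ {t}) ∪ {t' | t.Step t'} := by
    ext s
    simp only [Finset.mem_coe, Finset.mem_swapPair, Set.mem_union, Set.mem_sdiff,
      Set.mem_singleton_iff, Set.mem_ofPred_eq, step_iff ht h1, Bool.exists_bool]
    tauto
  rw [this]

/-- A pending hypothesis gives the position to Spoiler and blocks alea. Hence every explore or fork
of a hypothesis other than `1` starts at a winning position and costs Spoiler a layer. -/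
theorem mem_win_of_pending {X : Finset (RegE A)} {h : RegE A} (hX : Pending X) :
    (⟨X, h⟩ : PSimPos A) ∈ (psimGame A).win :=
  mem_win_iff.2 ⟨(owner_eq X h).2 (Or.inl hX), fun h' => h'.2.1 hX⟩

/-- The moves at a position whose hypotheses have all been explored. -/
inductive Next (X : Finset (RegE A)) (h : RegE A) : Finset (RegE A) → RegE A → Prop
  | choose (b : Bool) (h1 : h ≠ one) (hp : h.pol = .ex) : Next X h X (h.nxt b)
  | junk (a : A) (hp : h.pol = .letter a) : Next X h X (h.nxt false)
  | fill (a : A) (hp : h.pol = .letter a) (t : RegE A) (ht : t ∈ X) (htp : t.pol = .letter a) :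
      Next X h (X.swap t (t.nxt false)) (h.nxt false)

theorem next_iff {X Y : Finset (RegE A)} {h h' : RegE A} (hX : Tame X) (hh : h.TopZeroFree)
    (ho : (psimGame A).owner ⟨X, h⟩ = .duplicator) :
    (psimGame A).move ⟨X, h⟩ ⟨Y, h'⟩ ↔ Next X h Y h' := by
  obtain ⟨hp, h1, ha⟩ := (owner_eq_duplicator X h).1 ho
  rw [move_iff]
  constructor
  · rintro (⟨t, ht, hpol, -, t', hs, -⟩ | ⟨t, ht, hpol, -⟩ | ⟨hpol, -⟩ |
      ⟨-, hpol, rfl, hs⟩ | ⟨-, ⟨a, hpol⟩, rfl, hs⟩ | ⟨-, a, t, t', ht, hpe, hpt, hse, hst, rfl⟩)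
    · exact absurd ⟨t, ht, ne_one_of_step hs, Or.inl hpol⟩ hp
    · exact absurd ⟨t, ht, ne_one_of_all hpol, Or.inr hpol⟩ hp
    · exact absurd hpol ha
    · have h1 := ne_one_of_step hs
      obtain ⟨b, rfl⟩ := (step_iff hh h1).1 hs
      exact .choose b h1 hpol
    · obtain ⟨b, rfl⟩ := (step_iff hh (ne_one_of_step hs)).1 hs
      rw [nxt_eq_of_letter hpol]
      exact .junk a hpol
    · obtain ⟨b, rfl⟩ := (step_iff hh (ne_one_of_step hse)).1 hse
      obtain ⟨b', rfl⟩ := (step_iff (hX t ht) (ne_one_of_step hst)).1 hst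
      rw [nxt_eq_of_letter hpe, nxt_eq_of_letter hpt]
      exact .fill a hpe t ht hpt
  · rintro (⟨b, h1, hp⟩ | ⟨a, hp⟩ | ⟨a, hp, t, ht, htp⟩)
    · exact Or.inr (Or.inr (Or.inr (Or.inl ⟨ho, hp, rfl, step_nxt hh h1 b⟩)))
    · exact Or.inr (Or.inr (Or.inr (Or.inr (Or.inl ⟨ho, ⟨a, hp⟩, rfl,
        step_nxt hh (ne_one_of_letter hp) _⟩))))
    · exact Or.inr (Or.inr (Or.inr (Or.inr (Or.inr ⟨ho, a, t, _, ht, hp, htp,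
        step_nxt hh (ne_one_of_letter hp) _, step_nxt (hX t ht) (ne_one_of_letter htp) _, rfl⟩))))

/-- The five cases are the five actions of the reduction. Only the last two lower the rank; in the
first two a stored instance gets smaller instead, and the third needs no further call. -/
theorem progress_cases {Z : Set (PSimPos A)} {rank : PSimPos A → ℕ}
    (hP : (psimGame A).Progress Z rank) {X : Finset (RegE A)} {h : RegE A} (hX : Tame X)
    (hh : h.TopZeroFree) (hZ : (⟨X, h⟩ : PSimPos A) ∈ Z) :
    (∃ t ∈ X, t ≠ one ∧ t.pol = .ex ∧ ∀ b, (⟨X.swap t (t.nxt b), h⟩ : PSimPos A) ∈ Z) ∨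
    (∃ t ∈ X, t.pol = .all ∧ (⟨X.swapPair t (t.nxt false) (t.nxt true), h⟩ : PSimPos A) ∈ Z) ∨
    (one ∈ X ∧ h = one) ∨
    (h.pol = .all ∧ ∀ b, (⟨X, h.nxt b⟩ : PSimPos A) ∈ Z ∧ rank ⟨X, h.nxt b⟩ < rank ⟨X, h⟩) ∨
    (∃ Y h', Next X h Y h' ∧ (⟨Y, h'⟩ : PSimPos A) ∈ Z ∧ rank ⟨Y, h'⟩ < rank ⟨X, h⟩) := by
  by_cases hp : Pending X
  · have hw := hP.win _ hZ (mem_win_of_pending hp)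
    obtain ⟨t, ht, h1, ht' | ht'⟩ := hp
    · exact Or.inl ⟨t, ht, h1, ht', fun b => hw _ (move_iff.2
        (Or.inl ⟨t, ht, ht', rfl, _, step_nxt (hX t ht) h1 b, rfl⟩))⟩
    · exact Or.inr (Or.inl ⟨t, ht, ht', hw _ (move_iff.2
        (Or.inr (Or.inl ⟨t, ht, ht', rfl, (coe_eq_fork_iff (hX t ht) h1).2 rfl⟩)))⟩)
  by_cases h1 : one ∈ X ∧ h = one
  · exact Or.inr (Or.inr (Or.inl h1))
  by_cases ha : h.pol = .all
  · have hs := fun b => step_nxt hh (ne_one_of_all ha) b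
    refine Or.inr (Or.inr (Or.inr (Or.inl ⟨ha, fun b => ?_⟩)))
    refine (hP.spoiler _ hZ (fun hw => (mem_win_iff.1 hw).2 ⟨ha, hp, _, hs true⟩)
      ((owner_eq X h).2 (Or.inr (Or.inr ha)))).2 _ (move_iff.2 ?_)
    exact Or.inr (Or.inr (Or.inl ⟨ha, hp, rfl, hs b⟩))
  · have ho := (owner_eq_duplicator X h).2 ⟨hp, h1, ha⟩
    obtain ⟨⟨Y, h'⟩, hm, hZ', hr⟩ := hP.duplicator _ hZ (fun hw => by
      rw [win_spoiler _ hw] at ho; cases ho) ho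
    exact Or.inr (Or.inr (Or.inr (Or.inr ⟨Y, h', (next_iff hX hh ho).1 hm, hZ', hr⟩)))

/-- A layered set of positions in which Spoiler can stay, descending to the previous layer at the
winning positions. -/
structure Layers (L : ℕ → Set (PSimPos A)) : Prop where
  zero : L 0 = ∅
  pending : ∀ k X h, Tame X → (⟨X, h⟩ : PSimPos A) ∈ L (k + 1) → Pending X →
    (∃ t ∈ X, t ≠ one ∧ t.pol = .ex ∧ ∃ b, (⟨X.swap t (t.nxt b), h⟩ : PSimPos A) ∈ L k) ∨
    (∃ t ∈ X, t.pol = .all ∧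
      (⟨X.swapPair t (t.nxt false) (t.nxt true), h⟩ : PSimPos A) ∈ L k)
  done : ∀ k X, ¬ Pending X → (⟨X, one⟩ : PSimPos A) ∈ L k → one ∉ X
  alea : ∀ k X h, ¬ Pending X → h.TopZeroFree → (⟨X, h⟩ : PSimPos A) ∈ L k →
    h.pol = .all → ∃ b, (⟨X, h.nxt b⟩ : PSimPos A) ∈ L k
  next : ∀ k X h Y h', ¬ Pending X → Tame X → h.TopZeroFree → (⟨X, h⟩ : PSimPos A) ∈ L k →
    Next X h Y h' → (⟨Y, h'⟩ : PSimPos A) ∈ L k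

/-- As for partial derivatives of regular expressions: the left factor of a composition stays fixed
until the right one has been consumed, and an iteration only reproduces itself as a left factor. -/
theorem exists_finite_closed (t : RegE A) :
    ∃ T : Set (RegE A), T.Finite ∧ t ∈ T ∧ ∀ s ∈ T, ∀ s', s.Step s' → s' ∈ T := by
  induction t with
  | zero => exact ⟨{zero}, Set.finite_singleton _, rfl, by rintro s rfl s' h; cases h⟩
  | top => exact ⟨{top}, Set.finite_singleton _, rfl, by rintro s rfl s' h; cases h⟩
  | one => exact ⟨{one}, Set.finite_singleton _, rfl, by rintro s rfl s' h; cases h⟩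
  | var a =>
    refine ⟨{var a, one}, Set.toFinite _, Or.inl rfl, ?_⟩
    rintro s (rfl | rfl) s' h <;> cases h
    exact Or.inr rfl
  | join e f ihe ihf =>
    obtain ⟨T, h1, h2, h3⟩ := ihe
    obtain ⟨T', h1', h2', h3'⟩ := ihf
    refine ⟨{join e f} ∪ (T ∪ T'), (Set.finite_singleton _).union (h1.union h1'), Or.inl rfl, ?_⟩
    rintro s (rfl | hs | hs) s' h
    · cases h
      · exact Or.inr (Or.inl h2)
      · exact Or.inr (Or.inr h2')
    · exact Or.inr (Or.inl (h3 s hs s' h))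
    · exact Or.inr (Or.inr (h3' s hs s' h))
  | meet e f ihe ihf =>
    obtain ⟨T, h1, h2, h3⟩ := ihe
    obtain ⟨T', h1', h2', h3'⟩ := ihf
    refine ⟨{meet e f} ∪ (T ∪ T'), (Set.finite_singleton _).union (h1.union h1'), Or.inl rfl, ?_⟩
    rintro s (rfl | hs | hs) s' h
    · cases h
      · exact Or.inr (Or.inl h2)
      · exact Or.inr (Or.inr h2')
    · exact Or.inr (Or.inl (h3 s hs s' h))
    · exact Or.inr (Or.inr (h3' s hs s' h))
  | comp g e ihg ihe =>
    obtain ⟨T, h1, h2, h3⟩ := ihg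
    obtain ⟨T', h1', h2', h3'⟩ := ihe
    refine ⟨comp g '' T' ∪ T, (h1'.image _).union h1, Or.inl ⟨e, h2', rfl⟩, ?_⟩
    rintro s (⟨r, hr, rfl⟩ | hs) s' h
    · cases h with
      | comp_one => exact Or.inr h2
      | comp_right _ h => exact Or.inl ⟨_, h3' r hr _ h, rfl⟩
    · exact Or.inr (h3 s hs s' h)
  | iter e ih =>
    obtain ⟨T, h1, h2, h3⟩ := ih
    refine ⟨{iter e, one} ∪ comp (iter e) '' T, (Set.toFinite _).union (h1.image _),
      Or.inl (Or.inl rfl), ?_⟩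
    rintro s ((rfl | rfl) | ⟨r, hr, rfl⟩) s' h
    · cases h
      · exact Or.inl (Or.inr rfl)
      · exact Or.inr ⟨e, h2, rfl⟩
    · cases h
    · cases h with
      | comp_one => exact Or.inl (Or.inl rfl)
      | comp_right _ h => exact Or.inr ⟨_, h3 r hr _ h, rfl⟩

theorem exists_finite_closed_positions (X : Finset (RegE A)) (h : RegE A) :
    ∃ W : Set (PSimPos A), W.Finite ∧ ⟨X, h⟩ ∈ W ∧
      ∀ u ∈ W, ∀ m, (psimGame A).move u m → m ∈ W := by
  choose T hT1 hT2 hT3 using exists_finite_closed (A := A)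
  let U : Set (RegE A) := T h ∪ ⋃ t ∈ X, T t
  have hU : U.Finite := (hT1 h).union (X.finite_toSet.biUnion fun t _ => hT1 t)
  have hUs : ∀ s ∈ U, ∀ s', s.Step s' → s' ∈ U := by
    rintro s (hs | hs) s' hss
    · exact Or.inl (hT3 h s hs s' hss)
    · simp only [Set.mem_iUnion] at hs
      obtain ⟨t, ht, hs⟩ := hs
      refine Or.inr ?_
      simp only [Set.mem_iUnion]
      exact ⟨t, ht, hT3 t s hs s' hss⟩
  refine ⟨{u | (u.hyps : Set (RegE A)) ⊆ U ∧ u.goal ∈ U}, ?_, ⟨?_, Or.inl (hT2 h)⟩, ?_⟩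
  · refine Set.Finite.of_finite_image (f := fun u : PSimPos A => ((u.hyps : Set (RegE A)), u.goal))
      ((hU.finite_subsets.prod hU).subset ?_) ?_
    · rintro _ ⟨u, hu, rfl⟩
      exact hu
    · rintro ⟨Y, e⟩ - ⟨Y', e'⟩ - he
      obtain ⟨h1, rfl⟩ := Prod.mk.inj he
      rw [Finset.coe_inj] at h1
      simp only at h1
      rw [h1]
  · intro t ht
    refine Or.inr ?_
    simp only [Set.mem_iUnion]
    exact ⟨t, ht, hT2 t⟩
  · rintro ⟨Y, e⟩ ⟨hY, he⟩ ⟨Y', e'⟩ hm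
    have hswap : ∀ t ∈ Y, ∀ t', t.Step t' → ((Y.swap t t' : Finset _) : Set (RegE A)) ⊆ U := by
      intro t ht t' hs s hss
      rcases Finset.mem_swap.1 hss with rfl | hs'
      · exact hUs t (hY ht) _ hs
      · exact hY hs'.2
    rcases move_iff.1 hm with ⟨t, ht, -, rfl, t', hs, rfl⟩ | ⟨t, ht, -, rfl, hY'⟩ |
      ⟨-, -, rfl, hs⟩ | ⟨-, -, rfl, hs⟩ | ⟨-, -, rfl, hs⟩ |
      ⟨-, a, t, t', ht, -, -, hse, hst, rfl⟩
    · exact ⟨hswap t ht t' hs, he⟩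
    · refine ⟨?_, he⟩
      change (Y' : Set (RegE A)) ⊆ U
      rw [hY']
      rintro s (hs | hs)
      · exact hY hs.1
      · exact hUs t (hY ht) s hs
    · exact ⟨hY, hUs _ he _ hs⟩
    · exact ⟨hY, hUs _ he _ hs⟩
    · exact ⟨hY, hUs _ he _ hs⟩
    · exact ⟨hswap t ht t' hst, hUs _ he _ hse⟩

/-- Determinacy specialized to this game: a finite closed set of positions contains the initial one,
and the abstract layer conditions are restated for each kind of move. -/
theorem exists_psim_layers {X : Finset (RegE A)} {h : RegE A}
    (hno : ¬ (psimGame A).DuplicatorWins ⟨X, h⟩) :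
    ∃ L : ℕ → Set (PSimPos A), Layers L ∧ ∃ N, (⟨X, h⟩ : PSimPos A) ∈ L N := by
  obtain ⟨W, hW1, hW2, hW3⟩ := exists_finite_closed_positions X h
  obtain ⟨L, h0, hN, hL⟩ := BuchiArena.exists_layers win_spoiler finite_moves hno hW1 hW3 hW2
  have hsucc : ∀ {k u}, u ∈ L k → ∃ j, k = j + 1 := by
    intro k u hu
    cases k with
    | zero => rw [h0] at hu; exact hu.elim
    | succ k => exact ⟨k, rfl⟩
  refine ⟨L, ⟨h0, ?_, ?_, ?_, ?_⟩, hN⟩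
  · intro k X h hX hL' hp
    obtain ⟨⟨Y, h'⟩, hm, hmL⟩ := (hL k _ hL').2.1 (mem_win_of_pending hp)
    have hdup : (psimGame A).owner ⟨X, h⟩ ≠ .duplicator := by
      rw [(owner_eq X h).2 (Or.inl hp)]; nofun
    rcases move_iff.1 hm with ⟨t, ht, hpol, rfl, t', hs, rfl⟩ | ⟨t, ht, hpol, rfl, hY'⟩ |
      ⟨-, hp', -⟩ | ⟨ho, -⟩ | ⟨ho, -⟩ | ⟨ho, -⟩
    · obtain ⟨b, rfl⟩ := (step_iff (hX t ht) (ne_one_of_step hs)).1 hs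
      exact Or.inl ⟨t, ht, ne_one_of_step hs, hpol, b, hmL⟩
    · rw [coe_eq_fork_iff (hX t ht) (ne_one_of_all hpol)] at hY'
      exact Or.inr ⟨t, ht, hpol, hY' ▸ hmL⟩
    · exact absurd hp hp'
    all_goals exact absurd ho hdup
  · intro k X hp hL' h1
    obtain ⟨k, rfl⟩ := hsucc hL'
    have ho := (owner_eq X one).2 (Or.inr (Or.inl ⟨h1, rfl⟩))
    have hdup : (psimGame A).owner ⟨X, one⟩ ≠ .duplicator := by rw [ho]; nofun
    obtain ⟨⟨Y, h'⟩, hm, -⟩ := (hL k _ hL').2.1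
      (mem_win_iff.2 ⟨ho, fun h => by have := h.1; cases this⟩)
    rcases move_iff.1 hm with ⟨t, ht, hpol, -, t', hs, -⟩ | ⟨t, ht, hpol, -, -⟩ |
      ⟨hp', -⟩ | ⟨ho, -⟩ | ⟨ho, -⟩ | ⟨ho, -⟩
    · exact hp ⟨t, ht, ne_one_of_step hs, Or.inl hpol⟩
    · exact hp ⟨t, ht, ne_one_of_all hpol, Or.inr hpol⟩
    · cases hp'
    all_goals exact absurd ho hdup
  · intro k X h hp hh hL' ha
    obtain ⟨k, rfl⟩ := hsucc hL'
    have ho := (owner_eq X h).2 (Or.inr (Or.inr ha))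
    have hs := step_nxt hh (ne_one_of_all ha) true
    have hdup : (psimGame A).owner ⟨X, h⟩ ≠ .duplicator := by rw [ho]; nofun
    obtain ⟨⟨Y, h'⟩, hm, hmL⟩ := (hL k _ hL').2.2.1
      (fun hw => (mem_win_iff.1 hw).2 ⟨ha, hp, _, hs⟩) ho
      ⟨⟨X, h.nxt true⟩, move_iff.2 (Or.inr (Or.inr (Or.inl ⟨ha, hp, rfl, hs⟩)))⟩
    rcases move_iff.1 hm with ⟨t, ht, hpol, -, t', hs, -⟩ | ⟨t, ht, hpol, -, -⟩ |
      ⟨-, -, rfl, hs⟩ | ⟨ho, -⟩ | ⟨ho, -⟩ | ⟨ho, -⟩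
    · exact absurd ⟨t, ht, ne_one_of_step hs, Or.inl hpol⟩ hp
    · exact absurd ⟨t, ht, ne_one_of_all hpol, Or.inr hpol⟩ hp
    · obtain ⟨b, rfl⟩ := (step_iff hh (ne_one_of_step hs)).1 hs
      exact ⟨b, hmL⟩
    all_goals exact absurd ho hdup
  · intro k X h Y h' hp hX hh hL' hn
    obtain ⟨k, rfl⟩ := hsucc hL'
    have ho : (psimGame A).owner ⟨X, h⟩ = .duplicator := by
      refine (owner_eq_duplicator X h).2 ⟨hp, ?_, ?_⟩
      · rintro ⟨-, rfl⟩
        cases hn with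
        | choose b h1 => exact h1 rfl
        | junk a hp => cases hp
        | fill a hp => cases hp
      · intro ha
        cases hn with
        | choose b h1 hp => rw [ha] at hp; cases hp
        | junk a hp => rw [ha] at hp; cases hp
        | fill a hp => rw [ha] at hp; cases hp
    exact (hL k _ hL').2.2.2 ho _ ((next_iff hX hh ho).2 hn)

end PSimPos

namespace BuchiArena

theorem Progress.inter {V : Type*} {G : BuchiArena V} {Z W : Set V} {rank : V → ℕ}
    (h : G.Progress Z rank) (hW : ∀ u ∈ W, ∀ m, G.move u m → m ∈ W) :
    G.Progress (Z ∩ W) rank := by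
  refine ⟨fun u hu hw m hm => ⟨h.win u hu.1 hw m hm, hW u hu.2 m hm⟩, fun u hu hw ho => ?_,
    fun u hu hw ho => ?_⟩
  · obtain ⟨h1, h2⟩ := h.spoiler u hu.1 hw ho
    exact ⟨h1, fun m hm => ⟨⟨(h2 m hm).1, hW u hu.2 m hm⟩, (h2 m hm).2⟩⟩
  · obtain ⟨m, h1, h2, h3⟩ := h.duplicator u hu.1 hw ho
    exact ⟨m, h1, ⟨h2, hW u hu.2 m h1⟩, h3⟩

end BuchiArena

namespace PSimPos

open RegE

variable {A : Type*}

theorem tame_of_move {u m : PSimPos A} (hX : Tame u.hyps) (hg : u.goal.TopZeroFree)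
    (hm : (psimGame A).move u m) : Tame m.hyps ∧ m.goal.TopZeroFree := by
  obtain ⟨X, h⟩ := u
  obtain ⟨Y, h'⟩ := m
  have hstep : ∀ t t' : RegE A, t.TopZeroFree → t.Step t' → t'.TopZeroFree := by
    intro t t' ht hs
    obtain ⟨b, rfl⟩ := (step_iff ht (ne_one_of_step hs)).1 hs
    exact ht.nxt b
  have hswap : ∀ t ∈ X, ∀ t', t.Step t' → Tame (X.swap t t') := by
    intro t ht t' hs s hss
    rcases Finset.mem_swap.1 hss with rfl | hs'
    · exact hstep t _ (hX t ht) hs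
    · exact hX s hs'.2
  rcases move_iff.1 hm with ⟨t, ht, -, rfl, t', hs, rfl⟩ | ⟨t, ht, -, rfl, hY'⟩ |
    ⟨-, -, rfl, hs⟩ | ⟨-, -, rfl, hs⟩ | ⟨-, -, rfl, hs⟩ |
    ⟨-, a, t, t', ht, -, -, hse, hst, rfl⟩
  · exact ⟨hswap t ht t' hs, hg⟩
  · refine ⟨fun s hs => ?_, hg⟩
    have hs : s ∈ (Y : Set (RegE A)) := hs
    rw [hY'] at hs
    rcases hs with hs | hs
    · exact hX s hs.1
    · exact hstep t s (hX t ht) hs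
  · exact ⟨hX, hstep _ _ hg hs⟩
  · exact ⟨hX, hstep _ _ hg hs⟩
  · exact ⟨hX, hstep _ _ hg hs⟩
  · exact ⟨hswap t ht t' hst, hstep _ _ hg hse⟩

end PSimPos

/-! ### Instances together with codes of back maps -/

namespace RegE

variable {A : Type*} {ρ : A → WProblem}

/-- An instance of `t` together with a code that maps its solutions into `S`. -/
def Solves (ρ : A → WProblem) (S : Set Baire) (t : RegE A) (o : Baire × Baire) : Prop :=
  o.1 ∈ (t.interp ρ).dom ∧ ∀ y ∈ (t.interp ρ).sol o.1, ∃ z ∈ S, z ∈ (capp o.2 y : Part Baire)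

/-- The new back map splits a solution into an answer `x` and a rest, asks `ζ` again at `x` for the
back map that belongs to it, and applies that to the rest. The map `C` does not depend on `S`, which
varies with the original instance. -/
theorem exists_solves_constructor (ρ : A → WProblem) {h : RegE A} (hh : h.TopZeroFree)
    (h1 : h ≠ one) : ∃ C : Baire × Baire → Part (Baire × Baire), Rz C ∧ ∀ S q ζ,
      q ∈ (head ρ h).dom →
      (∀ x ∈ (head ρ h).sol q, ∃ b o, (b, o) ∈ (capp ζ x : Part (Bool × Baire × Baire)) ∧
        Selects h x b ∧ Solves ρ S (h.nxt b) o) → ∃ o ∈ C (q, ζ), Solves ρ S h o := by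
  obtain ⟨C, hC, hC'⟩ := exists_constructor hh h1
  obtain ⟨K₁, hK₁, hK₁'⟩ := Rz.curry (α := Baire) (β := Baire) (γ := Bool × Baire)
    (F := fun ζ x => (capp ζ x : Part (Bool × Baire × Baire)).map fun r => (r.1, r.2.1))
    (Rz.ap_map (by fun_prop) (by fun_prop) (by fun_prop))
  obtain ⟨K₂, hK₂, hK₂'⟩ := Rz.curry (α := Baire × Baire) (β := Baire) (γ := Baire)
    (F := fun x z => (capp x.1 z : Part (Baire × Baire)).bind fun r =>
      (capp x.2 r.1 : Part (Bool × Baire × Baire)).bind fun r' =>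
        (capp r'.2.2 r.2 : Part Baire))
    (Rz.bind (Rz.ap_total (by fun_prop) (by fun_prop))
      (Rz.bind (Rz.ap_total (by fun_prop) (by fun_prop))
        (Rz.ap_total (by fun_prop) (by fun_prop))))
  refine ⟨fun x => (C (x.1, K₁ x.2)).map fun r => (r.1, K₂ (r.2, x.2)),
    Rz.map (hC.comp (by fun_prop)) (by fun_prop), fun S q ζ hq hζ => ?_⟩
  obtain ⟨w, γ, hwγ, hw, hγ⟩ := hC' ρ q (K₁ ζ) ⟨hq, fun x hx => by
    obtain ⟨b, o, h1, h2, h3⟩ := hζ x hx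
    exact ⟨b, o.1, hK₁' ζ x _ ((Part.mem_map_iff _).2 ⟨_, h1, rfl⟩), h2, h3.1⟩⟩
  refine ⟨_, (Part.mem_map_iff _).2 ⟨_, hwγ, rfl⟩, hw, fun z hz => ?_⟩
  obtain ⟨x, y, b, w', hγz, hx, hκ, hy⟩ := hγ z hz
  obtain ⟨b', o, h1, h2, h3⟩ := hζ x hx
  obtain ⟨rfl, rfl⟩ := Prod.mk.inj (Part.mem_unique hκ
    (hK₁' ζ x _ ((Part.mem_map_iff _).2 ⟨_, h1, rfl⟩)))
  obtain ⟨z', hz', h4⟩ := h3.2 y hy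
  exact ⟨z', hz', hK₂' (γ, ζ) z z' (Part.mem_bind_iff.2 ⟨_, hγz, Part.mem_bind_iff.2 ⟨_, h1, h4⟩⟩)⟩

/-- The stored code is precomposed with the back map of the transition. The `Unfolds` clause makes
the recursion of the reduction decrease. -/
theorem exists_solves_destructor (ρ : A → WProblem) {t : RegE A} (ht : t.TopZeroFree)
    (h1 : t ≠ one) : ∃ D : Baire × Baire → Part (Baire × Baire), Rz D ∧ ∀ S o, Solves ρ S t o →
      ∃ q κ, (q, κ) ∈ D o ∧ q ∈ (head ρ t).dom ∧ ∀ x ∈ (head ρ t).sol q, ∃ b o',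
        (b, o') ∈ (capp κ x : Part (Bool × Baire × Baire)) ∧ Selects t x b ∧
        Solves ρ S (t.nxt b) o' ∧ Unfolds ρ (t.nxt b, o'.1) (t, o.1) := by
  obtain ⟨D, hD, hD'⟩ := exists_destructor ρ ht h1
  obtain ⟨K₁, hK₁, hK₁'⟩ := Rz.curry (α := Baire × Baire) (β := Baire) (γ := Baire)
    (F := fun x y => (capp x.2 y : Part Baire).bind fun y' => (capp x.1 y' : Part Baire))
    (Rz.bind (Rz.ap_total (by fun_prop) (by fun_prop)) (Rz.ap_total (by fun_prop) (by fun_prop)))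
  obtain ⟨K₂, hK₂, hK₂'⟩ := Rz.curry (α := Baire × Baire) (β := Baire) (γ := Bool × Baire × Baire)
    (F := fun c x => (capp c.2 x : Part (Bool × Baire × Baire)).map
      fun r => (r.1, r.2.1, K₁ (c.1, r.2.2)))
    (Rz.ap_map (by fun_prop) (by fun_prop) (by fun_prop))
  refine ⟨fun o => (D o.1).map fun r => (r.1, K₂ (o.2, r.2)),
    Rz.map (hD.comp (by fun_prop)) (by fun_prop), fun S o ho => ?_⟩
  obtain ⟨q, κ, hqκ, hq, hκ⟩ := hD' o.1 ho.1
  refine ⟨_, _, (Part.mem_map_iff _).2 ⟨_, hqκ, rfl⟩, hq, fun x hx => ?_⟩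
  obtain ⟨b, w', β, bk, h1, h2, h3, h4⟩ := hκ x hx
  obtain ⟨hw', hbk⟩ := h3.sound ho.1
  refine ⟨b, (w', K₁ (o.2, β)), hK₂' (o.2, κ) x _ ((Part.mem_map_iff _).2 ⟨_, h1, rfl⟩), h2,
    ⟨hw', fun y hy => ?_⟩, x, b, bk, h3, rfl⟩
  obtain ⟨z, hz, h5⟩ := ho.2 _ (hbk y hy)
  exact ⟨z, hz, hK₁' (o.2, β) y z (Part.mem_bind_iff.2 ⟨_, h4 y hy, h5⟩)⟩

/-- Ordinals are used because an answer may come from an infinite set of solutions, so an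
interaction need not have finite height. -/
theorem exists_unfolding_rank.{u} {A : Type u} (ρ : A → WProblem) :
    ∃ rk : RegE A × Baire → Ordinal.{u},
      ∀ p q, p.2 ∈ (p.1.interp ρ).dom → Unfolds ρ q p → rk q < rk p := by
  classical
  refine ⟨fun p => if h : p.2 ∈ (p.1.interp ρ).dom then (acc_of_mem_dom h).rank else 0, ?_⟩
  rintro p ⟨t, w⟩ hp ⟨x, b, bk, hls, rfl⟩
  have h' : w ∈ ((p.1.nxt b).interp ρ).dom := (hls.sound hp).1
  simp only [dif_pos h', dif_pos hp]
  exact Acc.rank_lt_of_rel (acc_of_mem_dom hp) ⟨x, b, bk, hls, rfl⟩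

end RegE

/-! ### States of a reduction -/

namespace Baire

/-- The instance and the code stored in column `k`. -/
def load (k : ℕ) (s : Baire) : Baire × Baire := (Baire.fst (col k s), Baire.snd (col k s))

/-- Storing an instance and a code in column `k`. -/
def store (k : ℕ) (s : Baire) (o : Baire × Baire) : Baire := upd k s (pair o.1 o.2)

@[simp] theorem load_store_self (k : ℕ) (s : Baire) (o : Baire × Baire) :
    load k (store k s o) = o := by
  simp [load, store]

theorem load_store_of_ne {k l : ℕ} (h : l ≠ k) (s : Baire) (o : Baire × Baire) :
    load l (store k s o) = load l s := by
  simp [load, store, col_upd_of_ne h]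

end Baire

@[fun_prop]
theorem Rt.load {α : Type} [Coded α] (k : ℕ) {f : α → Baire} (hf : Rt f) :
    Rt fun a => Baire.load k (f a) := by
  unfold Baire.load
  fun_prop

@[fun_prop]
theorem Rt.store {α : Type} [Coded α] (k : ℕ) {f : α → Baire} {g : α → Baire × Baire}
    (hf : Rt f) (hg : Rt g) : Rt fun a => Baire.store k (f a) (g a) := by
  unfold Baire.store
  fun_prop

/-- The element `t` is given up, and everything in `X'` that is not an unchanged element of `X` lies
below it. This also covers a successor that was already present and whose value is overwritten. -/
theorem Multiset.isDershowitzMannaLT_map {α β : Type*} [Preorder β] {X X' : Finset α}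
    {f f' : α → β} {t : α} (ht : t ∈ X)
    (h : ∀ s ∈ X', (s ∈ X ∧ s ≠ t ∧ f' s = f s) ∨ f' s < f t) :
    Multiset.IsDershowitzMannaLT (X'.val.map f') (X.val.map f) := by
  classical
  -- The common part of the two multisets; whatever else is in `X` is discarded along with `t`.
  let C := X'.filter fun s => s ∈ X ∧ s ≠ t ∧ f' s = f s
  have hCX : C ⊆ X := fun s hs => ((Finset.mem_filter.1 hs).2).1
  have hCX' : C ⊆ X' := Finset.filter_subset _ _
  have split : ∀ {Y : Finset α}, C ⊆ Y → Y.val = C.val + (Y \ C).val := by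
    intro Y hY
    rw [← Finset.disjUnion_val C (Y \ C) Finset.disjoint_sdiff, Finset.disjUnion_eq_union,
      Finset.union_sdiff_of_subset hY]
  have htC : t ∉ C := fun hs => ((Finset.mem_filter.1 hs).2).2.1 rfl
  refine ⟨C.val.map f, (X' \ C).val.map f', (X \ C).val.map f, ?_, ?_, ?_, ?_⟩
  · intro h0
    have : t ∈ (X \ C).val := Finset.mem_sdiff.2 ⟨ht, htC⟩
    have := Multiset.mem_map_of_mem f this
    rw [h0] at this
    exact Multiset.notMem_zero _ this
  · rw [split hCX', Multiset.map_add]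
    congr 1
    exact Multiset.map_congr rfl fun s hs => ((Finset.mem_filter.1 hs).2).2.2
  · rw [split hCX, Multiset.map_add]
  · intro y hy
    obtain ⟨s, hs, rfl⟩ := Multiset.mem_map.1 hy
    obtain ⟨hs1, hs2⟩ := Finset.mem_sdiff.1 hs
    refine ⟨f t, Multiset.mem_map_of_mem f (Finset.mem_sdiff.2 ⟨ht, htC⟩), ?_⟩
    exact (h s hs1).resolve_left fun h' => hs2 (Finset.mem_filter.2 ⟨hs1, h'⟩)

namespace RegE

universe u

variable {A : Type u} {ρ : A → WProblem}

/-- The columns of `s` store instances of the hypotheses `X` whose solutions lead into `S`. -/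
def Valid (ρ : A → WProblem) (cx : RegE A → ℕ) (S : Set Baire) (X : Finset (RegE A))
    (s : Baire) : Prop := ∀ t ∈ X, Solves ρ S t (load (cx t) s)

/-- The ranks of the instances stored for the hypotheses `X`. -/
def weight (rk : RegE A × Baire → Ordinal.{u}) (cx : RegE A → ℕ) (X : Finset (RegE A))
    (s : Baire) : Multiset Ordinal.{u} := X.val.map fun t => rk (t, (load (cx t) s).1)

variable {cx : RegE A → ℕ} {rk : RegE A × Baire → Ordinal.{u}} {S : Set Baire}
  {X : Finset (RegE A)} {s : Baire} {U : Set (RegE A)}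

/-- If `t'` already is a hypothesis, its old instance is overwritten, which loses nothing since any
instance leading into `S` will do. Injectivity of `cx` protects the other columns. -/
theorem Valid.swap (hs : Valid ρ cx S X s) (hcx : Set.InjOn cx U) {t t' : RegE A}
    (hU : ∀ r ∈ X.swap t t', r ∈ U) {o : Baire × Baire} (ho : Solves ρ S t' o) :
    Valid ρ cx S (X.swap t t') (store (cx t') s o) := by
  intro r hr
  by_cases hrt : r = t'
  · subst hrt
    simpa using ho
  · have hne : cx r ≠ cx t' := fun h =>
      hrt (hcx (hU r hr) (hU t' (Finset.mem_swap.2 (Or.inl rfl))) h)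
    rw [load_store_of_ne hne]
    exact hs r ((Finset.mem_swap.1 hr).resolve_left hrt).2

theorem weight_swap (hcx : Set.InjOn cx U) {t t' : RegE A} (ht : t ∈ X)
    (hU : ∀ r ∈ X.swap t t', r ∈ U) {o : Baire × Baire}
    (ho : rk (t', o.1) < rk (t, (load (cx t) s).1)) :
    (weight rk cx (X.swap t t') (store (cx t') s o)).IsDershowitzMannaLT (weight rk cx X s) := by
  refine Multiset.isDershowitzMannaLT_map ht fun r hr => ?_
  by_cases hrt : r = t'
  · subst hrt
    exact Or.inr (by simpa using ho)
  · have hne : cx r ≠ cx t' := fun h =>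
      hrt (hcx (hU r hr) (hU t' (Finset.mem_swap.2 (Or.inl rfl))) h)
    obtain ⟨h1, h2⟩ := (Finset.mem_swap.1 hr).resolve_left hrt
    exact Or.inl ⟨h2, h1, by rw [load_store_of_ne hne]⟩

theorem Valid.swapPair (hs : Valid ρ cx S X s) (hcx : Set.InjOn cx U) {t t₀ t₁ : RegE A}
    (hU : ∀ r ∈ X.swapPair t t₀ t₁, r ∈ U) {o₀ o₁ : Baire × Baire} (h₀ : Solves ρ S t₀ o₀)
    (h₁ : Solves ρ S t₁ o₁) :
    Valid ρ cx S (X.swapPair t t₀ t₁) (store (cx t₁) (store (cx t₀) s o₀) o₁) := by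
  intro r hr
  by_cases hr1 : r = t₁
  · subst hr1
    simpa using h₁
  · have hne : cx r ≠ cx t₁ := fun h =>
      hr1 (hcx (hU r hr) (hU t₁ (Finset.mem_swapPair.2 (Or.inl rfl))) h)
    rw [load_store_of_ne hne]
    by_cases hr0 : r = t₀
    · subst hr0
      simpa using h₀
    · have hne : cx r ≠ cx t₀ := fun h =>
        hr0 (hcx (hU r hr) (hU t₀ (Finset.mem_swapPair.2 (Or.inr (Or.inl rfl)))) h)
      rw [load_store_of_ne hne]
      exact hs r (((Finset.mem_swapPair.1 hr).resolve_left hr1).resolve_left hr0).2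

theorem weight_swapPair (hcx : Set.InjOn cx U) {t t₀ t₁ : RegE A} (ht : t ∈ X)
    (hU : ∀ r ∈ X.swapPair t t₀ t₁, r ∈ U) {o₀ o₁ : Baire × Baire}
    (h₀ : rk (t₀, o₀.1) < rk (t, (load (cx t) s).1))
    (h₁ : rk (t₁, o₁.1) < rk (t, (load (cx t) s).1)) :
    (weight rk cx (X.swapPair t t₀ t₁)
      (store (cx t₁) (store (cx t₀) s o₀) o₁)).IsDershowitzMannaLT (weight rk cx X s) := by
  refine Multiset.isDershowitzMannaLT_map ht fun r hr => ?_
  by_cases hr1 : r = t₁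
  · subst hr1
    exact Or.inr (by simpa using h₁)
  · have hne : cx r ≠ cx t₁ := fun h =>
      hr1 (hcx (hU r hr) (hU t₁ (Finset.mem_swapPair.2 (Or.inl rfl))) h)
    rw [load_store_of_ne hne]
    by_cases hr0 : r = t₀
    · subst hr0
      exact Or.inr (by simpa using h₀)
    · have hne : cx r ≠ cx t₀ := fun h =>
        hr0 (hcx (hU r hr) (hU t₀ (Finset.mem_swapPair.2 (Or.inr (Or.inl rfl)))) h)
      obtain ⟨h1, h2⟩ := ((Finset.mem_swapPair.1 hr).resolve_left hr1).resolve_left hr0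
      exact Or.inl ⟨h2, h1, by rw [load_store_of_ne hne]⟩

/-- The state `s'` at `u'` is smaller than the state `s` at `u`. -/
def Below (rk : RegE A × Baire → Ordinal.{u}) (cx : RegE A → ℕ) (rank : PSimPos A → ℕ)
    (u' : PSimPos A) (s' : Baire) (u : PSimPos A) (s : Baire) : Prop :=
  (weight rk cx u'.hyps s').IsDershowitzMannaLT (weight rk cx u.hyps s) ∨
    (weight rk cx u'.hyps s' = weight rk cx u.hyps s ∧ rank u' < rank u)

/-- `F` computes a solution at the position `u` from a code `r` of solutions at smaller states. -/
def Advances (ρ : A → WProblem) (rk : RegE A × Baire → Ordinal.{u}) (cx : RegE A → ℕ)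
    (idx : PSimPos A → ℕ) (Z : Set (PSimPos A)) (rank : PSimPos A → ℕ) (u : PSimPos A)
    (F : Baire × Baire → Part (Baire × Baire)) : Prop :=
  ∀ (r : Baire) (S : Set Baire) (s : Baire), Valid ρ cx S u.hyps s →
    (∀ u' ∈ Z, ∀ s', Valid ρ cx S u'.hyps s' → Below rk cx rank u' s' u s →
      ∃ o ∈ (capp r (idx u', s') : Part (Baire × Baire)), Solves ρ S u'.goal o) →
    ∃ o ∈ F (r, s), Solves ρ S u.goal o

theorem head_dom_of_ex {t : RegE A} (h : t.pol = .ex) : head ρ t = WProblem.one := by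
  simp [head, h]

theorem head_of_all {t : RegE A} (h : t.pol = .all) :
    head ρ t = WProblem.one.meet .one := by
  simp [head, h]

theorem head_of_letter {t : RegE A} {a : A} (h : t.pol = .letter a) : head ρ t = ρ a := by
  simp [head, h]

theorem mem_sol_one_meet_one {q x : Baire} (hq : q ∈ (WProblem.one.meet .one).dom) :
    x ∈ (WProblem.one.meet .one).sol q ↔ ∃ b, x = inb b pt := by
  obtain ⟨p, hp, p', hp', rfl⟩ := hq
  constructor
  · rintro ⟨_, _, _, _, -, (⟨x, hx, rfl⟩ | ⟨x, hx, rfl⟩)⟩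
    · obtain rfl : x = pt := hx
      exact ⟨false, rfl⟩
    · obtain rfl : x = pt := hx
      exact ⟨true, rfl⟩
  · rintro ⟨b, rfl⟩
    refine ⟨_, hp, _, hp', rfl, ?_⟩
    cases b
    · exact Or.inl ⟨pt, rfl, rfl⟩
    · exact Or.inr ⟨pt, rfl, rfl⟩

variable {idx : PSimPos A → ℕ} {Z : Set (PSimPos A)} {rank : PSimPos A → ℕ}

section

variable (hrk : ∀ p q, p.2 ∈ (p.1.interp ρ).dom → Unfolds ρ q p → rk q < rk p)
  (hcx : Set.InjOn cx U) (hZU : ∀ u ∈ Z, ∀ t ∈ u.hyps, t ∈ U)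

include hrk hcx hZU

/-- The stored instance itself decides which successor is taken, so all of Spoiler's explore moves
at `t` have to stay in `Z`. -/
theorem exists_advances_explore {X : Finset (RegE A)} {h t : RegE A} (hX : PSimPos.Tame X)
    (ht : t ∈ X) (h1 : t ≠ one) (hp : t.pol = .ex)
    (hZ : ∀ b, (⟨X.swap t (t.nxt b), h⟩ : PSimPos A) ∈ Z) :
    ∃ F, Rz F ∧ Advances ρ rk cx idx Z rank ⟨X, h⟩ F := by
  obtain ⟨D, hD, hD'⟩ := exists_solves_destructor ρ (hX t ht) h1
  -- The bit `b` becomes known only during the computation, so both targets are wired in and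
  -- selected by a realizable conditional.
  let st : Bool → Baire → Baire × Baire → Baire := fun b s o =>
    bif b then store (cx (t.nxt true)) s o else store (cx (t.nxt false)) s o
  let ix : Bool → ℕ := fun b => bif b then idx ⟨X.swap t (t.nxt true), h⟩
    else idx ⟨X.swap t (t.nxt false), h⟩
  have hst : ∀ b s o, st b s o = store (cx (t.nxt b)) s o := by intro b s o; cases b <;> rfl
  have hix : ∀ b, ix b = idx ⟨X.swap t (t.nxt b), h⟩ := by intro b; cases b <;> rfl
  refine ⟨fun x => (D (load (cx t) x.2)).bind fun y =>
    (capp y.2 pt : Part (Bool × Baire × Baire)).bind fun z =>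
      (capp x.1 (ix z.1, st z.1 x.2 z.2) : Part (Baire × Baire)),
    Rz.bind (hD.comp (by fun_prop)) (Rz.bind (Rz.ap_total (by fun_prop) (by fun_prop))
      (Rz.ap_total (by fun_prop) (by unfold ix st; fun_prop))), fun r S s hs hr => ?_⟩
  obtain ⟨q, κ, h1, -, h2⟩ := hD' S _ (hs t ht)
  rw [head_dom_of_ex hp] at h2
  obtain ⟨b, o, h3, -, h4, h5⟩ := h2 pt rfl
  obtain ⟨o', ho', ho''⟩ := hr _ (hZ b) (store (cx (t.nxt b)) s o) (hs.swap hcx (hZU _ (hZ b)) h4)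
    (Or.inl (weight_swap hcx ht (hZU _ (hZ b)) (hrk _ _ (hs t ht).1 h5)))
  refine ⟨o', Part.mem_bind_iff.2 ⟨_, h1, Part.mem_bind_iff.2 ⟨_, h3, ?_⟩⟩, ho''⟩
  simpa [hst, hix] using ho'

theorem exists_advances_fork {X : Finset (RegE A)} {h t : RegE A} (hX : PSimPos.Tame X)
    (ht : t ∈ X) (hp : t.pol = .all)
    (hZ : (⟨X.swapPair t (t.nxt false) (t.nxt true), h⟩ : PSimPos A) ∈ Z) :
    ∃ F, Rz F ∧ Advances ρ rk cx idx Z rank ⟨X, h⟩ F := by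
  obtain ⟨D, hD, hD'⟩ := exists_solves_destructor ρ (hX t ht) (PSimPos.ne_one_of_all hp)
  refine ⟨fun x => (D (load (cx t) x.2)).bind fun y =>
    (capp y.2 (inb false pt) : Part (Bool × Baire × Baire)).bind fun z =>
      (capp y.2 (inb true pt) : Part (Bool × Baire × Baire)).bind fun z' =>
        (capp x.1 (idx ⟨X.swapPair t (t.nxt false) (t.nxt true), h⟩,
          store (cx (t.nxt true)) (store (cx (t.nxt false)) x.2 z.2) z'.2) : Part (Baire × Baire)),
    Rz.bind (hD.comp (by fun_prop)) (Rz.bind (Rz.ap_total (by fun_prop) (by fun_prop))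
      (Rz.bind (Rz.ap_total (by fun_prop) (by fun_prop))
        (Rz.ap_total (by fun_prop) (by fun_prop)))), fun r S s hs hr => ?_⟩
  obtain ⟨q, κ, h1, hq, h2⟩ := hD' S _ (hs t ht)
  rw [head_of_all hp] at h2 hq
  obtain ⟨b, o, h3, hb, h4, h5⟩ := h2 _ ((mem_sol_one_meet_one hq).2 ⟨false, rfl⟩)
  obtain ⟨b', o', h3', hb', h4', h5'⟩ := h2 _ ((mem_sol_one_meet_one hq).2 ⟨true, rfl⟩)
  obtain rfl : false = b := by simpa using hb hp
  obtain rfl : true = b' := by simpa using hb' hp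
  obtain ⟨o'', ho, ho'⟩ := hr _ hZ _ (hs.swapPair hcx (hZU _ hZ) h4 h4')
    (Or.inl (weight_swapPair hcx ht (hZU _ hZ) (hrk _ _ (hs t ht).1 h5)
      (hrk _ _ (hs t ht).1 h5')))
  exact ⟨o'', Part.mem_bind_iff.2 ⟨_, h1, Part.mem_bind_iff.2 ⟨_, h3, Part.mem_bind_iff.2
    ⟨_, h3', ho⟩⟩⟩, ho'⟩

/-- The query of the stored instance of `t` is passed on as the query of the goal, since both go to
the letter `a`. Each answer then moves both sides at once. -/
theorem exists_advances_fill {X : Finset (RegE A)} {h t : RegE A} {a : A} (hX : PSimPos.Tame X)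
    (hh : h.TopZeroFree) (ht : t ∈ X) (hp : h.pol = .letter a) (htp : t.pol = .letter a)
    (hZ : (⟨X.swap t (t.nxt false), h.nxt false⟩ : PSimPos A) ∈ Z) :
    ∃ F, Rz F ∧ Advances ρ rk cx idx Z rank ⟨X, h⟩ F := by
  obtain ⟨D, hD, hD'⟩ := exists_solves_destructor ρ (hX t ht) (PSimPos.ne_one_of_letter htp)
  obtain ⟨C, hC, hC'⟩ := exists_solves_constructor ρ hh (PSimPos.ne_one_of_letter hp)
  obtain ⟨K, hK, hK'⟩ := Rz.curry (α := (Baire × Baire) × Baire) (β := Baire)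
    (γ := Bool × Baire × Baire)
    (F := fun y x => (capp y.2 x : Part (Bool × Baire × Baire)).bind fun z =>
      (capp y.1.1 (idx ⟨X.swap t (t.nxt false), h.nxt false⟩,
        store (cx (t.nxt false)) y.1.2 z.2) : Part (Baire × Baire)).map fun o => (false, o))
    (Rz.bind (Rz.ap_total (by fun_prop) (by fun_prop))
      (Rz.ap_map (by fun_prop) (by fun_prop) (by fun_prop)))
  refine ⟨fun x => (D (load (cx t) x.2)).bind fun y => C (y.1, K (x, y.2)),
    Rz.bind (hD.comp (by fun_prop)) (hC.comp (by fun_prop)), fun r S s hs hr => ?_⟩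
  obtain ⟨q, κ, h1, hq, h2⟩ := hD' S _ (hs t ht)
  rw [head_of_letter htp] at hq h2
  have hC'' := hC' S q (K ((r, s), κ))
  rw [head_of_letter hp] at hC''
  obtain ⟨o, ho, ho'⟩ := hC'' hq fun x hx => by
    obtain ⟨b, o, h3, -, h4, h5⟩ := h2 x hx
    rw [nxt_eq_of_letter htp] at h4 h5
    obtain ⟨o', ho, ho'⟩ := hr _ hZ _ (hs.swap hcx (hZU _ hZ) h4)
      (Or.inl (weight_swap hcx ht (hZU _ hZ) (hrk _ _ (hs t ht).1 h5)))
    refine ⟨false, o', hK' ((r, s), κ) x _ (Part.mem_bind_iff.2 ⟨_, h3,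
      (Part.mem_map_iff _).2 ⟨_, ho, rfl⟩⟩), fun h => ?_, ho'⟩
    rw [hp] at h
    cases h
  exact ⟨o, Part.mem_bind_iff.2 ⟨_, h1, ho⟩, ho'⟩

end

theorem exists_advances_done {X : Finset (RegE A)} (h1 : one ∈ X) :
    ∃ F, Rz F ∧ Advances ρ rk cx idx Z rank ⟨X, one⟩ F := by
  obtain ⟨K, hK, hK'⟩ := Rz.curry (α := Baire) (β := Baire) (γ := Baire)
    (F := fun b _ => (capp b pt : Part Baire)) (Rz.ap_total (by fun_prop) (by fun_prop))
  refine ⟨fun x => Part.some (pt, K (load (cx one) x.2).2),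
    (by fun_prop : Rt fun x : Baire × Baire => (pt, K (load (cx one) x.2).2)),
    fun r S s hs _ => ⟨_, Part.mem_some _, rfl, fun y _ => ?_⟩⟩
  obtain ⟨z, hz, h⟩ := (hs one h1).2 pt rfl
  exact ⟨z, hz, hK' _ _ _ h⟩

/-- A transition of the goal that answers the query `q`, without use of the hypotheses. -/
theorem exists_advances_goal {X : Finset (RegE A)} {h : RegE A} (hh : h.TopZeroFree)
    (h1 : h ≠ one) {q : Baire} (hq : Computable q) (hqd : q ∈ (head ρ h).dom)
    {sel : Baire → Bool} (hsel : Rt sel)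
    (hZ : ∀ x ∈ (head ρ h).sol q, Selects h x (sel x) ∧
      (⟨X, h.nxt (sel x)⟩ : PSimPos A) ∈ Z ∧ rank ⟨X, h.nxt (sel x)⟩ < rank ⟨X, h⟩) :
    ∃ F, Rz F ∧ Advances ρ rk cx idx Z rank ⟨X, h⟩ F := by
  obtain ⟨C, hC, hC'⟩ := exists_solves_constructor ρ hh h1
  let ix : Bool → ℕ := fun b => bif b then idx ⟨X, h.nxt true⟩ else idx ⟨X, h.nxt false⟩
  have hix : ∀ b, ix b = idx ⟨X, h.nxt b⟩ := by intro b; cases b <;> rfl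
  obtain ⟨K, hK, hK'⟩ := Rz.curry (α := Baire × Baire) (β := Baire) (γ := Bool × Baire × Baire)
    (F := fun y x => (capp y.1 (ix (sel x), y.2) : Part (Baire × Baire)).map
      fun o => (sel x, o))
    (Rz.ap_map (by fun_prop) (by unfold ix; fun_prop) (by fun_prop))
  have hq' : Rt fun _ : Baire × Baire => q := Rt.const hq
  refine ⟨fun x => C (q, K x), hC.comp (by fun_prop), fun r S s hs hr =>
    hC' S q _ hqd fun x hx => ?_⟩
  obtain ⟨h2, h3, h4⟩ := hZ x hx
  obtain ⟨o, ho, ho'⟩ := hr _ h3 s hs (Or.inr ⟨rfl, h4⟩)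
  rw [← hix] at ho
  exact ⟨sel x, o, hK' (r, s) x _ ((Part.mem_map_iff _).2 ⟨o, ho, rfl⟩), h2, ho'⟩

theorem exists_advances (hrk : ∀ p q, p.2 ∈ (p.1.interp ρ).dom → Unfolds ρ q p → rk q < rk p)
    (hcx : Set.InjOn cx U) (hZU : ∀ u ∈ Z, ∀ t ∈ u.hyps, t ∈ U)
    (hρ : ∀ a, (ρ a).IsPointed) (hP : (psimGame A).Progress Z rank) {u : PSimPos A}
    (hX : PSimPos.Tame u.hyps) (hh : u.goal.TopZeroFree) (hu : u ∈ Z) :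
    ∃ F, Rz F ∧ Advances ρ rk cx idx Z rank u F := by
  obtain ⟨X, h⟩ := u
  rcases PSimPos.progress_cases hP hX hh hu with ⟨t, ht, h1, hp, hZ⟩ | ⟨t, ht, hp, hZ⟩ |
    ⟨h1, rfl⟩ | ⟨ha, hZ⟩ | ⟨Y, h', hn, hZ, hr⟩
  · exact exists_advances_explore hrk hcx hZU hX ht h1 hp hZ
  · exact exists_advances_fork hrk hcx hZU hX ht hp hZ
  · exact exists_advances_done h1
  · have hd : pair pt pt ∈ (WProblem.one.meet .one).dom := ⟨pt, rfl, pt, rfl, rfl⟩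
    refine exists_advances_goal hh (PSimPos.ne_one_of_all ha) (q := pair pt pt)
      (Rt.computable (f := fun _ : Baire => pair pt pt) (by fun_prop) computable_pt)
      (by rw [head_of_all ha]; exact hd) (sel := tag) (by fun_prop) fun x hx => ?_
    exact ⟨fun _ => rfl, hZ _⟩
  · cases hn with
    | choose b h1 hp =>
      refine exists_advances_goal hh h1 (q := pt) computable_pt
        (by rw [head_dom_of_ex hp]; rfl) (sel := fun _ => b) (by fun_prop) fun x hx => ?_
      exact ⟨fun ha => (by rw [hp] at ha; cases ha), hZ, hr⟩
    | junk a hp =>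
      obtain ⟨q, hq, hq'⟩ := hρ a
      refine exists_advances_goal hh (PSimPos.ne_one_of_letter hp) (q := q) hq'
        (by rw [head_of_letter hp]; exact hq) (sel := fun _ => false) (by fun_prop)
        fun x hx => ?_
      exact ⟨fun ha => (by rw [hp] at ha; cases ha), hZ, hr⟩
    | fill a hp t ht htp =>
      exact exists_advances_fill hrk hcx hZU hX hh ht hp htp hZ

end RegE

namespace RegE

universe u

variable {A : Type u} {ρ : A → WProblem}

/-- Every position has its own advancing map, which presupposes a code for all smaller states. The
recursion theorem supplies that code for the finite dispatch over all positions. -/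
theorem exists_solver {cx : RegE A → ℕ} {rk : RegE A × Baire → Ordinal.{u}}
    {U : Set (RegE A)} {Z : Set (PSimPos A)} {rank : PSimPos A → ℕ}
    (hrk : ∀ p q, p.2 ∈ (p.1.interp ρ).dom → Unfolds ρ q p → rk q < rk p)
    (hcx : Set.InjOn cx U) (hZU : ∀ u ∈ Z, ∀ t ∈ u.hyps, t ∈ U)
    (hρ : ∀ a, (ρ a).IsPointed) (hP : (psimGame A).Progress Z rank) (hZ : Z.Finite)
    (hX : ∀ u ∈ Z, PSimPos.Tame u.hyps ∧ u.goal.TopZeroFree) :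
    ∃ (r : Baire) (idx : PSimPos A → ℕ), Computable r ∧ ∀ S, ∀ u ∈ Z, ∀ s, Valid ρ cx S u.hyps s →
      ∃ o ∈ (capp r (idx u, s) : Part (Baire × Baire)), Solves ρ S u.goal o := by
  classical
  obtain ⟨idx, hidx⟩ := Set.countable_iff_exists_injOn.1 hZ.countable
  obtain ⟨N, hN⟩ := (hZ.image idx).bddAbove
  have hF : ∀ i, ∃ F : Baire × Baire → Part (Baire × Baire), Rz F ∧
      ∀ u ∈ Z, idx u = i → Advances ρ rk cx idx Z rank u F := by
    intro i
    by_cases hi : ∃ u ∈ Z, idx u = i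
    · obtain ⟨u, hu, rfl⟩ := hi
      obtain ⟨F, hF, hF'⟩ := exists_advances (idx := idx) hrk hcx hZU hρ hP (hX u hu).1
        (hX u hu).2 hu
      refine ⟨F, hF, fun v hv hvu => ?_⟩
      rwa [hidx hv hu hvu]
    · exact ⟨_, Rt.id, fun u hu h => absurd ⟨u, hu, h⟩ hi⟩
  choose F hF hF' using hF
  obtain ⟨r, hr, hr'⟩ := Rz.exists_fix (α := ℕ × Baire) (β := Baire × Baire)
    (F := fun r x => if x.1 < N + 1 then F x.1 (r, x.2) else Part.none)
    ((Rz.dispatch (F := F) (N + 1) fun i _ => hF i).comp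
      (f := fun x : Baire × ℕ × Baire => (x.2.1, x.1, x.2.2)) (by fun_prop))
  refine ⟨r, idx, hr, fun S => ?_⟩
  -- Lexicographic induction: the Dershowitz–Manna order on weights first, then the rank of the
  -- position.
  have key : ∀ (m : Multiset Ordinal.{u}) (k : ℕ), ∀ u ∈ Z, ∀ s, weight rk cx u.hyps s = m →
      rank u = k → Valid ρ cx S u.hyps s →
      ∃ o ∈ (capp r (idx u, s) : Part (Baire × Baire)), Solves ρ S u.goal o := by
    intro m
    refine (Multiset.wellFounded_isDershowitzMannaLT (α := Ordinal.{u})).induction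
      (C := fun m => ∀ k : ℕ, ∀ u ∈ Z, ∀ s, weight rk cx u.hyps s = m → rank u = k →
        Valid ρ cx S u.hyps s → ∃ o ∈ (capp r (idx u, s) : Part (Baire × Baire)),
          Solves ρ S u.goal o) m fun m ihm => ?_
    intro k
    induction k using Nat.strong_induction_on with
    | _ k ihk =>
    rintro u hu s rfl rfl hs
    obtain ⟨o, ho, ho'⟩ := hF' (idx u) u hu rfl r S s hs fun u' hu' s' hs' hb => by
      rcases hb with hb | ⟨hb, hb'⟩
      · exact ihm _ hb _ u' hu' s' rfl rfl hs'
      · exact ihk _ hb' u' hu' s' hb rfl hs'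
    refine ⟨o, hr' _ _ ?_, ho'⟩
    have : idx u < N + 1 := Nat.lt_succ_of_le (hN ⟨u, hu, rfl⟩)
    simpa [this] using ho
  exact fun u hu s hs => key _ _ u hu s rfl rfl hs

/-- Both halves of the reduction come from one run of the solver: the forward map outputs the
constructed instance, and the backward map repeats the run and applies the resulting code. -/
theorem pointedValid_of_duplicatorWins {e f : RegE A} (he : e.TopZeroFree) (hf : f.TopZeroFree)
    (h : (psimGame A).DuplicatorWins ⟨{e}, f⟩) : PointedValid e f := by
  classical
  intro ρ hρ
  obtain ⟨Z₀, rank, hv, hP₀⟩ := h.exists_progress PSimPos.win_spoiler PSimPos.finite_moves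
  obtain ⟨W, hW, hvW, hWm⟩ := PSimPos.exists_finite_closed_positions {e} f
  let T : Set (PSimPos A) := {u | PSimPos.Tame u.hyps ∧ u.goal.TopZeroFree}
  let Z := Z₀ ∩ (W ∩ T)
  have hP : (psimGame A).Progress Z rank :=
    hP₀.inter fun u hu m hm => ⟨hWm u hu.1 m hm, PSimPos.tame_of_move hu.2.1 hu.2.2 hm⟩
  have hvZ : (⟨{e}, f⟩ : PSimPos A) ∈ Z :=
    ⟨hv, hvW, fun t ht => by rwa [Finset.mem_singleton.1 ht], hf⟩
  have hZ : Z.Finite := hW.subset fun u hu => hu.2.1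
  obtain ⟨cx, hcx⟩ := Set.countable_iff_exists_injOn.1 
    (hZ.biUnion fun u _ => u.hyps.finite_toSet).countable
  obtain ⟨rk, hrk⟩ := exists_unfolding_rank ρ
  obtain ⟨r, idx, hr, hsol⟩ := exists_solver hrk hcx
    (fun u hu t ht => Set.mem_biUnion hu ht) (fun a => (hρ a).2) hP hZ (fun u hu => hu.2.2)
  obtain ⟨c, hc, hc'⟩ := Rz.exists_code (α := Baire) (β := Baire) Rt.id
  have hcR : Rt fun _ : Baire => c := Rt.const hc
  have hrR : Rt fun _ : Baire => r := Rt.const hr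
  -- The initial store holds the given instance under `e`; the code `c` of the identity sends its
  -- solutions to themselves.
  let st : Baire → ℕ × Baire := fun u => (idx ⟨{e}, f⟩, store (cx e) pt (u, c))
  have hst : Rt st := by unfold st; fun_prop
  obtain ⟨φ, hφ, hφ'⟩ := Rz.exists_code (α := Baire) (β := Baire)
    (F := fun u => (capp r (st u) : Part (Baire × Baire)).map fun o => o.1)
    (Rz.ap_map hrR hst (by fun_prop))
  have hrR' : Rt fun _ : Baire × Baire => r := Rt.const hr
  obtain ⟨ψ, hψ, hψ'⟩ := Rz.exists_code (α := Baire × Baire) (β := Baire)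
    (F := fun x => (capp r (st x.1) : Part (Baire × Baire)).bind fun o =>
      (capp o.2 x.2 : Part Baire))
    (Rz.bind (Rz.ap_total hrR' (by fun_prop)) (Rz.ap_total (by fun_prop) (by fun_prop)))
  refine ⟨φ, ψ, hφ, hψ, fun u hu => ?_⟩
  obtain ⟨o, ho, ho1, ho2⟩ := hsol ((e.interp ρ).sol u) _ hvZ (st u).2 (by
    intro t ht
    obtain rfl := Finset.mem_singleton.1 ht
    simp only [st, load_store_self]
    exact ⟨hu, fun y hy => ⟨y, hy, hc' y y (Part.mem_some _)⟩⟩)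
  refine ⟨o.1, ho1, mem_capp.1 (hφ' u o.1 ((Part.mem_map_iff _).2 ⟨o, ho, rfl⟩)), fun y hy => ?_⟩
  obtain ⟨z, hz, hz'⟩ := ho2 y hy
  exact ⟨z, hz, mem_capp.1 (hψ' (u, y) z (Part.mem_bind_iff.2 ⟨o, ho, hz'⟩))⟩

end RegE

/-! ### Generic points and relative computability -/

namespace Baire

/-- The restriction of `p` to the columns in `K`. -/
def restrict (K : Finset ℕ) (p : Baire) : Baire := fun n => if n.unpair.1 ∈ K then p n else 0

theorem restrict_insert (k : ℕ) (K : Finset ℕ) (p : Baire) :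
    restrict (insert k K) p = upd k (restrict K p) (col k p) := by
  funext n
  by_cases h : n.unpair.1 = k
  · subst h
    simp [restrict, upd, col]
  · simp [restrict, upd, h]

theorem restrict_restrict {K K' : Finset ℕ} (h : K ⊆ K') (p : Baire) :
    restrict K (restrict K' p) = restrict K p := by
  funext n
  by_cases hn : n.unpair.1 ∈ K
  · simp [restrict, hn, h hn]
  · simp [restrict, hn]

theorem col_restrict {K : Finset ℕ} {k : ℕ} (h : k ∈ K) (p : Baire) :
    col k (restrict K p) = col k p := by
  funext n
  simp [restrict, col, h]

end Baire

@[fun_prop]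
theorem Rt.restrict {α : Type} [Coded α] (K : Finset ℕ) {f : α → Baire} (hf : Rt f) :
    Rt fun a => Baire.restrict K (f a) := by
  refine Rt.comp (f := Baire.restrict K) ?_ hf
  induction K using Finset.induction_on with
  | empty => exact Rt.pt
  | insert k K _ ih =>
    rw [funext (restrict_insert k K)]
    fun_prop

namespace Baire

theorem prefixOf_eq_of_agree {p q : Baire} {m : ℕ} (h : ∀ i < m, p i = q i) :
    prefixOf p m = prefixOf q m :=
  List.map_congr_left fun i hi => h i (List.mem_range.1 hi)

/-- No column of `p` can be computed from finitely many other columns. -/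
def Generic (p : Baire) : Prop :=
  ∀ (c : Baire) (K : Finset ℕ) (i : ℕ), Computable c → i ∉ K → ¬ App c (restrict K p) (col i p)

/-- Baire category: for each of the countably many triples of a computable code, a finite set of
columns and a further column, the points where the code succeeds form a nowhere dense set. -/
theorem exists_generic : ∃ p, Generic p := by
  let N : {c : Baire // Computable c} × Finset ℕ × ℕ → Set Baire := fun x =>
    {p | App x.1.1 (restrict x.2.1 p) (col x.2.2 p) ∧ x.2.2 ∉ x.2.1}
  have hd : ∀ x, Dense (interior (N x)ᶜ) := by
    rintro ⟨⟨c, hc⟩, K, i⟩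
    refine (PiNat.isTopologicalBasis_cylinders (E := fun _ => ℕ)).dense_iff.2 ?_
    rintro _ ⟨p, l, rfl⟩ -
    by_cases h : ∃ q ∈ PiNat.cylinder (E := fun _ => ℕ) p l, q ∈ N ⟨⟨c, hc⟩, K, i⟩
    · obtain ⟨q, hq, hqN, hi⟩ := h
      -- One entry of column `i` is altered. Its index is at least `l`, so `q'` stays in the given
      -- cylinder, and the columns in `K` are untouched.
      let q' : Baire := fun n => if n = Nat.pair i l then q n + 1 else q n
      have hle : l ≤ Nat.pair i l := Nat.right_le_pair i l
      have hq' : ∀ n, n.unpair.1 ≠ i → q' n = q n := fun n hn => by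
        refine if_neg ?_
        rintro rfl
        simp at hn
      have hr : restrict K q' = restrict K q := by
        funext n
        by_cases hn : n.unpair.1 ∈ K
        · simp only [restrict, hn, if_true]
          exact hq' n fun h => hi (h ▸ hn)
        · simp [restrict, hn]
      -- The code finds its `l`-th value after reading `m` entries of the restriction. On all points
      -- close enough to `q'` it therefore gives the old value, which is now wrong.
      obtain ⟨m, hm, hm'⟩ := hqN l
      refine ⟨q', fun j hj => ?_, mem_interior.2 ⟨PiNat.cylinder (E := fun _ => ℕ) q'
        (max m (Nat.pair i l + 1)), fun r hr' hrN => ?_, PiNat.isOpen_cylinder _ _ _,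
        PiNat.self_mem_cylinder _ _⟩⟩
      · rw [← hq j hj]
        exact if_neg (by omega)
      · obtain ⟨m', h1, h2⟩ := hrN.1 l
        have hpre : ∀ j ≤ m, prefixOf (restrict K r) j = prefixOf (restrict K q) j := by
          intro j hj
          rw [← hr]
          refine prefixOf_eq_of_agree fun n hn => ?_
          simp only [restrict, hr' n (by omega)]
        have hval : col i r l = col i q l + 1 := by
          change r _ = _
          rw [hr' _ (by omega)]
          simp [q', col]
        rcases lt_trichotomy m m' with h | h | h
        · have := h1 m h
          rw [hpre m le_rfl] at this
          exact absurd (hm'.symm.trans this) (Nat.succ_ne_zero _)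
        · subst h
          rw [hpre m le_rfl] at h2
          simp only at hm' h2
          omega
        · have := hm m' h
          rw [hpre m' h.le] at h2
          simp only at this h2
          omega
    · push Not at h
      exact ⟨p, PiNat.self_mem_cylinder _ _, mem_interior.2 ⟨_, h, PiNat.isOpen_cylinder _ _ _,
        PiNat.self_mem_cylinder _ _⟩⟩
  obtain ⟨p, hp⟩ := (dense_iInter_of_isOpen (fun x => isOpen_interior) hd).nonempty
  refine ⟨p, fun c K i hc hi h => ?_⟩
  exact interior_subset (Set.mem_iInter.1 hp ⟨⟨c, hc⟩, K, i⟩) ⟨h, hi⟩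

variable {α β : Type} [Coded α] [Coded β] {p : Baire} {K : Finset ℕ}

/-- `a` can be computed from the columns of `p` in `K`. -/
def Computes (p : Baire) (K : Finset ℕ) (a : α) : Prop :=
  ∃ c : Baire, Computable c ∧ a ∈ (capp c (restrict K p) : Part α)

theorem Computes.bind {F : α → Part β} (hF : Rz F) {a : α} {b : β} (ha : Computes p K a)
    (hb : b ∈ F a) : Computes p K b := by
  obtain ⟨c, hc, h⟩ := ha
  have hc' : Rt fun _ : Baire => c := Rt.const hc
  obtain ⟨d, hd, h'⟩ := Rz.exists_code (F := fun s : Baire => (capp c s : Part α).bind F)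
    (Rz.bind (Rz.ap_total hc' Rt.id) (hF.comp Rt.snd))
  exact ⟨d, hd, h' _ _ (Part.mem_bind_iff.2 ⟨a, h, hb⟩)⟩

theorem Computes.map {f : α → β} (hf : Rt f) {a : α} (ha : Computes p K a) :
    Computes p K (f a) := ha.bind hf (Part.mem_some _)

theorem Computes.pair {a : α} {b : β} (ha : Computes p K a) (hb : Computes p K b) :
    Computes p K (a, b) := by
  obtain ⟨c, hc, h⟩ := ha
  obtain ⟨d, hd, h'⟩ := hb
  have hc' : Rt fun _ : Baire => c := Rt.const hc
  have hd' : Rt fun _ : Baire => d := Rt.const hd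
  obtain ⟨e, he, h''⟩ := Rz.exists_code (Rz.pair (Rz.ap_total (γ := α) hc' Rt.id)
    (Rz.ap_total (γ := β) hd' Rt.id))
  exact ⟨e, he, h'' _ _ (Part.mem_bind_iff.2 ⟨a, h, (Part.mem_map_iff _).2 ⟨b, h', rfl⟩⟩)⟩

theorem Computes.of_computable {a : α} (ha : Computable (Coded.code a)) : Computes p K a := by
  obtain ⟨c, hc, h⟩ := Rz.exists_code (α := Baire) (Rt.const (α := Baire) ha)
  exact ⟨c, hc, h _ _ (Part.mem_some _)⟩

theorem Computes.capp {c : Baire} {a : α} {b : β} (hc : Computes p K c) (ha : Computes p K a)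
    (h : b ∈ (capp c a : Part β)) : Computes p K b :=
  (hc.pair ha).bind (F := fun x : Baire × α => (_root_.capp x.1 x.2 : Part β))
    (Rz.ap_total Rt.fst Rt.snd) h

theorem Computes.mono {K' : Finset ℕ} (h : K ⊆ K') {a : α} (ha : Computes p K a) :
    Computes p K' a := by
  have h' : Computes p K' (restrict K p) := by
    obtain ⟨c, hc, hc'⟩ := Rz.exists_code (F := fun s : Baire => Part.some (restrict K s))
      (Rt.restrict K Rt.id)
    refine ⟨c, hc, hc' _ _ ?_⟩
    rw [restrict_restrict h]
    exact Part.mem_some _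
  obtain ⟨c, hc, hca⟩ := ha
  exact (Computes.of_computable hc).capp h' hca

theorem Computes.col {k : ℕ} (hk : k ∈ K) : Computes p K (col k p) := by
  obtain ⟨c, hc, hc'⟩ := Rz.exists_code (F := fun s : Baire => Part.some (Baire.col k s))
    (Rt.col k Rt.id)
  refine ⟨c, hc, hc' _ _ ?_⟩
  rw [col_restrict hk]
  exact Part.mem_some _

/-- The form in which genericity is used: whoever can compute a column has been shown it. -/
theorem Generic.mem (hp : Generic p) {k : ℕ} (h : Computes p K (Baire.col k p)) : k ∈ K := by
  obtain ⟨c, hc, h⟩ := h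
  by_contra hk
  exact hp c K k hc hk (mem_capp.1 h)

theorem Generic.col_injective (hp : Generic p) : Function.Injective fun k => Baire.col k p := by
  intro k l h
  have h' : Computes p {l} (Baire.col l p) := .col (Finset.mem_singleton_self l)
  have h : Baire.col k p = Baire.col l p := h
  rw [← h] at h'
  exact Finset.mem_singleton.1 (hp.mem h')

end Baire

/-! ### Countability of terms and descriptions -/

namespace RegE

/-- Codes of expressions. -/
def encodeWith {A : Type*} (k : A → ℕ) : RegE A → ℕ
  | var a => Nat.pair 0 (k a)
  | zero => Nat.pair 1 0
  | join e f => Nat.pair 2 (Nat.pair (e.encodeWith k) (f.encodeWith k))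
  | top => Nat.pair 3 0
  | meet e f => Nat.pair 4 (Nat.pair (e.encodeWith k) (f.encodeWith k))
  | one => Nat.pair 5 0
  | comp e f => Nat.pair 6 (Nat.pair (e.encodeWith k) (f.encodeWith k))
  | iter e => Nat.pair 7 (e.encodeWith k)

instance {A : Type*} [Countable A] : Countable (RegE A) := by
  obtain ⟨k, hk⟩ := Countable.exists_injective_nat A
  refine Function.Injective.countable (f := encodeWith k) fun s => ?_
  induction s with
  | var a => rintro (_ | _) h <;> simp_all [encodeWith, Nat.pair_eq_pair, hk.eq_iff]
  | zero | top | one => rintro (_ | _) h <;> simp_all [encodeWith, Nat.pair_eq_pair]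
  | join e f ihe ihf | meet e f ihe ihf | comp e f ihe ihf =>
    rintro (_ | _) h <;> simp only [encodeWith, Nat.pair_eq_pair] at h <;>
      first | omega | skip
    rw [@ihe _ h.2.1, @ihf _ h.2.2]
  | iter e ih =>
    rintro (_ | _) h <;> simp only [encodeWith, Nat.pair_eq_pair] at h <;>
      first | omega | skip
    rw [@ih _ h.2]

/-- Descriptions of the instances that Spoiler uses. -/
inductive Desc where
  | one : Desc
  | leaf (i : ℕ) : Desc
  | ex (b : Bool) (d : Desc) : Desc
  | all (d₀ d₁ : Desc) : Desc

namespace Desc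

/-- Codes of descriptions. -/
def encode : Desc → ℕ
  | one => Nat.pair 0 0
  | leaf i => Nat.pair 1 i
  | ex b d => Nat.pair 2 (Nat.pair b.toNat d.encode)
  | all d₀ d₁ => Nat.pair 3 (Nat.pair d₀.encode d₁.encode)

instance : Countable Desc := by
  refine Function.Injective.countable (f := encode) fun s => ?_
  induction s with
  | one => rintro (_ | _) h <;> simp_all [encode, Nat.pair_eq_pair]
  | leaf i => rintro (_ | _) h <;> simp_all [encode, Nat.pair_eq_pair]
  | ex b d ih =>
    rintro (_ | _) h <;> simp only [encode, Nat.pair_eq_pair] at h <;> first | omega | skip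
    rw [@ih _ h.2.2, Coded.code_inj (α := Bool) (funext fun _ => h.2.1)]
  | all d₀ d₁ ih₀ ih₁ =>
    rintro (_ | _) h <;> simp only [encode, Nat.pair_eq_pair] at h <;> first | omega | skip
    rw [@ih₀ _ h.2.1, @ih₁ _ h.2.2]

end Desc

variable {A : Type*}

/-! ### Instances built from transitions -/

/-- Every letter is queried at `pt`, joins go left and iterations stop at once; the instance thus
works for all valuations with `pt` in their domains. -/
theorem exists_computable_instance {t : RegE A} (ht : t.TopZeroFree) :
    ∃ w, Computable w ∧ ∀ ρ : A → WProblem, (∀ a, pt ∈ (ρ a).dom) → w ∈ (t.interp ρ).dom := by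
  induction t with
  | zero => exact ht.elim
  | top => exact ht.elim
  | one => exact ⟨pt, computable_pt, fun _ _ => rfl⟩
  | var a => exact ⟨pt, computable_pt, fun _ h => h a⟩
  | join e f ihe _ =>
    obtain ⟨w, hw, h⟩ := ihe ht.1
    exact ⟨inb false w, (Rt.inb (Rt.bool false) Rt.id).computable hw,
      fun ρ hρ => Or.inl ⟨w, h ρ hρ, rfl⟩⟩
  | meet e f ihe ihf =>
    obtain ⟨w, hw, h⟩ := ihe ht.1
    obtain ⟨w', hw', h'⟩ := ihf ht.2
    exact ⟨pair w w', (Rt.baire_pair Rt.id (Rt.const hw')).computable hw,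
      fun ρ hρ => ⟨w, h ρ hρ, w', h' ρ hρ, rfl⟩⟩
  | comp e f ihe ihf =>
    obtain ⟨w, hw, h⟩ := ihe ht.1
    obtain ⟨w', hw', h'⟩ := ihf ht.2
    obtain ⟨K, hK, hK'⟩ := exists_const_code (α := Baire) (β := Baire)
    exact ⟨pair w' (K w), (Rt.baire_pair (Rt.const hw') hK).computable hw,
      fun ρ hρ => ⟨w', h' ρ hρ, K w, rfl, fun x _ => ⟨w, h ρ hρ, mem_capp.1 (hK' w x)⟩⟩⟩
  | iter e =>
    exact ⟨inb false pt, (Rt.inb (Rt.bool false) Rt.id).computable computable_pt,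
      fun _ _ => .done⟩

open Classical in
/-- A recursive instance of `t`. -/
noncomputable def triv (t : RegE A) : Baire :=
  if h : t.TopZeroFree then (exists_computable_instance h).choose else pt

theorem computable_triv (t : RegE A) : Computable (triv t) := by
  rw [triv]
  split_ifs with h
  · exact (exists_computable_instance h).choose_spec.1
  · exact computable_pt

theorem triv_mem_dom {t : RegE A} (ht : t.TopZeroFree) {ρ : A → WProblem}
    (hρ : ∀ a, pt ∈ (ρ a).dom) : triv t ∈ (t.interp ρ).dom := by
  rw [triv, dif_pos ht]
  exact (exists_computable_instance ht).choose_spec.2 ρ hρ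

open Classical in
/-- The instance of `t` whose first transition is described by `q` and `κ`. -/
noncomputable def construct (t : RegE A) (q κ : Baire) : Baire :=
  if h : t.TopZeroFree ∧ t ≠ one then
    if h' : ((exists_constructor h.1 h.2).choose (q, κ)).Dom then
      (((exists_constructor h.1 h.2).choose (q, κ)).get h').1
    else pt
  else pt

/-- Besides the instance, its query and continuation also compute the splitting code `γ`, so a
solution reveals an answer to the query without additional columns. -/
theorem exists_constructs {ρ : A → WProblem} {t : RegE A} (ht : t.TopZeroFree) (h1 : t ≠ one)
    {q κ : Baire} (h : Queries ρ t q κ) : ∃ γ, Constructs ρ t q κ (construct t q κ) γ ∧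
      ∀ p K, Computes p K q → Computes p K κ →
        Computes p K (construct t q κ) ∧ Computes p K γ := by
  have h' : t.TopZeroFree ∧ t ≠ one := ⟨ht, h1⟩
  obtain ⟨hC, hC'⟩ := (exists_constructor h'.1 h'.2).choose_spec
  obtain ⟨w, γ, hwγ, hw⟩ := hC' ρ q κ h
  have hd : ((exists_constructor h'.1 h'.2).choose (q, κ)).Dom := Part.dom_iff_mem.2 ⟨_, hwγ⟩
  have hc : construct t q κ = w := by
    rw [construct, dif_pos h', dif_pos hd, Part.get_eq_of_mem hwγ hd]
  rw [hc]
  refine ⟨γ, hw, fun p K hq hκ => ?_⟩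
  have := (hq.pair hκ).bind hC hwγ
  exact ⟨this.map Rt.fst, this.map Rt.snd⟩

/-- The code of the map that reads an instance from an answer. -/
noncomputable def answerCode : Baire :=
  (exists_fun_code (f := fun x : Baire => (false, Baire.snd x)) (by fun_prop)).choose

theorem computable_answerCode : Computable answerCode :=
  (exists_fun_code (f := fun x : Baire => (false, Baire.snd x)) (by fun_prop)).choose_spec.1

theorem mem_capp_answerCode (x : Baire) :
    (false, Baire.snd x) ∈ (capp answerCode x : Part (Bool × Baire)) :=
  (exists_fun_code (f := fun x : Baire => (false, Baire.snd x)) (by fun_prop)).choose_spec.2 x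

/-- The code of a constant map. -/
noncomputable def constCode : Bool × Baire → Baire :=
  (exists_const_code (α := Baire) (β := Bool × Baire)).choose

theorem rt_constCode : Rt constCode :=
  (exists_const_code (α := Baire) (β := Bool × Baire)).choose_spec.1

theorem mem_capp_constCode (y : Bool × Baire) (x : Baire) :
    y ∈ (capp (constCode y) x : Part (Bool × Baire)) :=
  (exists_const_code (α := Baire) (β := Bool × Baire)).choose_spec.2 y x

theorem exists_tag_code : ∃ K : Baire × Baire → Baire, Rt K ∧ ∀ (y : Baire × Baire) (x : Baire),
    (tag x, bif tag x then y.2 else y.1) ∈ (capp (K y) x : Part (Bool × Baire)) := by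
  obtain ⟨K, hK, h⟩ := Rz.curry (α := Baire × Baire) (β := Baire)
    (F := fun y x => Part.some (tag x, bif tag x then y.2 else y.1))
    (by fun_prop : Rt fun x : (Baire × Baire) × Baire =>
      (tag x.2, bif tag x.2 then x.1.2 else x.1.1))
  exact ⟨K, hK, fun y x => h y x _ (Part.mem_some _)⟩

/-- The code of the map that selects an instance by the tag of the answer. -/
noncomputable def tagCode : Baire × Baire → Baire := exists_tag_code.choose

theorem rt_tagCode : Rt tagCode := exists_tag_code.choose_spec.1

theorem mem_capp_tagCode (y : Baire × Baire) (x : Baire) :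
    (tag x, bif tag x then y.2 else y.1) ∈ (capp (tagCode y) x : Part (Bool × Baire)) :=
  exists_tag_code.choose_spec.2 y x

/-! ### The valuation -/

/-- The query of rank `r` for the name `x`. -/
def query (r : ℕ) (x : Baire) : Baire := Coded.code (r, x)

theorem query_inj {r r' : ℕ} {x x' : Baire} (h : query r x = query r' x') : r = r' ∧ x = x' :=
  Prod.mk.inj (Coded.code_inj (α := ℕ × Baire) h)

theorem snd_query (r : ℕ) (x : Baire) : Baire.snd (query r x) = x := snd_pair _ _

theorem rt_query (r : ℕ) : Rt (query r) := by
  have h : Rt fun y : ℕ × Baire => Coded.code y := Rt.of_reindex (ι := id) Computable.id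
    fun _ _ => rfl
  exact h.comp (Rt.pair (Rt.nat r) Rt.id)

/-- Names and passwords, taken from a generic point. -/
structure Cipher (A : Type*) where
  point : Baire
  generic : Generic point
  index : (RegE A × ℕ) ⊕ (RegE A × ℕ × Desc) → ℕ
  index_inj : Function.Injective index

theorem nonempty_cipher [Countable A] : Nonempty (Cipher A) := by
  obtain ⟨p, hp⟩ := exists_generic
  obtain ⟨k, hk⟩ := Countable.exists_injective_nat ((RegE A × ℕ) ⊕ (RegE A × ℕ × Desc))
  exact ⟨⟨p, hp, k, hk⟩⟩

namespace Cipher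

variable (O : Cipher A)

/-- The name of the `i`-th query at `t`. -/
def name (t : RegE A) (i : ℕ) : Baire := Baire.col (O.index (.inl (t, i))) O.point

/-- The password that comes with the answer `d` to the `i`-th query at `t`. -/
def password (t : RegE A) (i : ℕ) (d : Desc) : Baire :=
  Baire.col (O.index (.inr (t, i, d))) O.point

open Classical in
/-- The instance of rank `r` with a given description. -/
noncomputable def inst (r : ℕ) : RegE A → Desc → Baire
  | t, .one => triv t
  | t, .leaf i =>
    if ∃ a, t.pol = .letter a then construct t (query r (O.name t i)) answerCode else triv t
  | t, .ex b d =>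
    if t ≠ one ∧ t.pol = .ex then construct t pt (constCode (b, inst r (t.nxt b) d)) else triv t
  | t, .all d₀ d₁ =>
    if t.pol = .all then
      construct t (pair pt pt) (tagCode (inst r (t.nxt false) d₀, inst r (t.nxt true) d₁))
    else triv t

/-- The instance in the answer `d` to a query of rank `r` at `t`. -/
noncomputable def answer (t : RegE A) (d : Desc) : ℕ → Baire
  | 0 => triv (t.nxt false)
  | r + 1 => O.inst r (t.nxt false) d

/-- Spoiler's valuation. -/
noncomputable def val (a : A) : WProblem where
  dom := {u | u = pt ∨ ∃ r t i, t.TopZeroFree ∧ t.pol = .letter a ∧ u = query r (O.name t i)}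
  sol u := {x | (u = pt ∧ x = pt) ∨
    ∃ r t i d, u = query r (O.name t i) ∧ x = pair (O.password t i d) (O.answer t d r)}

variable {O}

theorem name_inj {t t' : RegE A} {i i' : ℕ} (h : O.name t i = O.name t' i') :
    t = t' ∧ i = i' := by
  have := O.index_inj (O.generic.col_injective h)
  simpa using this

/-- A recursive point is computable from no columns at all, whereas a name is not. -/
theorem name_ne_pt (t : RegE A) (i : ℕ) : O.name t i ≠ pt := by
  intro h
  have h' : Computes O.point ∅ pt := .of_computable computable_pt
  rw [← h] at h'
  exact absurd (O.generic.mem h') (Finset.notMem_empty _)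

theorem query_ne_pt (r : ℕ) (t : RegE A) (i : ℕ) : query r (O.name t i) ≠ pt := by
  intro h
  have h' : Baire.snd (query r (O.name t i)) = Baire.snd pt := by rw [h]
  rw [snd_query] at h'
  exact name_ne_pt t i h'

theorem mem_sol_pt {a : A} {x : Baire} : x ∈ (O.val a).sol pt ↔ x = pt := by
  constructor
  · rintro (⟨-, rfl⟩ | ⟨r, t, i, d, h, -⟩)
    · rfl
    · exact absurd h.symm (query_ne_pt r t i)
  · rintro rfl
    exact Or.inl ⟨rfl, rfl⟩

theorem mem_sol_query {a : A} {r : ℕ} {t : RegE A} {i : ℕ} {x : Baire} :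
    x ∈ (O.val a).sol (query r (O.name t i)) ↔
      ∃ d, x = pair (O.password t i d) (O.answer t d r) := by
  constructor
  · rintro (⟨h, -⟩ | ⟨r', t', i', d, h, rfl⟩)
    · exact absurd h (query_ne_pt r t i)
    · obtain ⟨rfl, h'⟩ := query_inj h
      obtain ⟨rfl, rfl⟩ := name_inj h'
      exact ⟨d, rfl⟩
  · rintro ⟨d, rfl⟩
    exact Or.inr ⟨r, t, i, d, rfl, rfl⟩

theorem pt_mem_dom (a : A) : pt ∈ (O.val a).dom := Or.inl rfl

theorem queries_leaf {t : RegE A} {a : A} (ht : t.TopZeroFree) (hp : t.pol = .letter a) {r : ℕ}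
    (h : ∀ d, O.answer t d r ∈ ((t.nxt false).interp O.val).dom) (i : ℕ) :
    Queries O.val t (query r (O.name t i)) answerCode := by
  rw [Queries, head_of_letter hp]
  refine ⟨Or.inr ⟨r, t, i, ht, hp, rfl⟩, fun x hx => ?_⟩
  obtain ⟨d, rfl⟩ := mem_sol_query.1 hx
  refine ⟨false, _, mem_capp_answerCode _, fun h => ?_, by simpa using h d⟩
  rw [hp] at h; cases h

theorem queries_ex {ρ : A → WProblem} {t : RegE A} (hp : t.pol = .ex) {b : Bool} {w : Baire}
    (hw : w ∈ ((t.nxt b).interp ρ).dom) : Queries ρ t pt (constCode (b, w)) := by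
  rw [Queries, head_dom_of_ex hp]
  refine ⟨rfl, fun x _ => ⟨b, w, mem_capp_constCode _ _, fun h => ?_, hw⟩⟩
  rw [hp] at h; cases h

theorem queries_all {ρ : A → WProblem} {t : RegE A} (hp : t.pol = .all) {w₀ w₁ : Baire}
    (h₀ : w₀ ∈ ((t.nxt false).interp ρ).dom) (h₁ : w₁ ∈ ((t.nxt true).interp ρ).dom) :
    Queries ρ t (pair pt pt) (tagCode (w₀, w₁)) := by
  rw [Queries, head_of_all hp]
  refine ⟨⟨pt, rfl, pt, rfl, rfl⟩, fun x _ => ⟨_, _, mem_capp_tagCode _ _, fun _ => rfl, ?_⟩⟩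
  cases tag x
  · exact h₀
  · exact h₁

/-- Answers carry arbitrary descriptions, so descriptions alone would not make an interaction
terminate. The rank does, as it falls with every answer: outer induction on `r`, inner induction on
`d`. -/
theorem inst_mem_dom (r : ℕ) {t : RegE A} (ht : t.TopZeroFree) (d : Desc) :
    O.inst r t d ∈ (t.interp O.val).dom := by
  induction r using Nat.strong_induction_on generalizing t d with
  | _ r ihr =>
  have htriv : ∀ {t : RegE A}, t.TopZeroFree → triv t ∈ (t.interp O.val).dom :=
    fun ht => triv_mem_dom ht pt_mem_dom
  induction d generalizing t with
  | one => rw [inst]; exact htriv ht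
  | leaf i =>
    rw [inst]
    split_ifs with h
    · obtain ⟨a, ha⟩ := h
      refine (exists_constructs ht (PSimPos.ne_one_of_letter ha)
        (queries_leaf ht ha (fun d => ?_) i)).choose_spec.1.1
      cases r with
      | zero => exact htriv (ht.nxt false)
      | succ r => exact ihr r (Nat.lt_succ_self r) (ht.nxt false) d
    · exact htriv ht
  | ex b d ih =>
    rw [inst]
    split_ifs with h
    · exact (exists_constructs ht h.1 (queries_ex h.2 (ih (ht.nxt b)))).choose_spec.1.1
    · exact htriv ht
  | all d₀ d₁ ih₀ ih₁ =>
    rw [inst]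
    split_ifs with h
    · exact (exists_constructs ht (PSimPos.ne_one_of_all h)
        (queries_all h (ih₀ (ht.nxt false)) (ih₁ (ht.nxt true)))).choose_spec.1.1
    · exact htriv ht

theorem answer_mem_dom {t : RegE A} (ht : t.TopZeroFree) (d : Desc) (r : ℕ) :
    O.answer t d r ∈ ((t.nxt false).interp O.val).dom := by
  cases r with
  | zero => exact triv_mem_dom (ht.nxt false) pt_mem_dom
  | succ r => exact inst_mem_dom r (ht.nxt false) d

theorem val_isOrdinary (a : A) : (O.val a).IsOrdinary := by
  rintro u (rfl | ⟨r, t, i, ht, hp, rfl⟩)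
  · exact ⟨pt, mem_sol_pt.2 rfl⟩
  · exact ⟨_, mem_sol_query.2 ⟨.one, rfl⟩⟩

theorem val_isPointed (a : A) : (O.val a).IsPointed := ⟨pt, pt_mem_dom a, computable_pt⟩

end Cipher

end RegE

/-! ### Resolving pending hypotheses -/

namespace RegE

variable {A : Type*}

/-- After a letter only `1` remains on the right, so the successor is `1` itself or is pending. This
is what makes filling lower the layer whenever an answer matters. -/
theorem pol_nxt_of_letter {t : RegE A} {a : A} (h : t.pol = .letter a) :
    (t.nxt false).pol = .ex := by
  induction t with
  | var => rfl
  | comp g e _ ih =>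
    by_cases he : e = one
    · subst he; cases h
    · rw [nxt_comp he]
      exact ih h
  | _ => cases h

/-- The description `d` of an instance of an expression has its leaves in `Y`, with the names
given by `ι`. -/
inductive Resolves (Y : Finset (RegE A)) (ι : RegE A → ℕ) : RegE A → Desc → Prop
  | one (h : one ∈ Y) : Resolves Y ι one .one
  | leaf (t : RegE A) (a : A) (hp : t.pol = .letter a) (ht : t ∈ Y) :
      Resolves Y ι t (.leaf (ι t))
  | ex (t : RegE A) (b : Bool) (d : Desc) (h1 : t ≠ one) (hp : t.pol = .ex)
      (h : Resolves Y ι (t.nxt b) d) : Resolves Y ι t (.ex b d)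
  | all (t : RegE A) (d₀ d₁ : Desc) (hp : t.pol = .all) (h₀ : Resolves Y ι (t.nxt false) d₀)
      (h₁ : Resolves Y ι (t.nxt true) d₁) : Resolves Y ι t (.all d₀ d₁)

theorem eq_one_or_letter {X : Finset (RegE A)} (hX : ¬ PSimPos.Pending X) {t : RegE A}
    (ht : t ∈ X) : t = one ∨ ∃ a, t.pol = .letter a := by
  by_contra! h
  refine hX ⟨t, ht, h.1, ?_⟩
  cases hp : t.pol with
  | ex => exact Or.inl rfl
  | all => exact Or.inr rfl
  | letter a => exact absurd hp (h.2 a)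

/-- Spoiler explores and forks until nothing is pending, and the description records the choices.
Each such move descends a layer, so this stops, strictly lower if anything was pending at the start.
-/
theorem exists_resolves {L : ℕ → Set (PSimPos A)} (hL : PSimPos.Layers L) {h : RegE A} {k : ℕ}
    {X : Finset (RegE A)} (hX : PSimPos.Tame X) (hk : (⟨X, h⟩ : PSimPos A) ∈ L k) :
    ∃ Y, ∃ k' ≤ k, (PSimPos.Pending X → k' < k) ∧ (⟨Y, h⟩ : PSimPos A) ∈ L k' ∧
      ¬ PSimPos.Pending Y ∧ PSimPos.Tame Y ∧ ∀ ι, ∀ s ∈ X, ∃ d, Resolves Y ι s d := by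
  induction k generalizing X with
  | zero => rw [hL.zero] at hk; exact hk.elim
  | succ k ih =>
    by_cases hp : PSimPos.Pending X
    · rcases hL.pending k X h hX hk hp with ⟨t, ht, h1, hpt, b, hb⟩ | ⟨t, ht, hpt, hb⟩
      · obtain ⟨Y, k', hk', -, h2, h3, h4, h5⟩ := ih (hX.swap ht b) hb
        refine ⟨Y, k', by omega, fun _ => by omega, h2, h3, h4, fun ι s hs => ?_⟩
        by_cases hst : s = t
        · subst hst
          obtain ⟨d, hd⟩ := h5 ι _ (Finset.mem_swap.2 (Or.inl rfl))
          exact ⟨_, .ex s b d h1 hpt hd⟩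
        · exact h5 ι s (Finset.mem_swap.2 (Or.inr ⟨hst, hs⟩))
      · obtain ⟨Y, k', hk', -, h2, h3, h4, h5⟩ := ih (hX.swapPair ht) hb
        refine ⟨Y, k', by omega, fun _ => by omega, h2, h3, h4, fun ι s hs => ?_⟩
        by_cases hst : s = t
        · subst hst
          obtain ⟨d, hd⟩ := h5 ι _ (Finset.mem_swapPair.2 (Or.inr (Or.inl rfl)))
          obtain ⟨d', hd'⟩ := h5 ι _ (Finset.mem_swapPair.2 (Or.inl rfl))
          exact ⟨_, .all s d d' hpt hd hd'⟩
        · exact h5 ι s (Finset.mem_swapPair.2 (Or.inr (Or.inr ⟨hst, hs⟩)))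
    · refine ⟨X, k + 1, le_rfl, fun h => absurd h hp, hk, hp, hX, fun ι s hs => ?_⟩
      rcases eq_one_or_letter hp hs with rfl | ⟨a, ha⟩
      · exact ⟨_, .one hs⟩
      · exact ⟨_, .leaf s a ha hs⟩

namespace Resolves

variable {X Y : Finset (RegE A)} {ι : RegE A → ℕ} {t : RegE A} {d : Desc}

/-- A settled term is `1` or waits for a letter, so it can only be resolved by being a leaf itself.
-/
theorem mem (hX : ¬ PSimPos.Pending X) (ht : t ∈ X) (h : Resolves Y ι t d) : t ∈ Y := by
  rcases eq_one_or_letter hX ht with rfl | ⟨a, ha⟩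
  · cases h with
    | one h => exact h
    | leaf _ a hp ht => exact ht
    | ex _ b d h1 => exact absurd rfl h1
    | all _ _ _ hp => cases hp
  · cases h with
    | one h => exact h
    | leaf _ _ _ ht => exact ht
    | ex _ b d h1 hp => rw [ha] at hp; cases hp
    | all _ _ _ hp => rw [ha] at hp; cases hp

end Resolves

namespace Cipher

variable {O : Cipher A} {K : Finset ℕ}

theorem name_mem {t : RegE A} {i : ℕ} (h : Computes O.point K (O.name t i)) :
    O.index (.inl (t, i)) ∈ K := O.generic.mem h

theorem password_mem {t : RegE A} {i : ℕ} {d : Desc}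
    (h : Computes O.point K (O.password t i d)) : O.index (.inr (t, i, d)) ∈ K := O.generic.mem h

theorem computes_query {t : RegE A} {i : ℕ} (h : O.index (.inl (t, i)) ∈ K) (r : ℕ) :
    Computes O.point K (query r (O.name t i)) := Computes.map (rt_query r) (Computes.col h)

theorem computes_answerCode : Computes O.point K answerCode := .of_computable computable_answerCode

theorem computes_pt : Computes O.point K pt := .of_computable computable_pt

theorem computes_pair {x y : Baire} (hx : Computes O.point K x) (hy : Computes O.point K y) :
    Computes O.point K (pair x y) :=
  (hx.pair hy).map (f := fun z : Baire × Baire => Baire.pair z.1 z.2) (by fun_prop)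

theorem computes_constCode {b : Bool} {w : Baire} (h : Computes O.point K w) :
    Computes O.point K (constCode (b, w)) :=
  Computes.map rt_constCode (h.map (f := fun w => (b, w)) (by fun_prop))

theorem computes_tagCode {w w' : Baire} (h : Computes O.point K w) (h' : Computes O.point K w') :
    Computes O.point K (tagCode (w, w')) :=
  (h.pair h').map rt_tagCode

theorem inst_leaf {t : RegE A} {a : A} (hp : t.pol = .letter a) (r i : ℕ) :
    O.inst r t (.leaf i) = construct t (query r (O.name t i)) answerCode := by
  rw [inst, if_pos ⟨a, hp⟩]

theorem inst_ex {t : RegE A} (h1 : t ≠ one) (hp : t.pol = .ex) (r : ℕ) (b : Bool) (d : Desc) :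
    O.inst r t (.ex b d) = construct t pt (constCode (b, O.inst r (t.nxt b) d)) := by
  rw [inst, if_pos ⟨h1, hp⟩]

theorem inst_all {t : RegE A} (hp : t.pol = .all) (r : ℕ) (d₀ d₁ : Desc) :
    O.inst r t (.all d₀ d₁) = construct t (pair pt pt)
      (tagCode (O.inst r (t.nxt false) d₀, O.inst r (t.nxt true) d₁)) := by
  rw [inst, if_pos hp]

/-- A solution of an instance built from `q` and `κ` computes an answer to `q` and a solution of
the next instance. -/
theorem exists_answer_of_construct {t : RegE A} (ht : t.TopZeroFree) (h1 : t ≠ one)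
    {q κ : Baire} (h : Queries O.val t q κ) (hq : Computes O.point K q)
    (hκ : Computes O.point K κ) : Computes O.point K (construct t q κ) ∧
      ∀ z ∈ (t.interp O.val).sol (construct t q κ), Computes O.point K z → ∃ x y b w',
        Computes O.point K x ∧ Computes O.point K y ∧ x ∈ (head O.val t).sol q ∧
        (b, w') ∈ (capp κ x : Part (Bool × Baire)) ∧ y ∈ ((t.nxt b).interp O.val).sol w' := by
  obtain ⟨γ, hγ, hγ'⟩ := exists_constructs ht h1 h
  obtain ⟨h2, h3⟩ := hγ' O.point K hq hκ
  refine ⟨h2, fun z hz hzK => ?_⟩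
  obtain ⟨x, y, b, w', h4, h5, h6, h7⟩ := hγ.2 z hz
  have h8 := h3.capp hzK h4
  exact ⟨x, y, b, w', h8.map Rt.fst, h8.map Rt.snd, h5, h6, h7⟩

theorem queries_inst_leaf {t : RegE A} {a : A} (ht : t.TopZeroFree) (hp : t.pol = .letter a)
    (r i : ℕ) : Queries O.val t (query r (O.name t i)) answerCode :=
  queries_leaf ht hp (fun d => answer_mem_dom ht d r) i

theorem computes_inst_of_resolves {Y : Finset (RegE A)} {ι : RegE A → ℕ}
    (hY : ∀ t ∈ Y, O.index (.inl (t, ι t)) ∈ K) {t : RegE A} {d : Desc} (h : Resolves Y ι t d)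
    (ht : t.TopZeroFree) (r : ℕ) : Computes O.point K (O.inst r t d) := by
  induction h with
  | one => rw [inst]; exact .of_computable (computable_triv _)
  | leaf t a hp htY =>
    rw [inst_leaf hp]
    exact (exists_answer_of_construct ht (PSimPos.ne_one_of_letter hp)
      (queries_inst_leaf ht hp r _) (computes_query (hY t htY) r) computes_answerCode).1
  | ex t b d h1 hp _ ih =>
    rw [inst_ex h1 hp]
    exact (exists_answer_of_construct ht h1 (queries_ex hp (inst_mem_dom r (ht.nxt b) d))
      computes_pt (computes_constCode (ih (ht.nxt b)))).1
  | all t d₀ d₁ hp _ _ ih₀ ih₁ =>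
    rw [inst_all hp]
    exact (exists_answer_of_construct ht (PSimPos.ne_one_of_all hp)
      (queries_all hp (inst_mem_dom r (ht.nxt _) d₀) (inst_mem_dom r (ht.nxt _) d₁))
      (computes_pair computes_pt computes_pt)
      (computes_tagCode (ih₀ (ht.nxt _)) (ih₁ (ht.nxt _)))).1

end Cipher

/-! ### Spoiler's play against a reduction -/

/-- A stage of the play against a reduction: the hypotheses of the position, the index of the
current query for every hypothesis, the answers that have been given, the layer of the position,
and the names and passwords that have been revealed. -/
structure Stage (A : Type*) where
  hyps : Finset (RegE A)
  cur : RegE A → ℕ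
  ans : RegE A → ℕ → Option Desc
  level : ℕ
  known : Finset ℕ

namespace Stage

/-- The consistency conditions on a stage. -/
structure Sound (O : Cipher A) (σ : Stage A) : Prop where
  tame : PSimPos.Tame σ.hyps
  settled : ¬ PSimPos.Pending σ.hyps
  unanswered : ∀ t ∈ σ.hyps, σ.ans t (σ.cur t) = none
  name_known : ∀ t ∈ σ.hyps, O.index (.inl (t, σ.cur t)) ∈ σ.known
  ans_known : ∀ t i d, σ.ans t i = some d → O.index (.inl (t, i)) ∈ σ.known ∧
    O.index (.inr (t, i, d)) ∈ σ.known ∧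
    ∀ r, Computes O.point σ.known (O.inst r (t.nxt false) d)
  of_name_known : ∀ t i, O.index (.inl (t, i)) ∈ σ.known →
    (∃ d, σ.ans t i = some d) ∨ (t ∈ σ.hyps ∧ i = σ.cur t)
  of_password_known : ∀ t i d, O.index (.inr (t, i, d)) ∈ σ.known → σ.ans t i = some d

/-- In view of the answers at the stage `σ`, the leaves of the instance of rank `r` with the
description `d` are hypotheses at `σ`. -/
inductive Safe (σ : Stage A) : RegE A → Desc → ℕ → Prop
  | one (r : ℕ) (h : RegE.one ∈ σ.hyps) : Safe σ RegE.one .one r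
  | unanswered (t : RegE A) (a : A) (r : ℕ) (hp : t.pol = .letter a) (ht : t ∈ σ.hyps)
      (hr : σ.level ≤ r) : Safe σ t (.leaf (σ.cur t)) r
  | answered (t : RegE A) (a : A) (i : ℕ) (d : Desc) (r : ℕ) (hp : t.pol = .letter a)
      (h : σ.ans t i = some d) (hd : Safe σ (t.nxt false) d r) : Safe σ t (.leaf i) (r + 1)
  | ex (t : RegE A) (b : Bool) (d : Desc) (r : ℕ) (h1 : t ≠ one) (hp : t.pol = .ex)
      (h : Safe σ (t.nxt b) d r) : Safe σ t (.ex b d) r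
  | all (t : RegE A) (d₀ d₁ : Desc) (r : ℕ) (hp : t.pol = .all)
      (h₀ : Safe σ (t.nxt false) d₀ r) (h₁ : Safe σ (t.nxt true) d₁ r) : Safe σ t (.all d₀ d₁) r

variable {O : Cipher A} {σ : Stage A}

theorem safe_of_resolves {t : RegE A} {d : Desc} (h : Resolves σ.hyps σ.cur t d) {r : ℕ}
    (hr : σ.level ≤ r) : σ.Safe t d r := by
  induction h with
  | one h => exact .one r h
  | leaf t a hp ht => exact .unanswered t a r hp ht hr
  | ex t b d h1 hp _ ih => exact .ex t b d r h1 hp ih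
  | all t d₀ d₁ hp _ _ ih₀ ih₁ => exact .all t d₀ d₁ r hp ih₀ ih₁

/-- A computed solution would yield an answer at each leaf it meets, hence a password. At an
unanswered leaf no password is known; at an answered one the password determines the description
that was given, and the argument continues in the answer. It could only end at `1`, which is not a
hypothesis. -/
theorem Safe.not_computes (hσ : σ.Sound O) (h1 : RegE.one ∉ σ.hyps) {t : RegE A} {d : Desc} {r : ℕ}
    (h : σ.Safe t d r) (ht : t.TopZeroFree) : Computes O.point σ.known (O.inst r t d) ∧
      ∀ z ∈ (t.interp O.val).sol (O.inst r t d), ¬ Computes O.point σ.known z := by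
  induction h with
  | one r h => exact absurd h h1
  | unanswered t a r hp hts hr =>
    rw [Cipher.inst_leaf hp]
    refine (Cipher.exists_answer_of_construct ht (PSimPos.ne_one_of_letter hp)
      (Cipher.queries_inst_leaf ht hp r _) (Cipher.computes_query (hσ.name_known t hts) r)
      Cipher.computes_answerCode).imp_right fun hz z hzs hzK => ?_
    obtain ⟨x, y, b, w', h2, -, h3, -⟩ := hz z hzs hzK
    rw [head_of_letter hp] at h3
    obtain ⟨d, rfl⟩ := Cipher.mem_sol_query.1 h3
    have h4 : Computes O.point σ.known (O.password t (σ.cur t) d) := by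
      simpa using h2.map (f := Baire.fst) (by fun_prop)
    have h5 := hσ.of_password_known _ _ _ (Cipher.password_mem h4)
    rw [hσ.unanswered t hts] at h5
    cases h5
  | answered t a i d r hp h hd ih =>
    rw [Cipher.inst_leaf hp]
    refine (Cipher.exists_answer_of_construct ht (PSimPos.ne_one_of_letter hp)
      (Cipher.queries_inst_leaf ht hp (r + 1) _) (Cipher.computes_query (hσ.ans_known t i d h).1 _)
      Cipher.computes_answerCode).imp_right fun hz z hzs hzK => ?_
    obtain ⟨x, y, b, w', h2, h3, h4, h5, h6⟩ := hz z hzs hzK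
    rw [head_of_letter hp] at h4
    obtain ⟨d', rfl⟩ := Cipher.mem_sol_query.1 h4
    have h7 : Computes O.point σ.known (O.password t i d') := by
      simpa using h2.map (f := Baire.fst) (by fun_prop)
    have h8 := hσ.of_password_known _ _ _ (Cipher.password_mem h7)
    rw [h] at h8
    cases h8
    have h9 := mem_capp_answerCode (pair (O.password t i d) (O.answer t d (r + 1)))
    obtain ⟨rfl, rfl⟩ := Prod.mk.inj (Part.mem_unique h5 h9)
    rw [snd_pair] at h6
    exact (ih (ht.nxt false)).2 y h6 h3
  | ex t b d r h1t hp _ ih =>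
    rw [Cipher.inst_ex h1t hp]
    refine (Cipher.exists_answer_of_construct ht h1t
      (Cipher.queries_ex hp (Cipher.inst_mem_dom r (ht.nxt b) d)) Cipher.computes_pt
      (Cipher.computes_constCode (ih (ht.nxt b)).1)).imp_right fun hz z hzs hzK => ?_
    obtain ⟨x, y, b', w', -, h2, -, h3, h4⟩ := hz z hzs hzK
    obtain ⟨rfl, rfl⟩ := Prod.mk.inj (Part.mem_unique h3 (mem_capp_constCode _ x))
    exact (ih (ht.nxt _)).2 y h4 h2
  | all t d₀ d₁ r hp _ _ ih₀ ih₁ =>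
    rw [Cipher.inst_all hp]
    refine (Cipher.exists_answer_of_construct ht (PSimPos.ne_one_of_all hp)
      (Cipher.queries_all hp (Cipher.inst_mem_dom r (ht.nxt _) d₀) (Cipher.inst_mem_dom r (ht.nxt _) d₁))
      (Cipher.computes_pair Cipher.computes_pt Cipher.computes_pt)
      (Cipher.computes_tagCode (ih₀ (ht.nxt _)).1 (ih₁ (ht.nxt _)).1)).imp_right
        fun hz z hzs hzK => ?_
    obtain ⟨x, y, b, w', -, h2, -, h3, h4⟩ := hz z hzs hzK
    obtain ⟨rfl, rfl⟩ := Prod.mk.inj (Part.mem_unique h3 (mem_capp_tagCode _ x))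
    cases hx : tag x
    · simp only [hx] at h4
      exact (ih₀ (ht.nxt _)).2 y h4 h2
    · simp only [hx] at h4
      exact (ih₁ (ht.nxt _)).2 y h4 h2

/-- The stage `σ'` may follow the stage `σ`. -/
structure Extends (σ σ' : Stage A) : Prop where
  known : σ.known ⊆ σ'.known
  safe : ∀ t d r, σ.Safe t d r → σ'.Safe t d r

theorem Extends.refl (σ : Stage A) : σ.Extends σ := ⟨subset_rfl, fun _ _ _ h => h⟩

theorem Extends.trans {σ σ' σ'' : Stage A} (h : σ.Extends σ') (h' : σ'.Extends σ'') :
    σ.Extends σ'' := ⟨h.known.trans h'.known, fun t d r hs => h'.safe t d r (h.safe t d r hs)⟩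

theorem exists_fresh (O : Cipher A) (K : Finset ℕ) :
    ∃ n, ∀ t, O.index (.inl (t, n)) ∉ K := by
  have hf : {x : RegE A × ℕ | O.index (.inl x) ∈ K}.Finite :=
    Set.Finite.preimage ((O.index_inj.comp Sum.inl_injective).injOn) K.finite_toSet
  obtain ⟨n, hn⟩ := (hf.image Prod.snd).exists_notMem
  exact ⟨n, fun t ht => hn ⟨(t, n), ht, rfl⟩⟩

/-- Spoiler answers the current query of `t` with the description obtained by resolving its
successor. The new hypotheses get fresh names, and the names of `Y` and one password are revealed.
-/
theorem Sound.exists_fill {L : ℕ → Set (PSimPos A)} (hL : PSimPos.Layers L) (hσ : σ.Sound O)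
    {t h : RegE A} {a : A} (ht : t ∈ σ.hyps) (hp : t.pol = .letter a)
    (hk : (⟨σ.hyps.swap t (t.nxt false), h⟩ : PSimPos A) ∈ L σ.level) :
    ∃ σ' : Stage A, σ'.Sound O ∧ σ.Extends σ' ∧ (⟨σ'.hyps, h⟩ : PSimPos A) ∈ L σ'.level ∧
      ∃ d, σ'.ans t (σ.cur t) = some d := by
  classical
  obtain ⟨Y, k, hkl, hpend, hY, hYp, hYt, hres⟩ := exists_resolves hL (hσ.tame.swap ht false) hk
  obtain ⟨n, hn⟩ := exists_fresh O σ.known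
  have hpos : 0 < σ.level := by
    rcases Nat.eq_zero_or_pos σ.level with h0 | h0
    · rw [h0, hL.zero] at hk; exact hk.elim
    · exact h0
  -- A hypothesis that was present all along keeps its open query, even when it is reached a second
  -- time. All others, including `t` should it reappear, use the fresh index `n`.
  let cur' : RegE A → ℕ := fun s => if s ∈ σ.hyps ∧ s ≠ t then σ.cur s else n
  have : Nonempty Desc := ⟨.one⟩
  choose! δ hδ using hres cur'
  let d₀ := δ (t.nxt false)
  have hd₀ : Resolves Y cur' (t.nxt false) d₀ := hδ _ (Finset.mem_swap.2 (Or.inl rfl))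
  let ans' : RegE A → ℕ → Option Desc := fun s i =>
    if s = t ∧ i = σ.cur t then some d₀ else σ.ans s i
  let K' : Finset ℕ := insert (O.index (.inr (t, σ.cur t, d₀)))
    (σ.known ∪ Y.image fun s => O.index (.inl (s, cur' s)))
  have hK : σ.known ⊆ K' := Finset.subset_union_left.trans (Finset.subset_insert _ _)
  have hnone : ∀ s, σ.ans s n = none := fun s => by
    cases hs : σ.ans s n with
    | none => rfl
    | some d => exact absurd (hσ.ans_known s n d hs).1 (hn s)
  have hnt : n ≠ σ.cur t := by
    rintro rfl
    exact hn t (hσ.name_known t ht)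
  have hans : ∀ s i d, σ.ans s i = some d → ans' s i = some d := fun s i d hs => by
    refine (if_neg ?_).trans hs
    rintro ⟨rfl, rfl⟩
    rw [hσ.unanswered s ht] at hs
    cases hs
  have hstay : ∀ s ∈ σ.hyps, s ≠ t → s ∈ Y ∧ cur' s = σ.cur s := fun s hs hst =>
    ⟨(hδ s (Finset.mem_swap.2 (Or.inr ⟨hst, hs⟩))).mem hσ.settled hs, if_pos ⟨hs, hst⟩⟩
  have hname : ∀ s ∈ Y, O.index (.inl (s, cur' s)) ∈ K' := fun s hs =>
    Finset.mem_insert_of_mem (Finset.mem_union_right _ (Finset.mem_image_of_mem _ hs))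
  let σ' : Stage A := ⟨Y, cur', ans', k, K'⟩
  have htt : t.TopZeroFree := hσ.tame t ht
  refine ⟨σ', ⟨hYt, hYp, fun s hs => ?_, hname, fun s i d hs => ?_, fun s i hs => ?_,
    fun s i d hs => ?_⟩, ⟨hK, fun s d r hs => ?_⟩, hY, d₀, if_pos ⟨rfl, rfl⟩⟩
  · change ans' s (cur' s) = none
    by_cases hst : s ∈ σ.hyps ∧ s ≠ t
    · rw [(hstay s hst.1 hst.2).2]
      exact (if_neg fun h => hst.2 h.1).trans (hσ.unanswered s hst.1)
    · have : cur' s = n := if_neg hst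
      rw [this]
      exact (if_neg fun h => hnt h.2).trans (hnone s)
  · by_cases hst : s = t ∧ i = σ.cur t
    · obtain ⟨rfl, rfl⟩ := hst
      obtain rfl : d₀ = d := Option.some.inj ((if_pos ⟨rfl, rfl⟩).symm.trans hs)
      exact ⟨hK (hσ.name_known s ht), Finset.mem_insert_self _ _,
        Cipher.computes_inst_of_resolves hname hd₀ (htt.nxt false)⟩
    · obtain ⟨h1, h2, h3⟩ := hσ.ans_known s i d ((if_neg hst).symm.trans hs)
      exact ⟨hK h1, hK h2, fun r => (h3 r).mono hK⟩
  · rcases Finset.mem_insert.1 hs with hs | hs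
    · exact absurd (O.index_inj hs) (by simp)
    rcases Finset.mem_union.1 hs with hs | hs
    · rcases hσ.of_name_known s i hs with ⟨d, hd⟩ | ⟨h1, rfl⟩
      · exact Or.inl ⟨d, hans s i d hd⟩
      · by_cases hst : s = t
        · subst hst
          exact Or.inl ⟨d₀, if_pos ⟨rfl, rfl⟩⟩
        · exact Or.inr ⟨(hstay s h1 hst).1, (hstay s h1 hst).2.symm⟩
    · obtain ⟨s', hs', he⟩ := Finset.mem_image.1 hs
      obtain ⟨rfl, rfl⟩ : s' = s ∧ cur' s' = i := by simpa using O.index_inj he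
      exact Or.inr ⟨hs', rfl⟩
  · rcases Finset.mem_insert.1 hs with hs | hs
    · obtain ⟨rfl, rfl, rfl⟩ : s = t ∧ i = σ.cur t ∧ d = d₀ := by simpa using O.index_inj hs
      exact if_pos ⟨rfl, rfl⟩
    rcases Finset.mem_union.1 hs with hs | hs
    · exact hans s i d (hσ.of_password_known s i d hs)
    · obtain ⟨s', hs', he⟩ := Finset.mem_image.1 hs
      exact absurd (O.index_inj he) (by simp)
  · induction hs with
    | one r h1 => exact .one r (hstay _ h1 (PSimPos.ne_one_of_letter hp).symm).1
    | unanswered s a r hps hs hr =>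
      by_cases hst : s = t
      · subst hst
        -- Since `L 0` is empty the level is positive, hence so is the rank of this leaf, and its
        -- answer is a genuine instance rather than the trivial one.
        obtain ⟨r, rfl⟩ : ∃ r', r = r' + 1 := ⟨r - 1, by omega⟩
        refine .answered s a _ d₀ r hps (if_pos ⟨rfl, rfl⟩) ?_
        by_cases h1 : s.nxt false = RegE.one
        · rw [h1] at hd₀ ⊢
          generalize d₀ = d at hd₀
          cases hd₀ with
          | one h => exact .one r h
          | leaf _ _ hp => cases hp
          | ex _ _ _ h1 => exact absurd rfl h1
          | all _ _ _ hp => cases hp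
        -- The successor was pending, so the level has dropped strictly, which makes up for the
        -- lower rank of the answer.
        · have := hpend ⟨_, Finset.mem_swap.2 (Or.inl rfl), h1, Or.inl (pol_nxt_of_letter hp)⟩
          exact safe_of_resolves hd₀ (by change k ≤ r; omega)
      · obtain ⟨h1, h2⟩ := hstay s hs hst
        rw [← h2]
        exact .unanswered s a r hps h1 (hkl.trans hr)
    | answered s a i d r hps h _ ih => exact .answered s a i d r hps (hans s i d h) ih
    | ex s b d r h1 hps _ ih => exact .ex s b d r h1 hps ih
    | all s d d' r hps _ _ ih ih' => exact .all s d d' r hps ih ih'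

/-- All moves of Duplicator stay in the layer, so any way of querying can be met; at a meet Spoiler
instead picks the answer along an alea move. -/
theorem Sound.exists_answer {L : ℕ → Set (PSimPos A)} (hL : PSimPos.Layers L) (hσ : σ.Sound O)
    {h : RegE A} (hh : h.TopZeroFree) (h1 : h ≠ RegE.one)
    (hk : (⟨σ.hyps, h⟩ : PSimPos A) ∈ L σ.level) {q : Baire} (hq : q ∈ (head O.val h).dom)
    (hqK : Computes O.point σ.known q) :
    ∃ (σ' : Stage A) (x : Baire), σ'.Sound O ∧ σ.Extends σ' ∧ x ∈ (head O.val h).sol q ∧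
      Computes O.point σ'.known x ∧
      ∀ b, Selects h x b → (⟨σ'.hyps, h.nxt b⟩ : PSimPos A) ∈ L σ'.level := by
  cases hp : h.pol with
  | ex =>
    rw [head_dom_of_ex hp] at hq ⊢
    exact ⟨σ, pt, hσ, .refl σ, rfl, Cipher.computes_pt, fun b _ =>
      hL.next _ _ _ _ _ hσ.settled hσ.tame hh hk (.choose b h1 hp)⟩
  | all =>
    rw [head_of_all hp] at hq ⊢
    obtain ⟨b, hb⟩ := hL.alea _ _ _ hσ.settled hh hk hp
    refine ⟨σ, inb b pt, hσ, .refl σ, (mem_sol_one_meet_one hq).2 ⟨b, rfl⟩,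
      .of_computable ((Rt.inb (Rt.bool b) Rt.id).computable computable_pt), fun b' hb' => ?_⟩
    have := hb' hp
    rw [tag_inb] at this
    rwa [← this]
  | letter a =>
    rw [head_of_letter hp] at hq ⊢
    have hjunk : ∀ b, (⟨σ.hyps, h.nxt b⟩ : PSimPos A) ∈ L σ.level := fun b => by
      rw [nxt_eq_of_letter hp]
      exact hL.next _ _ _ _ _ hσ.settled hσ.tame hh hk (.junk a hp)
    rcases hq with rfl | ⟨r, t, i, ht, htp, rfl⟩
    · exact ⟨σ, pt, hσ, .refl σ, Cipher.mem_sol_pt.2 rfl, Cipher.computes_pt, fun b _ => hjunk b⟩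
    · have hans : ∀ σ' : Stage A, σ'.Sound O → ∀ d, σ'.ans t i = some d →
          Computes O.point σ'.known (pair (O.password t i d) (O.answer t d r)) := by
        intro σ' hσ' d hd
        obtain ⟨-, h2, h3⟩ := hσ'.ans_known t i d hd
        refine Cipher.computes_pair (.col h2) ?_
        cases r with
        | zero => exact .of_computable (computable_triv _)
        | succ r => exact h3 r
      have hname : Computes O.point σ.known (O.name t i) := by
        simpa [snd_query] using hqK.map (f := Baire.snd) (by fun_prop)
      -- A computable query has a revealed name. Either it was answered before, and the same answer
      -- is repeated as for junk, or it belongs to a current hypothesis, and Spoiler fills.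
      rcases hσ.of_name_known t i (Cipher.name_mem hname) with ⟨d, hd⟩ | ⟨hts, rfl⟩
      · exact ⟨σ, _, hσ, .refl σ, Cipher.mem_sol_query.2 ⟨d, rfl⟩, hans σ hσ d hd,
          fun b _ => hjunk b⟩
      · obtain ⟨σ', h2, h3, h4, d, hd⟩ := hσ.exists_fill hL hts htp
          (hL.next _ _ _ _ _ hσ.settled hσ.tame hh hk (.fill a hp t hts htp))
        refine ⟨σ', _, h2, h3, Cipher.mem_sol_query.2 ⟨d, rfl⟩, hans σ' h2 d hd, fun b _ => ?_⟩
        rwa [nxt_eq_of_letter hp]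

/-- Induction along the terminating interaction of the goal's instance. The next instance and its
back map are computed from revealed columns only, so the invariant persists, and the run ends at
goal `1`, where `done` keeps `1` out of the hypotheses. -/
theorem Sound.exists_solution {L : ℕ → Set (PSimPos A)} (hL : PSimPos.Layers L)
    {h : RegE A} {v : Baire} (hv : v ∈ (h.interp O.val).dom) (hh : h.TopZeroFree)
    (hσ : σ.Sound O) (hk : (⟨σ.hyps, h⟩ : PSimPos A) ∈ L σ.level)
    (hvK : Computes O.point σ.known v) :
    ∃ (σ' : Stage A) (y : Baire), σ'.Sound O ∧ σ.Extends σ' ∧ RegE.one ∉ σ'.hyps ∧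
      y ∈ (h.interp O.val).sol v ∧ Computes O.point σ'.known y := by
  have hacc := acc_of_mem_dom hv
  generalize hu : (h, v) = u at hacc
  induction hacc generalizing h v σ with
  | intro u _ ih =>
    subst hu
    by_cases h1 : h = RegE.one
    · subst h1
      obtain rfl : v = pt := hv
      exact ⟨σ, pt, hσ, .refl σ, hL.done _ _ hσ.settled hk, rfl, Cipher.computes_pt⟩
    · obtain ⟨D, hD, hD'⟩ := exists_destructor O.val hh h1
      obtain ⟨q, κ, hqκ, hq, hκ⟩ := hD' v hv
      have hqκK := hvK.bind hD hqκ
      obtain ⟨σ₁, x, hσ₁, he, hx, hxK, hb⟩ :=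
        hσ.exists_answer hL hh h1 hk hq (hqκK.map Rt.fst)
      obtain ⟨b, w', β, bk, h2, h3, h4, h5⟩ := hκ x hx
      have hwβ := ((hqκK.map Rt.snd).mono he.known).capp hxK h2
      have hβ := (hwβ.map Rt.snd).map Rt.snd
      obtain ⟨hw', hbk⟩ := h4.sound hv
      obtain ⟨σ₂, y, hσ₂, he', hone, hy, hyK⟩ := ih (h.nxt b, w') ⟨x, b, bk, h4, rfl⟩ hw'
        (hh.nxt b) hσ₁ (hb b h3) ((hwβ.map Rt.snd).map Rt.fst) rfl
      exact ⟨σ₂, bk y, hσ₂, he.trans he', hone, hbk y hy,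
        (hβ.mono he'.known).capp hyK (h5 y hy)⟩

end Stage

/-! ### Validity yields a winning strategy -/

theorem duplicatorWins_of_pointedValid [Countable A] {e f : RegE A} (he : e.TopZeroFree)
    (hf : f.TopZeroFree) (h : PointedValid e f) : (psimGame A).DuplicatorWins ⟨{e}, f⟩ := by
  classical
  by_contra hno
  obtain ⟨L, hL, N, hN⟩ := PSimPos.exists_psim_layers hno
  obtain ⟨O⟩ := nonempty_cipher (A := A)
  have htame : PSimPos.Tame {e} := fun t ht => by rwa [Finset.mem_singleton.1 ht]
  obtain ⟨Y, k, hk, -, hY, hYp, hYt, hres⟩ := exists_resolves hL htame hN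
  obtain ⟨d, hd⟩ := hres (fun _ => 0) e (Finset.mem_singleton_self e)
  -- Initially only the names of the resolved hypotheses are revealed, all at index `0`, and nothing
  -- has been answered.
  let σ : Stage A := ⟨Y, fun _ => 0, fun _ _ => none, k, Y.image fun s => O.index (.inl (s, 0))⟩
  have hname : ∀ t ∈ Y, O.index (.inl (t, 0)) ∈ σ.known := fun t ht =>
    Finset.mem_image_of_mem _ ht
  have hσ : σ.Sound O := by
    refine ⟨hYt, hYp, fun _ _ => rfl, hname, nofun, fun t i ht => ?_, fun t i d ht => ?_⟩
    · obtain ⟨s, hs, he⟩ := Finset.mem_image.1 ht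
      obtain ⟨rfl, rfl⟩ : s = t ∧ 0 = i := by simpa using O.index_inj he
      exact Or.inr ⟨hs, rfl⟩
    · obtain ⟨s, hs, he⟩ := Finset.mem_image.1 ht
      exact absurd (O.index_inj he) (by simp)
  obtain ⟨φ, ψ, hφ, hψ, hred⟩ := h O.val fun a => ⟨Cipher.val_isOrdinary a, Cipher.val_isPointed a⟩
  have hu : Computes O.point σ.known (O.inst N e d) :=
    Cipher.computes_inst_of_resolves hname hd he N
  obtain ⟨v, hv, huv, hsol⟩ := hred (O.inst N e d) (Cipher.inst_mem_dom N he d)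
  have hvK : Computes O.point σ.known v :=
    (Computes.of_computable hφ).capp hu (mem_capp.2 huv)
  obtain ⟨σ', y, hσ', hext, hone, hy, hyK⟩ := hσ.exists_solution hL hv hf hY hvK
  obtain ⟨x, hx, hxy⟩ := hsol y hy
  have hsafe := hext.safe e d N (Stage.safe_of_resolves hd hk)
  -- The rank `N` bounds the initial level, so the original instance is safe at the last stage. Yet
  -- the reduction computes a solution of it from the revealed columns.
  refine (hsafe.not_computes hσ' hone he).2 x hx ?_
  exact (Computes.of_computable hψ).capp
    (Cipher.computes_pair (hu.mono hext.known) hyK) (mem_capp.2 hxy)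

end RegE

theorem mainTheorem2 {A : Type*} [Finite A] (e f : RegE A)
    (he : e.TopZeroFree) (hf : f.TopZeroFree) :
    RegE.PointedValid e f ↔ (psimGame A).DuplicatorWins ⟨{e}, f⟩ :=
  ⟨RegE.duplicatorWins_of_pointedValid he hf, RegE.pointedValid_of_duplicatorWins he hf⟩
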